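/- **Setting.** Write $[n]=\{1,\dots,n\}$ and $\log x:=\max(\ln x,1)$. There are $n$ arms; arm $i$ has a $1$-sub-Gaussian reward law $\nu_i$ with mean $\mu_i$, where $\mu_1\ge\dots\ge\mu_n$ and $\mu_0,\mu_1,\dots,\mu_n\in[0,1]$ ($\mu_0$ is a threshold). Let $\mathcal H_1=\{i:\mu_i>\mu_0\}$, $\mathcal H_0=\{i:\mu_i\le\mu_0\}$, $m=|\mathcal H_1|$, $1\le k\le m$, $0<\delta\le 1/40$. Put $\Delta_{j,i}=\mu_j-\mu_i$, $\Delta_{j,0}=\mu_j-\mu_0$ and $\Delta_{i\vee j,0}=\max(\Delta_{i,0},\Delta_{j,0})$. *Confidence bound.* $U(u,\alpha)=c_U\sqrt{\tfrac1u\log(\log(u)/\alpha)}$ for $u\geq 1$, where $c_U$ is a constant for which $U$ is an anytime confidence bound: for every $1$-sub-Gaussian law $\nu$ and every $\alpha\in(0,1)$, the empirical means $\widehat\mu_u$ of i.i.d. samples of $\nu$ satisfy $\mathbb P(\forall u\ge1:\ |\widehat\mu_u-\mathbb E_\nu|\le U(u,\alpha))\ge1-\alpha$, where $\mathbb E_\nu$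 is the mean of $\nu$. Such constants exist. *Algorithms.* Brackets $A_1,A_2,\dots\subseteq[n]$ are independent, $A_r$ is uniform among the sets of $\min(n,2^r)$ arms, and for every arm $i$ and bracket $r$ there is an independent i.i.d. sequence of samples of $\nu_i$ (samples are not shared across brackets). Let $\ell=0$, $R_0=0$. In round $t=1,2,\dots$: if $t\ge2^\ell\ell$, then $\ell$ is increased by one (bracket $A_{\ell+1}$ is opened); $R_t=1+R_{t-1}\mathbf 1\{R_{t-1}<\ell\}$; one arm $I_t$ is pulled in bracket $R_t$. $T_{i,r}(t)$ is the number of pulls of $i$ in bracket $r$ before the pull of round $t$, and $\widehat\mu_{i,r,u}$ is the mean of the first $u$ samples of $i$ in $r$. FWER-TPR: $\mathcal Q_0=\mathcal Q_1=\emptyset$. If some $i\in A_{R_t}$ has $T_{i,R_t}(t)=0$, pull any such arm and let $\mathcal Q_{t+1}=\mathcal Q_t$. Otherwise pull a maximizer of $\widehat\mu_{i,R_t,T_{i,R_t}(t)}+U(T_{i,R_t}(t),\delta)$ over $i\in A_{R_t}\setminus\mathcal Q_t$ and let $\mathcal Q_{t+1}=\mathcal Q_t\cup\{i\in A_{R_t}:\widehat\mu_{i,R_t,T_{i,R_t}(t)}-U(T_{i,R_t}(t),\tfrac{\delta}{|A_{R_t}|R_t^2})\ge\mu_0\}$.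 FDR-TPR: $\mathcal S_0=\mathcal S_1=\emptyset$. If some $i\in A_{R_t}\setminus\mathcal S_t$ has $T_{i,R_t}(t)=0$, pull any such arm; otherwise pull a maximizer of the same upper confidence bound over $A_{R_t}\setminus\mathcal S_t$. In every round $t\geq 1$, with $\delta_r=\delta/r^2$, $\delta'_r=\delta_r/(6.4\log(36/\delta_r))$ and $s(p)=\{i\in A_{R_t}: T_{i,R_t}(t)\ge1,\ \widehat\mu_{i,R_t,T_{i,R_t}(t)}-U(T_{i,R_t}(t),\tfrac{p}{|A_{R_t}|}\delta'_{R_t})\ge\mu_0\}$, let $\mathcal S_{t+1}=\mathcal S_t\cup s(\widehat p)$, where $\widehat p$ is the largest $p\in\{1,\dots,|A_{R_t}|\}$ with $|s(p)|\ge p$ ($\mathcal S_{t+1}=\mathcal S_t$ if there is none). Ties are broken arbitrarily, and an arbitrary arm is pulled if the set of candidates is empty. $\mathcal F_t$ is generated by the pulled arms, observed rewards and output sets ($\mathcal Q_s$, resp. $\mathcal S_s$) of rounds $1\le s\le t$. **Theorem.** For $k\le j\le m$ let $$\mathcal H_{\mathrm{FWER}}(\mu_0;j)=\frac kj\Big(\sum_{i=1}^m\Delta_{i\vee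 j,0}^{-2}\log\big(\tfrac{nk}{j\delta}\log(\Delta_{i\vee j,0}^{-2})\big)+\sum_{i=m+1}^n\Delta_{j,i}^{-2}\log\big(\tfrac{\log(\Delta_{j,i}^{-2})}{\delta}\big)\Big).$$ There is a constant $c>0$, depending only on $c_U$, such that the following hold. 1. For the FWER-TPR algorithm, $\mathbb P(\exists t:\mathcal Q_t\cap\mathcal H_0\ne\emptyset)\le2\delta$, and there is a stopping time $\tau_k$ with respect to $(\mathcal F_t)$ such that $$\mathbb E[\tau_k]\le c\min_{k\le j\le m}\mathcal H_{\mathrm{FWER}}(\mu_0;j)\,\log\Big(\mathcal H_{\mathrm{FWER}}(\mu_0;j)+\Delta_{j,0}^{-2}\log\big(\tfrac njk\log(\Delta_{j,0}^{-2})/\delta\big)\Big)$$ and $\mathbb E[|\mathcal Q_t\cap\mathcal H_1|]\ge(1-\delta)k$ for all (possibly random) times $t\ge\tau_k$. 2. For the FDR-TPR algorithm there is a stopping time $\tau_k$ with respect to its filtration satisfying the same bound on $\mathbb E[\tau_k]$ and $\mathbb E[|\mathcal S_t\cap\mathcal H_1|]\ge(1-\delta)k$ for all (possibly random) times $t\ge\tau_k$.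 -/

import Mathlib

open MeasureTheory ProbabilityTheory
open scoped ENNReal

noncomputable section

namespace InfiniteUCB

/-! ### Confidence bounds -/

/-- The truncated logarithm `max (ln x) 1`. -/
def tlog (x : ℝ) : ℝ := max (Real.log x) 1

/-- The confidence width `U(u, α) = c √(log (log u / α) / u)`; it is only used for `u ≥ 1`. -/
def confWidth (c : ℝ) (u : ℕ) (α : ℝ) : ℝ := c * √(tlog (tlog u / α) / u)

/-- A probability measure on `ℝ` is `1`-sub-Gaussian (after centering). -/
def IsOneSubGaussian (ν : Measure ℝ) : Prop :=
  HasSubgaussianMGF (fun y => y - ∫ z, z ∂ν) 1 ν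

/-- With the constant `c`, the width `U` is an anytime confidence bound for empirical means of i.i.d.
samples of every `1`-sub-Gaussian law. -/
def IsAnytimeBound (c : ℝ) : Prop :=
  ∀ ν : Measure ℝ, IsProbabilityMeasure ν → IsOneSubGaussian ν →
    ∀ α : ℝ, 0 < α → α < 1 →
      ENNReal.ofReal (1 - α) ≤ Measure.infinitePi (fun _ : ℕ => ν)
        {y | ∀ u : ℕ, 1 ≤ u →
          |(∑ s ∈ Finset.range u, y s) / u - ∫ z, z ∂ν| ≤ confWidth c u α}

/-! ### The schedule: number of open brackets and the bracket played in each round -/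

/-- `numOpen t` is the number `ℓ` of brackets that are open when an arm is pulled in round `t`. -/
def numOpen : ℕ → ℕ
  | 0 => 0
  | t + 1 => if 2 ^ numOpen t * numOpen t ≤ t + 1 then numOpen t + 1 else numOpen t

/-- The bracket `R_t` played in round `t ≥ 1` (and `R_0 = 0`). -/
def bracket : ℕ → ℕ
  | 0 => 0
  | t + 1 => 1 + if bracket t < numOpen (t + 1) then bracket t else 0

/-! ### Runs of the algorithm along one sample path

`A r` is the set of arms of bracket `r`, `x i r s` is the `(s + 1)`-st sample of arm `i` in bracket
`r` (samples are not shared across brackets), and `I t` is the arm pulled in round `t ≥ 1`. -/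

section Path

variable {n : ℕ}

/-- `T_{i,r}(t)`: the number of pulls of arm `i` in bracket `r` in the rounds before round `t`, that
is, the pulls on which the decisions in round `t` are based. -/
def pulls (I : ℕ → Fin n) (i : Fin n) (r t : ℕ) : ℕ :=
  {s ∈ Finset.Ico 1 t | bracket s = r ∧ I s = i}.card

/-- The empirical mean of arm `i` in bracket `r` after `u` pulls. -/
def empMean (x : Fin n → ℕ → ℕ → ℝ) (i : Fin n) (r u : ℕ) : ℝ :=
  (∑ s ∈ Finset.range u, x i r s) / u

/-- The reward observed in round `t`. -/
def reward (x : Fin n → ℕ → ℕ → ℝ) (I : ℕ → Fin n) (t : ℕ) : ℝ :=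
  x (I t) (bracket t) (pulls I (I t) (bracket t) t)

/-- The upper confidence bound of arm `i` of the bracket played in round `t`. -/
def ucb (c δ : ℝ) (x : Fin n → ℕ → ℕ → ℝ) (I : ℕ → Fin n) (t : ℕ) (i : Fin n) : ℝ :=
  empMean x i (bracket t) (pulls I i (bracket t) t) + confWidth c (pulls I i (bracket t) t) δ

open Classical in
/-- The arms of the bracket played in round `t` whose lower confidence bound at level `α` is at least
`μ₀`. An arm without any pull in this bracket has lower confidence bound `-∞`. -/
def lcbAbove (c μ₀ α : ℝ) (A : ℕ → Finset (Fin n)) (x : Fin n → ℕ → ℕ → ℝ) (I : ℕ → Fin n)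
    (t : ℕ) : Finset (Fin n) :=
  {i ∈ A (bracket t) | 0 < pulls I i (bracket t) t ∧
    μ₀ ≤ empMean x i (bracket t) (pulls I i (bracket t) t)
      - confWidth c (pulls I i (bracket t) t) α}

/-- The arms of `B` that have not been pulled yet in the bracket played in round `t`. -/
def unpulled (B : Finset (Fin n)) (I : ℕ → Fin n) (t : ℕ) : Finset (Fin n) :=
  {i ∈ B | pulls I i (bracket t) t = 0}

/-- The pull in round `t`: if `new` is nonempty, an arbitrary arm of `new`; otherwise a maximizer of
the upper confidence bound over `cand`, with ties broken arbitrarily (if `cand` is empty as well, an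
arbitrary arm). -/
def PullRule (c δ : ℝ) (x : Fin n → ℕ → ℕ → ℝ) (I : ℕ → Fin n) (t : ℕ)
    (new cand : Finset (Fin n)) : Prop :=
  (new.Nonempty → I t ∈ new) ∧
  (new = ∅ → cand.Nonempty → I t ∈ cand ∧ ∀ i ∈ cand, ucb c δ x I t i ≤ ucb c δ x I t (I t))

/-- The sets `Q_t` of the FWER-TPR algorithm (`Q_0 = Q_1 = ∅`). They are updated in the rounds in
which every arm of the current bracket has already been pulled in this bracket. -/
def fwerSet (c μ₀ δ : ℝ) (A : ℕ → Finset (Fin n)) (x : Fin n → ℕ → ℕ → ℝ) (I : ℕ → Fin n) :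
    ℕ → Finset (Fin n)
  | 0 => ∅
  | t + 1 =>
    if t = 0 ∨ (unpulled (A (bracket t)) I t).Nonempty then fwerSet c μ₀ δ A x I t
    else fwerSet c μ₀ δ A x I t ∪
      lcbAbove c μ₀ (δ / ((A (bracket t)).card * (bracket t : ℝ) ^ 2)) A x I t

/-- `I` is a run of the FWER-TPR algorithm. -/
def IsFWERRun (c μ₀ δ : ℝ) (A : ℕ → Finset (Fin n)) (x : Fin n → ℕ → ℕ → ℝ) (I : ℕ → Fin n) :
    Prop :=
  ∀ t, 1 ≤ t → PullRule c δ x I t (unpulled (A (bracket t)) I t)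
    (A (bracket t) \ fwerSet c μ₀ δ A x I t)

/-- `δ'_r = δ_r / (6.4 log (36 / δ_r))` with `δ_r = δ / r²`. -/
def fdrLevel (δ : ℝ) (r : ℕ) : ℝ :=
  (δ / (r : ℝ) ^ 2) / (6.4 * tlog (36 / (δ / (r : ℝ) ^ 2)))

/-- The set `s(p)` of the Benjamini-Hochberg step in round `t`. -/
def bhSet (c μ₀ δ : ℝ) (A : ℕ → Finset (Fin n)) (x : Fin n → ℕ → ℕ → ℝ) (I : ℕ → Fin n)
    (t p : ℕ) : Finset (Fin n) :=
  lcbAbove c μ₀ ((p : ℝ) / (A (bracket t)).card * fdrLevel δ (bracket t)) A x I t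

/-- The largest `p` with `1 ≤ p ≤ |A_{R_t}|` and `|s(p)| ≥ p`; it is `0` if there is none. -/
def bhIndex (c μ₀ δ : ℝ) (A : ℕ → Finset (Fin n)) (x : Fin n → ℕ → ℕ → ℝ) (I : ℕ → Fin n)
    (t : ℕ) : ℕ :=
  {p ∈ Finset.Icc 1 (A (bracket t)).card | p ≤ (bhSet c μ₀ δ A x I t p).card}.sup id

/-- The sets `S_t` of the FDR-TPR algorithm (`S_0 = S_1 = ∅`). -/
def fdrSet (c μ₀ δ : ℝ) (A : ℕ → Finset (Fin n)) (x : Fin n → ℕ → ℕ → ℝ) (I : ℕ → Fin n) :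
    ℕ → Finset (Fin n)
  | 0 => ∅
  | t + 1 =>
    if t = 0 ∨ bhIndex c μ₀ δ A x I t = 0 then fdrSet c μ₀ δ A x I t
    else fdrSet c μ₀ δ A x I t ∪ bhSet c μ₀ δ A x I t (bhIndex c μ₀ δ A x I t)

/-- `I` is a run of the FDR-TPR algorithm. -/
def IsFDRRun (c μ₀ δ : ℝ) (A : ℕ → Finset (Fin n)) (x : Fin n → ℕ → ℕ → ℝ) (I : ℕ → Fin n) :
    Prop :=
  ∀ t, 1 ≤ t → PullRule c δ x I t
    (unpulled (A (bracket t) \ fdrSet c μ₀ δ A x I t) I t)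
    (A (bracket t) \ fdrSet c μ₀ δ A x I t)

end Path

/-! ### The probabilistic model -/

section Model

variable {n : ℕ} {Ω : Type*} [mΩ : MeasurableSpace Ω]

/-- All samples and all brackets are mutually independent, every sample of arm `i` has law `ν i`, and
bracket `r` is uniformly distributed on the sets of `min n (2 ^ r)` arms. -/
structure IsModel (P : Measure Ω) (ν : Fin n → Measure ℝ) (A : Ω → ℕ → Finset (Fin n))
    (X : Ω → Fin n → ℕ → ℕ → ℝ) : Prop where
  measurable_brackets : Measurable A
  measurable_samples : Measurable X
  law_samples : ∀ i r s, P.map (fun ω => X ω i r s) = ν i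
  law_brackets : ∀ r, ∀ B : Finset (Fin n), B.card = min n (2 ^ r) →
    P {ω | A ω r = B} = ((n.choose (min n (2 ^ r)) : ℕ) : ℝ≥0∞)⁻¹
  indep_samples : iIndepFun (fun (q : Fin n × ℕ × ℕ) ω => X ω q.1 q.2.1 q.2.2) P
  indep_brackets : iIndepFun (fun r ω => A ω r) P
  indep_samples_brackets : IndepFun X A P

/-- The filtration `F_t = σ((I_s, reward_s, out_s) : 1 ≤ s ≤ t)` generated by the play, where `out_s`
is the set that is output in round `s`. -/
def playFiltration (X : Ω → Fin n → ℕ → ℕ → ℝ) (I : Ω → ℕ → Fin n) (out : Ω → ℕ → Finset (Fin n))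
    (hX : ∀ t, Measurable fun ω => reward (X ω) (I ω) t) (hI : Measurable I)
    (hout : ∀ t, Measurable fun ω => out ω t) : Filtration ℕ mΩ where
  seq t := ⨆ s ∈ Finset.Icc 1 t, MeasurableSpace.comap
    (fun ω => (I ω s, reward (X ω) (I ω) s, out ω s)) inferInstance
  mono' := by
    intro a b hab
    refine biSup_mono fun s hs => ?_
    simp only [Finset.mem_Icc] at hs ⊢
    omega
  le' := by
    intro t
    refine iSup₂_le fun s _ => ?_
    have hIs : Measurable fun ω => I ω s := (measurable_pi_apply s).comp hI
    exact (hIs.prodMk ((hX s).prodMk (hout s))).comap_le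

/-! Measurability of the quantities computed by the algorithm. -/

lemma measurable_comp_countable {ι β : Type*} [Countable ι] [MeasurableSpace ι]
    [MeasurableSingletonClass ι] [MeasurableSpace β] (g : ι → Ω → β) (hg : ∀ q, Measurable (g q))
    {h : Ω → ι} (hh : Measurable h) : Measurable fun ω => g (h ω) ω :=
  (measurable_from_prod_countable_right (f := fun q : ι × Ω => g q.1 q.2) hg).comp
    (hh.prodMk measurable_id)

lemma measurable_pulls {I : Ω → ℕ → Fin n} (hI : Measurable I) (i : Fin n) (r t : ℕ) :
    Measurable fun ω => pulls (I ω) i r t := by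
  have h : ∀ s, Measurable fun ω => I ω s := fun s => (measurable_pi_apply s).comp hI
  have h2 : Measurable fun ω => {s ∈ Finset.Ico 1 t | bracket s = r ∧ I ω s = i} := by
    refine measurable_finset_iff.2 fun s => ?_
    simp only [Finset.mem_filter]
    exact (measurable_const).and ((measurable_const).and
      (measurableSet_setOfPred.1 (h s (measurableSet_singleton i))))
  exact (measurable_of_countable Finset.card).comp h2

lemma measurable_union {B B' : Ω → Finset (Fin n)} (hB : Measurable B) (hB' : Measurable B') :
    Measurable fun ω => B ω ∪ B' ω := by
  refine measurable_finset_iff.2 fun i => ?_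
  simp only [Finset.mem_union]
  exact ((measurable_finset_mem i).comp hB).or ((measurable_finset_mem i).comp hB')

lemma measurable_sample {X : Ω → Fin n → ℕ → ℕ → ℝ} (hX : Measurable X) (i : Fin n) (r s : ℕ) :
    Measurable fun ω => X ω i r s := by fun_prop

lemma measurable_reward {X : Ω → Fin n → ℕ → ℕ → ℝ} {I : Ω → ℕ → Fin n} (hX : Measurable X)
    (hI : Measurable I) (t : ℕ) : Measurable fun ω => reward (X ω) (I ω) t := by
  have h : ∀ s, Measurable fun ω => I ω s := fun s => (measurable_pi_apply s).comp hI
  have h1 : ∀ q : Fin n × ℕ, Measurable fun ω => X ω q.1 (bracket t) q.2 := fun q => by fun_prop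
  have h2 : ∀ i : Fin n, Measurable fun ω => (i, pulls (I ω) i (bracket t) t) := fun i =>
    measurable_const.prodMk (measurable_pulls hI i _ _)
  have h3 : Measurable fun ω => (I ω t, pulls (I ω) (I ω t) (bracket t) t) :=
    measurable_comp_countable (fun i ω => (i, pulls (I ω) i (bracket t) t)) h2 (h t)
  exact measurable_comp_countable (fun (q : Fin n × ℕ) ω => X ω q.1 (bracket t) q.2) h1 h3

lemma measurable_card_bracket {A : Ω → ℕ → Finset (Fin n)} (hA : Measurable A) (r : ℕ) :
    Measurable fun ω => (A ω r).card :=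
  (measurable_of_countable Finset.card).comp ((measurable_pi_apply r).comp hA)

lemma measurable_lcb {X : Ω → Fin n → ℕ → ℕ → ℝ} (hX : Measurable X) (c : ℝ) (i : Fin n) (r : ℕ)
    {u : Ω → ℕ} (hu : Measurable u) {a : Ω → ℝ} (ha : Measurable a) :
    Measurable fun ω => empMean (X ω) i r (u ω) - confWidth c (u ω) (a ω) := by
  refine measurable_comp_countable
    (fun (q : ℕ) ω => empMean (X ω) i r q - confWidth c q (a ω)) (fun q => ?_) hu
  have h1 : Measurable fun ω => empMean (X ω) i r q := by
    unfold empMean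
    fun_prop
  have h2 : Measurable fun y : ℝ => confWidth c q y := by
    unfold confWidth tlog
    fun_prop
  exact h1.sub (h2.comp ha)

lemma measurable_lcbAbove {A : Ω → ℕ → Finset (Fin n)} {X : Ω → Fin n → ℕ → ℕ → ℝ}
    {I : Ω → ℕ → Fin n} (hA : Measurable A) (hX : Measurable X) (hI : Measurable I) (c μ₀ : ℝ)
    (f : ℕ → ℝ) (t : ℕ) :
    Measurable fun ω => lcbAbove c μ₀ (f (A ω (bracket t)).card) (A ω) (X ω) (I ω) t := by
  have hu : ∀ i, Measurable fun ω => pulls (I ω) i (bracket t) t := fun i =>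
    measurable_pulls hI i _ _
  have ha : Measurable fun ω => f (A ω (bracket t)).card :=
    (measurable_of_countable f).comp (measurable_card_bracket hA _)
  have hB : Measurable fun ω => A ω (bracket t) := (measurable_pi_apply _).comp hA
  refine measurable_finset_iff.2 fun i => ?_
  simp only [lcbAbove, Finset.mem_filter]
  have h5 : MeasurableSet {ω | 0 < pulls (I ω) i (bracket t) t} :=
    measurableSet_lt measurable_const (hu i)
  have h6 : MeasurableSet {ω | μ₀ ≤ empMean (X ω) i (bracket t) (pulls (I ω) i (bracket t) t)
      - confWidth c (pulls (I ω) i (bracket t) t) (f (A ω (bracket t)).card)} :=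
    measurableSet_le measurable_const (measurable_lcb hX c i _ (hu i) ha)
  exact ((measurable_finset_mem i).comp hB).and
    ((measurableSet_setOfPred.1 h5).and (measurableSet_setOfPred.1 h6))

lemma measurable_unpulled {B : Ω → Finset (Fin n)} {I : Ω → ℕ → Fin n} (hB : Measurable B)
    (hI : Measurable I) (t : ℕ) : Measurable fun ω => unpulled (B ω) (I ω) t := by
  refine measurable_finset_iff.2 fun i => ?_
  simp only [unpulled, Finset.mem_filter]
  exact ((measurable_finset_mem i).comp hB).and (measurableSet_setOfPred.1
    (measurable_pulls hI i (bracket t) t (measurableSet_singleton 0)))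

lemma measurable_fwerSet {A : Ω → ℕ → Finset (Fin n)} {X : Ω → Fin n → ℕ → ℕ → ℝ}
    {I : Ω → ℕ → Fin n} (hA : Measurable A) (hX : Measurable X) (hI : Measurable I) (c μ₀ δ : ℝ)
    (t : ℕ) : Measurable fun ω => fwerSet c μ₀ δ (A ω) (X ω) (I ω) t := by
  induction t with
  | zero => exact measurable_const
  | succ t ih =>
    have hu := measurable_unpulled ((measurable_pi_apply (bracket t)).comp hA) hI t
    have hl := measurable_lcbAbove hA hX hI c μ₀
      (fun m => δ / (m * (bracket t : ℝ) ^ 2)) t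
    have h1 : MeasurableSet
        {ω | t = 0 ∨ (unpulled (A ω (bracket t)) (I ω) t).Nonempty} :=
      (MeasurableSet.const _).union (hu (Set.to_countable {B : Finset (Fin n) | B.Nonempty}).measurableSet)
    simp only [fwerSet]
    exact Measurable.ite h1 ih (measurable_union ih hl)

lemma measurable_bhSet {A : Ω → ℕ → Finset (Fin n)} {X : Ω → Fin n → ℕ → ℕ → ℝ}
    {I : Ω → ℕ → Fin n} (hA : Measurable A) (hX : Measurable X) (hI : Measurable I) (c μ₀ δ : ℝ)
    (t p : ℕ) : Measurable fun ω => bhSet c μ₀ δ (A ω) (X ω) (I ω) t p :=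
  measurable_lcbAbove hA hX hI c μ₀ (fun m => (p : ℝ) / m * fdrLevel δ (bracket t)) t

lemma measurable_bhIndex {A : Ω → ℕ → Finset (Fin n)} {X : Ω → Fin n → ℕ → ℕ → ℝ}
    {I : Ω → ℕ → Fin n} (hA : Measurable A) (hX : Measurable X) (hI : Measurable I) (c μ₀ δ : ℝ)
    (t : ℕ) : Measurable fun ω => bhIndex c μ₀ δ (A ω) (X ω) (I ω) t := by
  have h : Measurable fun ω => {p ∈ Finset.Icc 1 (A ω (bracket t)).card |
      p ≤ (bhSet c μ₀ δ (A ω) (X ω) (I ω) t p).card} := by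
    refine measurable_finset_iff.2 fun p => ?_
    simp only [Finset.mem_filter, Finset.mem_Icc]
    refine (Measurable.and measurable_const ?_).and ?_
    · exact measurableSet_setOfPred.1
        (measurableSet_le measurable_const (measurable_card_bracket hA _))
    · exact measurableSet_setOfPred.1 (measurableSet_le measurable_const
        ((measurable_of_countable Finset.card).comp (measurable_bhSet hA hX hI c μ₀ δ t p)))
  exact (measurable_of_countable (fun B : Finset ℕ => B.sup id)).comp h

lemma measurable_fdrSet {A : Ω → ℕ → Finset (Fin n)} {X : Ω → Fin n → ℕ → ℕ → ℝ}
    {I : Ω → ℕ → Fin n} (hA : Measurable A) (hX : Measurable X) (hI : Measurable I) (c μ₀ δ : ℝ)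
    (t : ℕ) : Measurable fun ω => fdrSet c μ₀ δ (A ω) (X ω) (I ω) t := by
  induction t with
  | zero => exact measurable_const
  | succ t ih =>
    have hi := measurable_bhIndex hA hX hI c μ₀ δ t
    have hb : Measurable fun ω => bhSet c μ₀ δ (A ω) (X ω) (I ω) t
        (bhIndex c μ₀ δ (A ω) (X ω) (I ω) t) :=
      measurable_comp_countable (fun p ω => bhSet c μ₀ δ (A ω) (X ω) (I ω) t p)
        (measurable_bhSet hA hX hI c μ₀ δ t) hi
    have h1 : MeasurableSet {ω | t = 0 ∨ bhIndex c μ₀ δ (A ω) (X ω) (I ω) t = 0} :=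
      (MeasurableSet.const _).union (hi (measurableSet_singleton 0))
    simp only [fdrSet]
    exact Measurable.ite h1 ih (measurable_union ih hb)

/-- The filtration generated by playing the FWER-TPR algorithm. -/
def fwerFiltration {P : Measure Ω} {ν : Fin n → Measure ℝ} {A : Ω → ℕ → Finset (Fin n)}
    {X : Ω → Fin n → ℕ → ℕ → ℝ} (hM : IsModel P ν A X) {I : Ω → ℕ → Fin n} (hI : Measurable I)
    (c μ₀ δ : ℝ) : Filtration ℕ mΩ :=
  playFiltration X I (fun ω => fwerSet c μ₀ δ (A ω) (X ω) (I ω))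
    (measurable_reward hM.measurable_samples hI) hI
    (measurable_fwerSet hM.measurable_brackets hM.measurable_samples hI c μ₀ δ)

/-- The filtration generated by playing the FDR-TPR algorithm. -/
def fdrFiltration {P : Measure Ω} {ν : Fin n → Measure ℝ} {A : Ω → ℕ → Finset (Fin n)}
    {X : Ω → Fin n → ℕ → ℕ → ℝ} (hM : IsModel P ν A X) {I : Ω → ℕ → Fin n} (hI : Measurable I)
    (c μ₀ δ : ℝ) : Filtration ℕ mΩ :=
  playFiltration X I (fun ω => fdrSet c μ₀ δ (A ω) (X ω) (I ω))
    (measurable_reward hM.measurable_samples hI) hI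
    (measurable_fdrSet hM.measurable_brackets hM.measurable_samples hI c μ₀ δ)

end Model

/-! ### Means, gaps and the complexity -/

section Complexity

variable {n : ℕ}

open Classical in
/-- `H₁`: the arms with mean above the threshold. -/
def armsAbove (μ : Fin n → ℝ) (μ₀ : ℝ) : Finset (Fin n) := {i | μ₀ < μ i}

open Classical in
/-- `H₀`: the arms with mean at most the threshold. -/
def armsBelow (μ : Fin n → ℝ) (μ₀ : ℝ) : Finset (Fin n) := {i | μ i ≤ μ₀}

/-- The gap `Δ_{i∨j,0}`: the gap to the threshold of the better one of the arms `i` and `j`. -/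
def topGap (μ : Fin n → ℝ) (μ₀ : ℝ) (i j : Fin n) : ℝ := max (μ i - μ₀) (μ j - μ₀)

/-- The complexity `H_FWER(μ₀; j)`. The arm `j : Fin n` has rank `j + 1`. -/
def hFWER (μ : Fin n → ℝ) (μ₀ δ : ℝ) (k : ℕ) (j : Fin n) : ℝ :=
  (k : ℝ) / ((j : ℝ) + 1) *
    (∑ i ∈ armsAbove μ μ₀, topGap μ μ₀ i j ^ (-2 : ℤ) *
        tlog ((n : ℝ) * k / (((j : ℝ) + 1) * δ) * tlog (topGap μ μ₀ i j ^ (-2 : ℤ)))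
      + ∑ i ∈ armsBelow μ μ₀, (μ j - μ i) ^ (-2 : ℤ) *
        tlog (tlog ((μ j - μ i) ^ (-2 : ℤ)) / δ))

/-- `H log (H + Δ_{j,0}⁻² log ((n / j) k log (Δ_{j,0}⁻²) / δ))` with `H = H_FWER(μ₀; j)`. -/
def sampleBound (μ : Fin n → ℝ) (μ₀ δ : ℝ) (k : ℕ) (j : Fin n) : ℝ :=
  hFWER μ μ₀ δ k j * tlog (hFWER μ μ₀ δ k j + (μ j - μ₀) ^ (-2 : ℤ) *
    tlog ((n : ℝ) / ((j : ℝ) + 1) * k * tlog ((μ j - μ₀) ^ (-2 : ℤ)) / δ))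

end Complexity

/-- The detection guarantee with sample complexity: there is a stopping time `τ` with
`E[τ] ≤ C · min_{k ≤ j ≤ m} sampleBound j` such that `E |out_σ ∩ H₁| ≥ (1 - δ) k` for every random
time `σ ≥ τ`. -/
def Detects {n : ℕ} {Ω : Type*} [mΩ : MeasurableSpace Ω] (P : Measure Ω) (ℱ : Filtration ℕ mΩ)
    (out : Ω → ℕ → Finset (Fin n)) (μ : Fin n → ℝ) (μ₀ δ : ℝ) (k : ℕ) (C : ℝ) : Prop :=
  ∃ τ : Ω → ℕ∞, IsStoppingTime ℱ τ ∧
    (∀ j : Fin n, k ≤ (j : ℕ) + 1 → (j : ℕ) + 1 ≤ (armsAbove μ μ₀).card →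
      ∫⁻ ω, ((τ ω : ℕ∞) : ℝ≥0∞) ∂P ≤ ENNReal.ofReal (C * sampleBound μ μ₀ δ k j)) ∧
    ∀ σ : Ω → ℕ, Measurable σ → (∀ᵐ ω ∂P, τ ω ≤ (σ ω : ℕ∞)) →
      (1 - δ) * k ≤ ∫ ω, ((out ω (σ ω) ∩ armsAbove μ μ₀).card : ℝ) ∂P

end InfiniteUCB

end

open InfiniteUCB

/-! Fix a rank `j` that minimises the bound over `k ≤ j ≤ m`, put `θ = μ j`, and call the arms of
rank at most `j` good. Call an arm of a bracket active if it has not been output and has no upper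
confidence bound below `θ`. While some arm is active, a pulled arm is either new or has an upper
bound at least `θ`, and at its previous pull its lower bound was still below `μ₀`. If its samples
obey the anytime bound at level `exp (-q)`, these two facts bound the relevant gap by confidence
widths, hence its number of pulls by about `1 + q` times its term in the complexity
(`exists_pull_bound`). A bracket played more often than the sum of these budgets has therefore had a
round without active arms (`IsRun.exists_done`). A good arm whose bound holds at level `δ` always
has upper bound at least `θ`, so it had been output by that round. The least valid level `q` has
exponential tails by the anytime property, so the budgets have moments of the order of the
complexity, with no union bound over arms.

Two regimes remain, with `H = hFWER`. If `j ≥ 32 k`, a bracket of size about `n k / j` suffices: it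
contains `2 k` good arms (Chebyshev), at least half of them obey their bounds (Markov), and its
budget is of order `H` (Markov), except with probability `1 / 6`. Larger brackets fail
independently, and the `s`-th of them costs about `4 ^ s (s + 1) ^ 2` times more, so the first
success has finite expected cost because `4 / 6 < 1` (`exists_countTime_bound`). If `j ≤ 32 k`, the
total weight of all arms is at most `32 H`, so a bracket containing every arm is affordable. There
only good arms violating their bounds can be missed, a fraction `δ` in expectation
(`exists_settleTime_bound`).

The schedule serves open brackets in turn, so `x` plays of bracket `r` fit into `O(Y log Y)` rounds
with `Y = 2 ^ r + x` (`exists_plays_gt`). Both algorithms fit one argument because a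
Benjamini-Hochberg step outputs at least what the Bonferroni level `p = 1` would output. False
discoveries of FWER-TPR are controlled by a union bound over arms and brackets, with `∑ 1 / r ^ 2`
finite. An explicit anytime constant comes from Doob's inequality on dyadic blocks. -/

noncomputable section

namespace InfiniteUCB

/-! ### The truncated logarithm and the confidence width -/

lemma one_le_tlog (x : ℝ) : 1 ≤ tlog x := le_max_right _ _

lemma tlog_pos (x : ℝ) : 0 < tlog x := one_pos.trans_le (one_le_tlog x)

lemma log_le_tlog (x : ℝ) : Real.log x ≤ tlog x := le_max_left _ _

lemma tlog_mono {x y : ℝ} (hx : 0 < x) (hxy : x ≤ y) : tlog x ≤ tlog y :=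
  max_le_max (Real.log_le_log hx hxy) le_rfl

lemma tlog_mul_le {x y : ℝ} (hx : 0 < x) (hy : 0 < y) : tlog (x * y) ≤ tlog x + tlog y := by
  refine max_le ?_ ?_
  · rw [Real.log_mul hx.ne' hy.ne']
    exact add_le_add (log_le_tlog x) (log_le_tlog y)
  · linarith [one_le_tlog x, one_le_tlog y]

lemma tlog_le_self {x : ℝ} (hx : 1 ≤ x) : tlog x ≤ x :=
  max_le ((Real.log_le_sub_one_of_pos (by linarith)).trans (by linarith)) hx

lemma tlog_pow_le (x : ℝ) (k : ℕ) (hk : 1 ≤ k) : tlog (x ^ k) ≤ k * tlog x := by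
  have hk' : (1 : ℝ) ≤ k := by exact_mod_cast hk
  refine max_le ?_ ?_
  · rw [Real.log_pow]
    exact mul_le_mul_of_nonneg_left (log_le_tlog x) (by positivity)
  · nlinarith [one_le_tlog x]

lemma confWidth_anti {c : ℝ} (hc : 0 ≤ c) (u : ℕ) {α β : ℝ} (hα : 0 < α) (hαβ : α ≤ β) :
    confWidth c u β ≤ confWidth c u α := by
  unfold confWidth
  have h : tlog (tlog u / β) ≤ tlog (tlog u / α) :=
    tlog_mono (div_pos (tlog_pos _) (hα.trans_le hαβ))
      (div_le_div_of_nonneg_left (tlog_pos _).le hα hαβ)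
  gcongr

lemma confWidth_nonneg {c : ℝ} (hc : 0 ≤ c) (u : ℕ) (α : ℝ) : 0 ≤ confWidth c u α :=
  mul_nonneg hc (Real.sqrt_nonneg _)

/-- The truncation of the logarithm makes the width only weakly monotone in general. For `β ≤ 1 / 3`
the argument is at least `3 > e`, where the truncation is inactive. Strictness matters because the
output rule admits equality and the confidence event is closed. -/
lemma confWidth_strictAnti {c : ℝ} (hc : 0 < c) {u : ℕ} (hu : 1 ≤ u) {α β : ℝ} (hα : 0 < α)
    (hαβ : α < β) (hβ : β ≤ 1 / 3) : confWidth c u β < confWidth c u α := by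
  unfold confWidth
  have hu' : (0 : ℝ) < u := by exact_mod_cast hu
  have hβ0 : 0 < β := hα.trans hαβ
  have h1 : 3 ≤ tlog u / β := by
    rw [le_div_iff₀ hβ0]
    linarith [one_le_tlog u]
  have h2 : tlog u / β < tlog u / α := div_lt_div_of_pos_left (tlog_pos _) hα hαβ
  have h3 : 1 ≤ Real.log (tlog u / β) := by
    rw [Real.le_log_iff_exp_le (by linarith)]
    linarith [Real.exp_one_lt_d9]
  have h4 : tlog (tlog u / β) < tlog (tlog u / α) := by
    have e1 : tlog (tlog u / β) = Real.log (tlog u / β) := max_eq_left h3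
    rw [e1]
    exact (Real.log_lt_log (by linarith) h2).trans_le (log_le_tlog _)
  refine mul_lt_mul_of_pos_left (Real.sqrt_lt_sqrt ?_ ?_) hc
  · exact div_nonneg (tlog_pos _).le hu'.le
  · exact div_lt_div_of_pos_right h4 hu'

lemma log_le_half {v : ℝ} (hv : 0 < v) : Real.log v ≤ v / 2 := by
  have h := Real.log_le_sub_one_of_pos (show 0 < v / 2 by positivity)
  rw [Real.log_div hv.ne' two_ne_zero] at h
  linarith [Real.log_two_lt_d9]

/-- Inversion of `u ≤ a D log (log u / β)`. -/
lemma le_of_le_mul_tlog {a D β u : ℝ} (ha : 1 ≤ a) (hD : 1 ≤ D) (hβ : 0 < β)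
    (hu : 1 ≤ u) (h : u ≤ a * D * tlog (tlog u / β)) :
    u ≤ a * (2 * (2 + tlog (3 * tlog a))) * (D * tlog (tlog D / β)) := by
  set v := tlog (tlog u / β) with hv
  set B := tlog (tlog D / β) with hB
  have hv1 : 1 ≤ v := one_le_tlog _
  have hB1 : 1 ≤ B := one_le_tlog _
  have hvp : 0 < v := by linarith
  have ha1 := one_le_tlog a
  have hD1 := one_le_tlog D
  have hla := log_le_tlog a
  have hlD := log_le_tlog D
  have hlv : 0 ≤ Real.log v := Real.log_nonneg hv1
  -- Substituting the hypothesis once gives `log u ≤ log a + log D + log v`. As the truncated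
  -- logarithms and `v` are at least `1`, the sum is dominated by a product.
  have q1 : tlog u ≤ 3 * tlog a * tlog D * v := by
    have h1 : Real.log u ≤ Real.log a + Real.log D + Real.log v := by
      rw [← Real.log_mul (by positivity) (by positivity), ← Real.log_mul (by positivity)
        (by positivity)]
      exact Real.log_le_log (by linarith) h
    have h2 : Real.log v ≤ v := by linarith [log_le_half hvp]
    have e1 : 1 ≤ tlog a * tlog D := by nlinarith
    have e2 : 1 ≤ tlog D * v := by nlinarith
    have e3 : 1 ≤ tlog a * v := by nlinarith
    have e4 : tlog a ≤ tlog a * (tlog D * v) := le_mul_of_one_le_right (by linarith) e2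
    have e5 : tlog D ≤ tlog D * (tlog a * v) := le_mul_of_one_le_right (by linarith) e3
    have e6 : v ≤ v * (tlog a * tlog D) := le_mul_of_one_le_right (by linarith) e1
    refine max_le ?_ ?_ <;> nlinarith
  have hP : 0 < 3 * tlog a * tlog D := by positivity
  have q2 : v ≤ 2 * (2 + tlog (3 * tlog a)) * B := by
    have h0 : Real.log (tlog u / β) ≤ Real.log (3 * tlog a) + Real.log (tlog D / β)
        + Real.log v := by
      rw [← Real.log_mul (by positivity) (by have := tlog_pos D; positivity),
        ← Real.log_mul (by have := tlog_pos D; positivity) (by positivity)]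
      refine Real.log_le_log (div_pos (tlog_pos _) hβ) ?_
      rw [div_le_iff₀ hβ]
      calc tlog u ≤ _ := q1
        _ = 3 * tlog a * (tlog D / β) * v * β := by field_simp
    have h1 := log_le_half hvp
    have h2 := log_le_tlog (3 * tlog a)
    have h3 := log_le_tlog (tlog D / β)
    have h4 := one_le_tlog (3 * tlog a)
    -- The iteration closes here: `v` reappears on the right only as `log v ≤ v / 2`, so half of it
    -- can be moved to the left.
    have h5 : v ≤ 1 + (tlog (3 * tlog a) + B + v / 2) := by
      refine max_le ?_ ?_ <;> linarith
    nlinarith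
  calc u ≤ a * D * v := h
    _ ≤ a * D * (2 * (2 + tlog (3 * tlog a)) * B) := by gcongr
    _ = _ := by ring

/-- If a gap is at most a multiple of the confidence width after `u` samples, then `u` is at most the
usual inverse squared gap bound. -/
lemma exists_count_bound (c : ℝ) : ∃ K : ℝ, 1 ≤ K ∧
    ∀ (g β : ℝ) (u : ℕ), 0 < g → g ≤ 1 → 0 < β → 1 ≤ u → g ≤ 4 * confWidth c u β →
      (u : ℝ) ≤ K * (g ^ (-2 : ℤ) * tlog (tlog (g ^ (-2 : ℤ)) / β)) := by
  -- Squaring `g ≤ 4 U(u, β)` produces the factor `(4 c) ^ 2`; the maximum with `1` serves the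
  -- inversion lemma.
  set a := max ((4 * c) ^ 2) 1
  have ha : 1 ≤ a := le_max_right _ _
  have hK := one_le_tlog (3 * tlog a)
  refine ⟨a * (2 * (2 + tlog (3 * tlog a))), by nlinarith, ?_⟩
  intro g β u hg hg1 hβ hu h
  have hu' : (1 : ℝ) ≤ u := by exact_mod_cast hu
  have hD : 1 ≤ g ^ (-2 : ℤ) := by
    rw [zpow_neg]
    exact (one_le_inv₀ (by positivity)).2 (by
      rw [show (2 : ℤ) = ((2 : ℕ) : ℤ) by rfl, zpow_natCast]; exact pow_le_one₀ hg.le hg1)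
  refine le_of_le_mul_tlog ha hD hβ hu' ?_
  have hv := tlog_pos (tlog u / β)
  unfold confWidth at h
  have h1 : g ^ 2 ≤ (4 * c) ^ 2 * (tlog (tlog u / β) / u) := by
    have := pow_le_pow_left₀ hg.le h 2
    rw [← mul_assoc, mul_pow, Real.sq_sqrt (by positivity)] at this
    exact this
  have h2 : g ^ (-2 : ℤ) = (g ^ 2)⁻¹ := by
    rw [zpow_neg]; rfl
  rw [h2]
  have h3 : (4 * c) ^ 2 * (tlog (tlog u / β) / u) ≤ a * (tlog (tlog u / β) / u) := by
    gcongr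
    exact le_max_left _ _
  have h4 : g ^ 2 * u ≤ a * tlog (tlog u / β) := by
    have := h1.trans h3
    rw [← mul_div_assoc, le_div_iff₀ (by linarith)] at this
    exact this
  rw [mul_assoc, mul_left_comm, ← div_eq_inv_mul, le_div_iff₀ (by positivity)]
  linarith

/-! ### An anytime confidence bound for sub-Gaussian samples -/

section Maximal

variable {Ω : Type*} [MeasurableSpace Ω] {P : Measure Ω} [IsProbabilityMeasure P] {Z : ℕ → Ω → ℝ}

/-- The next factor is independent of the past and has mean at least `1 + l E[Z] = 1`. The sum runs
to `m + 1` because the natural filtration at time `m` already contains `Z m`. -/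
lemma submartingale_exp_sum (hZ : ∀ s, Measurable (Z s)) (hind : iIndepFun Z P)
    (hsub : ∀ s, HasSubgaussianMGF (Z s) 1 P) (h0 : ∀ s, ∫ ω, Z s ω ∂P = 0) (l : ℝ) :
    Submartingale (fun m ω => Real.exp (l * ∑ s ∈ Finset.range (m + 1), Z s ω))
      (Filtration.natural Z fun s => (hZ s).stronglyMeasurable) P := by
  set 𝒢 := Filtration.natural Z fun s => (hZ s).stronglyMeasurable
  have hadZ : StronglyAdapted 𝒢 Z := Filtration.stronglyAdapted_natural _
  have hint : ∀ m, Integrable (fun ω => Real.exp (l * ∑ s ∈ Finset.range m, Z s ω)) P := by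
    intro m
    have := (HasSubgaussianMGF.sum_of_iIndepFun hind (s := Finset.range m)
      (fun s _ => hsub s)).integrable_exp_mul l
    simpa using this
  have hadS : StronglyAdapted 𝒢
      (fun m ω => Real.exp (l * ∑ s ∈ Finset.range (m + 1), Z s ω)) := by
    intro m
    refine Real.continuous_exp.comp_stronglyMeasurable (StronglyMeasurable.const_mul ?_ l)
    refine Finset.stronglyMeasurable_fun_sum _ fun s hs => ?_
    exact (hadZ s).mono (𝒢.mono (Nat.lt_succ_iff.1 (Finset.mem_range.1 hs)))
  refine submartingale_nat hadS (fun m => hint _) fun m => ?_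
  have hprod : (fun ω => Real.exp (l * ∑ s ∈ Finset.range (m + 1 + 1), Z s ω))
      = (fun ω => Real.exp (l * ∑ s ∈ Finset.range (m + 1), Z s ω))
        * fun ω => Real.exp (l * Z (m + 1) ω) := by
    ext ω
    simp only [Pi.mul_apply]
    rw [Finset.sum_range_succ, mul_add, Real.exp_add]
  have h1 := condExp_mul_of_stronglyMeasurable_left (μ := P) (m := 𝒢 m) (hadS m)
    (hprod ▸ hint (m + 1 + 1)) ((hsub (m + 1)).integrable_exp_mul l)
  have h2 : P[fun ω => Real.exp (l * Z (m + 1) ω) | 𝒢 m]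
      =ᵐ[P] fun _ => ∫ ω, Real.exp (l * Z (m + 1) ω) ∂P := by
    refine condExp_indep_eq (hZ (m + 1)).comap_le (𝒢.le m) ?_
      (hind.indep_comap_natural_of_lt (fun s => (hZ s).stronglyMeasurable) (Nat.lt_succ_self m))
    exact Real.continuous_exp.comp_stronglyMeasurable
      ((comap_measurable (Z (m + 1))).stronglyMeasurable.const_mul l)
  have h3 : 1 ≤ ∫ ω, Real.exp (l * Z (m + 1) ω) ∂P := by
    have hi := (hsub (m + 1)).integrable
    calc (1 : ℝ) = ∫ ω, (l * Z (m + 1) ω + 1) ∂P := by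
          rw [integral_add (hi.const_mul l) (integrable_const _), integral_const_mul, h0]
          simp
      _ ≤ _ := integral_mono ((hi.const_mul l).add (integrable_const _))
          ((hsub (m + 1)).integrable_exp_mul l) fun ω => Real.add_one_le_exp _
  simp only [hprod]
  filter_upwards [h1, h2] with ω e1 e2
  rw [e1, Pi.mul_apply, e2]
  exact le_mul_of_one_le_right (Real.exp_pos _).le h3

/-- Doob's maximal inequality for the exponential submartingale, with the optimal parameter `l = x /
N`. A whole block of sample sizes costs no more than its last one, so only a union bound over dyadic
blocks is needed, and the width contains only an iterated logarithm. -/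
lemma measure_exists_sum_ge_le (hZ : ∀ s, Measurable (Z s)) (hind : iIndepFun Z P)
    (hsub : ∀ s, HasSubgaussianMGF (Z s) 1 P) (h0 : ∀ s, ∫ ω, Z s ω ∂P = 0) {N : ℕ} (hN : 1 ≤ N)
    {x : ℝ} (hx : 0 ≤ x) :
    P {ω | ∃ u, 1 ≤ u ∧ u ≤ N ∧ x ≤ ∑ s ∈ Finset.range u, Z s ω}
      ≤ ENNReal.ofReal (Real.exp (-x ^ 2 / (2 * N))) := by
  obtain ⟨m, rfl⟩ : ∃ m, N = m + 1 := ⟨N - 1, by omega⟩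
  have hNpos : (0 : ℝ) < (m + 1 : ℕ) := by positivity
  set l : ℝ := x / (m + 1 : ℕ) with hl
  have hl0 : 0 ≤ l := div_nonneg hx hNpos.le
  have hsm := submartingale_exp_sum hZ hind hsub h0 l
  have hS := HasSubgaussianMGF.sum_of_iIndepFun hind (s := Finset.range (m + 1))
      (fun s _ => hsub s)
  have hmgf : ∫ ω, Real.exp (l * ∑ s ∈ Finset.range (m + 1), Z s ω) ∂P
      ≤ Real.exp ((m + 1 : ℕ) * l ^ 2 / 2) := by
    have := hS.mgf_le l
    simpa [mgf] using this
  have hdoob := maximal_ineq hsm (fun m ω => (Real.exp_pos _).le)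
    (ε := ⟨Real.exp (l * x), (Real.exp_pos _).le⟩) m
  set ε : NNReal := ⟨Real.exp (l * x), (Real.exp_pos _).le⟩
  have hε : (ε : ℝ≥0∞) = ENNReal.ofReal (Real.exp (l * x)) := by
    rw [ENNReal.ofReal]
    congr 1
    exact (Real.toNNReal_of_nonneg (Real.exp_pos _).le).symm
  have hε0 : (ε : ℝ≥0∞) ≠ 0 := by rw [hε]; simp [Real.exp_pos]
  set E := {ω | (ε : ℝ) ≤ (Finset.range (m + 1)).sup' Finset.nonempty_range_add_one
    fun k => Real.exp (l * ∑ s ∈ Finset.range (k + 1), Z s ω)}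
  have hsubset : {ω | ∃ u, 1 ≤ u ∧ u ≤ m + 1 ∧ x ≤ ∑ s ∈ Finset.range u, Z s ω} ⊆ E := by
    rintro ω ⟨u, hu1, hu2, hu⟩
    have hmem : u - 1 ∈ Finset.range (m + 1) := Finset.mem_range.2 (by omega)
    have hle : (ε : ℝ) ≤ Real.exp (l * ∑ s ∈ Finset.range (u - 1 + 1), Z s ω) := by
      rw [Nat.sub_add_cancel hu1]
      exact Real.exp_le_exp.2 (mul_le_mul_of_nonneg_left hu hl0)
    exact hle.trans (Finset.le_sup' (f := fun k =>
      Real.exp (l * ∑ s ∈ Finset.range (k + 1), Z s ω)) hmem)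
  have hle : ENNReal.ofReal (∫ ω in E, Real.exp (l * ∑ s ∈ Finset.range (m + 1), Z s ω) ∂P)
      ≤ ENNReal.ofReal (Real.exp ((m + 1 : ℕ) * l ^ 2 / 2)) := by
    refine ENNReal.ofReal_le_ofReal (le_trans ?_ hmgf)
    exact setIntegral_le_integral (hsm.integrable m) (ae_of_all _ fun ω => (Real.exp_pos _).le)
  have hE : P E ≤ (ε : ℝ≥0∞)⁻¹ * ENNReal.ofReal (Real.exp ((m + 1 : ℕ) * l ^ 2 / 2)) := by
    rw [mul_comm, ← div_eq_mul_inv, ENNReal.le_div_iff_mul_le (Or.inl hε0)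
      (Or.inl ENNReal.coe_ne_top), mul_comm]
    exact hdoob.trans hle
  refine (measure_mono hsubset).trans (hE.trans (le_of_eq ?_))
  rw [hε, ← ENNReal.ofReal_inv_of_pos (Real.exp_pos _), ← ENNReal.ofReal_mul (by positivity),
    ← Real.exp_neg, ← Real.exp_add]
  congr 2
  rw [hl]
  field_simp
  ring

lemma measure_exists_abs_sum_ge_le (hZ : ∀ s, Measurable (Z s)) (hind : iIndepFun Z P)
    (hsub : ∀ s, HasSubgaussianMGF (Z s) 1 P) (h0 : ∀ s, ∫ ω, Z s ω ∂P = 0) {N : ℕ} (hN : 1 ≤ N)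
    {x : ℝ} (hx : 0 ≤ x) :
    P {ω | ∃ u, 1 ≤ u ∧ u ≤ N ∧ x ≤ |∑ s ∈ Finset.range u, Z s ω|}
      ≤ 2 * ENNReal.ofReal (Real.exp (-x ^ 2 / (2 * N))) := by
  have h1 := measure_exists_sum_ge_le hZ hind hsub h0 hN hx
  have h2 := measure_exists_sum_ge_le (Z := fun s ω => -Z s ω) (fun s => (hZ s).neg)
    (hind.comp (fun _ y => -y) fun _ => measurable_neg) (fun s => (hsub s).neg)
    (fun s => by rw [integral_neg, h0, neg_zero]) hN hx
  rw [two_mul]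
  refine le_trans (measure_mono ?_) ((measure_union_le _ _).trans (add_le_add h1 h2))
  rintro ω ⟨u, hu1, hu2, hu⟩
  rcases le_abs.1 hu with h | h
  · exact Or.inl ⟨u, hu1, hu2, h⟩
  · exact Or.inr ⟨u, hu1, hu2, by rwa [Finset.sum_neg_distrib]⟩

end Maximal

/-! ### Positivity of anytime constants and an explicit one. -/

lemma isOneSubGaussian_gaussianReal : IsOneSubGaussian (gaussianReal 0 1) := by
  have h0 : ∫ z, z ∂(gaussianReal 0 1) = 0 := integral_id_gaussianReal
  unfold IsOneSubGaussian
  simp only [h0, sub_zero]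
  refine ⟨fun t => integrable_exp_mul_gaussianReal t, fun t => ?_⟩
  rw [mgf_fun_id_gaussianReal]
  simp

/-- The constant of an anytime bound is positive. -/
lemma IsAnytimeBound.pos {c : ℝ} (hc : IsAnytimeBound c) : 0 < c := by
  by_contra hneg
  push Not at hneg
  have h := hc (gaussianReal 0 1) inferInstance isOneSubGaussian_gaussianReal (1 / 2)
    (by norm_num) (by norm_num)
  -- If `c ≤ 0`, the bound at `u = 1` forces the first sample to equal the mean, which is a null
  -- event for a Gaussian law.
  have hz : Measure.infinitePi (fun _ : ℕ => gaussianReal 0 1)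
      {y | ∀ u : ℕ, 1 ≤ u → |(∑ s ∈ Finset.range u, y s) / u - ∫ z, z ∂(gaussianReal 0 1)|
        ≤ confWidth c u (1 / 2)} = 0 := by
    refine measure_mono_null (t := (fun y : ℕ → ℝ => y 0) ⁻¹' {0}) ?_ ?_
    · intro y hy
      have h1 := hy 1 le_rfl
      have h2 : confWidth c 1 (1 / 2) ≤ 0 :=
        mul_nonpos_of_nonpos_of_nonneg hneg (Real.sqrt_nonneg _)
      have h3 := abs_nonpos_iff.1 (h1.trans h2)
      rw [integral_id_gaussianReal] at h3
      simpa using h3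
    · rw [← Measure.map_apply (measurable_pi_apply 0) (measurableSet_singleton 0),
        Measure.infinitePi_map_eval]
      exact (nullSingletonClass_gaussianReal one_ne_zero).measure_singleton 0
  rw [hz] at h
  norm_num at h

lemma exists_two_pow_block {u : ℕ} (hu : 1 ≤ u) : ∃ q, 2 ^ q ≤ u ∧ u ≤ 2 ^ (q + 1) :=
  ⟨Nat.log 2 u, Nat.pow_log_le_self 2 (by omega), (Nat.lt_pow_succ_log_self one_lt_two u).le⟩

/-- Makes the block probabilities, of order `(α / tlog (2 ^ q)) ^ 2`, summable in `q`. The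
truncation at `1` covers `q < 2`. -/
lemma tlog_two_pow_ge (q : ℕ) : ((q : ℝ) + 1) / 3 ≤ tlog ((2 ^ q : ℕ) : ℝ) := by
  rcases Nat.lt_or_ge q 2 with h | h
  · refine le_trans ?_ (one_le_tlog _)
    have : (q : ℝ) ≤ 1 := by exact_mod_cast Nat.lt_succ_iff.1 h
    linarith
  · refine le_trans ?_ (log_le_tlog _)
    push_cast
    rw [Real.log_pow]
    have h' : (2 : ℝ) ≤ q := by exact_mod_cast h
    nlinarith [Real.log_two_gt_d9]

lemma tsum_inv_sq_succ : ∑' q : ℕ, ENNReal.ofReal (1 / ((q : ℝ) + 1) ^ 2)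
    = ENNReal.ofReal (Real.pi ^ 2 / 6) := by
  have h := hasSum_zeta_two
  have h1 : HasSum (fun q : ℕ => 1 / ((q : ℝ) + 1) ^ 2) (Real.pi ^ 2 / 6) := by
    have := (hasSum_nat_add_iff' (f := fun q : ℕ => 1 / (q : ℝ) ^ 2) 1).2 h
    simpa using this
  rw [← ENNReal.ofReal_tsum_of_nonneg (fun q => by positivity) h1.summable, h1.tsum_eq]

lemma pi_sq_div_six_le : Real.pi ^ 2 / 6 ≤ 33 / 20 := by
  have h := Real.pi_lt_d4
  have h0 := Real.pi_pos
  nlinarith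

/-- Split `25 / 4 = 17 / 4 + 2`: the first part uses `tlog ≥ 1` and gives a small constant, the
second uses `tlog ≥ log` and gives the square. -/
lemma exp_neg_mul_tlog_le {y α : ℝ} (hy : 0 < y) (hα : 0 < α) :
    Real.exp (-(25 / 4 * tlog (y / α))) ≤ Real.exp (-(17 / 4)) * (α / y) ^ 2 := by
  have h1 := one_le_tlog (y / α)
  have h2 := log_le_tlog (y / α)
  have h3 : (α / y) ^ 2 = Real.exp (-(2 * Real.log (y / α))) := by
    rw [← Real.exp_log (show 0 < (α / y) ^ 2 by positivity), Real.log_pow, ← inv_div y α,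
      Real.log_inv]
    push_cast
    ring_nf
  rw [h3, ← Real.exp_add]
  exact Real.exp_le_exp.2 (by linarith)

/-- The width with constant `5` is an anytime confidence bound. -/
lemma isAnytimeBound_five : IsAnytimeBound 5 := by
  intro ν hν hsub α hα hα1
  set m := ∫ z, z ∂ν with hm
  set P := Measure.infinitePi fun _ : ℕ => ν with hP
  set Z : ℕ → (ℕ → ℝ) → ℝ := fun s y => y s - m with hZdef
  have hev : ∀ s, P.map (fun y : ℕ → ℝ => y s) = ν := fun s =>
    Measure.infinitePi_map_eval (fun _ : ℕ => ν) s
  have hes : ∀ s, Measurable fun y : ℕ → ℝ => y s := fun s => measurable_pi_apply s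
  have hZ : ∀ s, Measurable (Z s) := fun s => (hes s).sub_const m
  have hind : iIndepFun Z P :=
    iIndepFun_infinitePi (P := fun _ : ℕ => ν) (X := fun _ y => y - m)
      fun _ => measurable_id.sub_const m
  have hsubZ : ∀ s, HasSubgaussianMGF (Z s) 1 P := by
    intro s
    have h : HasSubgaussianMGF (fun y => y - m) 1 (P.map fun y : ℕ → ℝ => y s) := by
      rw [hev]; exact hsub
    exact h.of_map (hes s).aemeasurable
  have h0 : ∀ s, ∫ y, Z s y ∂P = 0 := by
    intro s
    have hi : Integrable (fun z : ℝ => z) ν := by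
      have := hsub.integrable.add (integrable_const m)
      refine this.congr (ae_of_all _ fun z => ?_)
      simp [hm]
    have h1 : ∫ y, Z s y ∂P = ∫ z, (z - m) ∂(P.map fun y : ℕ → ℝ => y s) :=
      (integral_map (hes s).aemeasurable
        (measurable_id.sub_const m).aestronglyMeasurable).symm
    rw [h1, hev, integral_sub hi (integrable_const m)]
    simp [hm]
  -- Peeling: for `2 ^ q ≤ u ≤ 2 ^ (q + 1)` the allowed deviation of the partial sum, `u * confWidth
  -- 5 u α`, is at least its value `x q` at the left end of the block.
  set x : ℕ → ℝ := fun q => 5 * √((2 ^ q : ℕ) * tlog (tlog ((2 ^ q : ℕ) : ℝ) / α)) with hx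
  set G := {y : ℕ → ℝ | ∀ u : ℕ, 1 ≤ u →
    |(∑ s ∈ Finset.range u, y s) / u - m| ≤ confWidth 5 u α} with hG
  have hcover : Gᶜ ⊆ ⋃ q, {y | ∃ u, 1 ≤ u ∧ u ≤ 2 ^ (q + 1) ∧
      x q ≤ |∑ s ∈ Finset.range u, Z s y|} := by
    intro y hy
    rw [hG, Set.mem_compl_iff, Set.mem_ofPred_eq] at hy
    push Not at hy
    obtain ⟨u, hu1, hu⟩ := hy
    obtain ⟨q, hq1, hq2⟩ := exists_two_pow_block hu1
    refine Set.mem_iUnion.2 ⟨q, u, hu1, hq2, ?_⟩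
    have hu0 : (0 : ℝ) < u := by exact_mod_cast hu1
    have hq0 : (0 : ℝ) < (2 ^ q : ℕ) := by positivity
    have hqu : ((2 ^ q : ℕ) : ℝ) ≤ u := by exact_mod_cast hq1
    have e1 : ∑ s ∈ Finset.range u, Z s y = u * ((∑ s ∈ Finset.range u, y s) / u - m) := by
      simp only [hZdef, Finset.sum_sub_distrib, Finset.sum_const, Finset.card_range,
        nsmul_eq_mul]
      field_simp
    rw [e1, abs_mul, abs_of_pos hu0]
    refine le_trans ?_ (mul_le_mul_of_nonneg_left hu.le hu0.le)
    have e2 : (u : ℝ) * confWidth 5 u α = 5 * √(u * tlog (tlog u / α)) := by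
      have hT := tlog_pos (tlog u / α)
      have : (u : ℝ) * tlog (tlog u / α) = u ^ 2 * (tlog (tlog u / α) / u) := by field_simp
      rw [this, Real.sqrt_mul (by positivity), Real.sqrt_sq hu0.le]
      unfold confWidth
      ring
    rw [e2, hx]
    have e3 : tlog (tlog ((2 ^ q : ℕ) : ℝ) / α) ≤ tlog (tlog u / α) :=
      tlog_mono (div_pos (tlog_pos _) hα)
        (div_le_div_of_nonneg_right (tlog_mono hq0 hqu) hα.le)
    have := (tlog_pos (tlog ((2 ^ q : ℕ) : ℝ) / α)).le
    dsimp only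
    gcongr
  have hterm : ∀ q, P {y | ∃ u, 1 ≤ u ∧ u ≤ 2 ^ (q + 1) ∧
      x q ≤ |∑ s ∈ Finset.range u, Z s y|}
      ≤ ENNReal.ofReal (18 * Real.exp (-(17 / 4)) * α ^ 2)
        * ENNReal.ofReal (1 / ((q : ℝ) + 1) ^ 2) := by
    intro q
    have hx0 : 0 ≤ x q := by positivity
    refine (measure_exists_abs_sum_ge_le hZ hind hsubZ h0 (Nat.one_le_two_pow) hx0).trans ?_
    have hT := tlog_pos (tlog ((2 ^ q : ℕ) : ℝ) / α)
    have e1 : -x q ^ 2 / (2 * ((2 ^ (q + 1) : ℕ) : ℝ))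
        = -(25 / 4 * tlog (tlog ((2 ^ q : ℕ) : ℝ) / α)) := by
      rw [hx]
      dsimp only
      rw [mul_pow, Real.sq_sqrt (by positivity)]
      push_cast
      rw [pow_succ]
      field_simp
      ring
    rw [e1, ← ENNReal.ofReal_mul (by positivity),
      show (2 : ℝ≥0∞) = ENNReal.ofReal 2 by simp, ← ENNReal.ofReal_mul (by norm_num)]
    refine ENNReal.ofReal_le_ofReal ?_
    have h1 := exp_neg_mul_tlog_le (tlog_pos ((2 ^ q : ℕ) : ℝ)) hα
    have h2 : (α / tlog ((2 ^ q : ℕ) : ℝ)) ^ 2 ≤ (α / (((q : ℝ) + 1) / 3)) ^ 2 := by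
      have := tlog_two_pow_ge q
      have := (tlog_pos ((2 ^ q : ℕ) : ℝ)).le
      gcongr
    calc 2 * Real.exp (-(25 / 4 * tlog (tlog ((2 ^ q : ℕ) : ℝ) / α)))
        ≤ 2 * (Real.exp (-(17 / 4)) * (α / (((q : ℝ) + 1) / 3)) ^ 2) := by
          have := (Real.exp_pos (-(17 / 4))).le
          have := mul_le_mul_of_nonneg_left h2 this
          linarith
      _ = _ := by field_simp; ring
  have hbad : P Gᶜ ≤ ENNReal.ofReal α := by
    refine (measure_mono hcover).trans ((measure_iUnion_le _).trans
      ((ENNReal.tsum_le_tsum hterm).trans ?_))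
    rw [ENNReal.tsum_mul_left, tsum_inv_sq_succ, ← ENNReal.ofReal_mul (by positivity)]
    refine ENNReal.ofReal_le_ofReal ?_
    have h1 := pi_sq_div_six_le
    have h2 : Real.exp (-(17 / 4)) ≤ 1 / 30 := by
      rw [Real.exp_neg, ← one_div]
      refine one_div_le_one_div_of_le (by norm_num) ?_
      have h3 : Real.exp 4 ≤ Real.exp (17 / 4) := Real.exp_le_exp.2 (by norm_num)
      have h4 : Real.exp 4 = Real.exp 1 ^ 4 := by rw [← Real.exp_nat_mul]; norm_num
      have h5 : (2.7 : ℝ) ^ 4 ≤ Real.exp 1 ^ 4 :=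
        pow_le_pow_left₀ (by norm_num) (by linarith [Real.exp_one_gt_d9]) 4
      norm_num at h5
      linarith
    have h3 : α ^ 2 ≤ α := by nlinarith
    -- The factor `18` is `2 * 3 ^ 2`, from the two tails and from `tlog_two_pow_ge`; numerically
    -- `18 / 30 * 33 / 20 = 0.99`.
    calc 18 * Real.exp (-(17 / 4)) * α ^ 2 * (Real.pi ^ 2 / 6)
        ≤ 18 * (1 / 30) * α * (33 / 20) := by gcongr
      _ ≤ α := by linarith
  have hone : (1 : ℝ≥0∞) ≤ P G + P Gᶜ := by
    rw [← measure_univ (μ := P), ← Set.union_compl_self G]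
    exact measure_union_le _ _
  rw [ENNReal.ofReal_sub _ hα.le, ENNReal.ofReal_one]
  exact tsub_le_iff_right.2 (hone.trans (by gcongr))

/-! ### The schedule -/

lemma two_pow_mul_mono {a b : ℕ} (h : a ≤ b) : 2 ^ a * a ≤ 2 ^ b * b :=
  Nat.mul_le_mul (Nat.pow_le_pow_right two_pos h) h

/-- Opening one bracket per round keeps up with the schedule, because the thresholds `2 ^ ℓ * ℓ`
increase strictly. Together with `two_pow_mul_pred_le` this locates the number of open brackets
between two consecutive thresholds. -/
lemma lt_two_pow_mul_numOpen : ∀ {t : ℕ}, 1 ≤ t → t < 2 ^ numOpen t * numOpen t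
  | 1, _ => by simp [numOpen]
  | t + 2, _ => by
    have ih := lt_two_pow_mul_numOpen (t := t + 1) (by omega)
    rw [numOpen]
    split_ifs with h
    · have := Nat.pow_lt_pow_right (a := 2) one_lt_two (Nat.lt_succ_self (numOpen (t + 1)))
      calc t + 2 ≤ 2 ^ numOpen (t + 1) * numOpen (t + 1) := by omega
        _ < 2 ^ (numOpen (t + 1) + 1) * (numOpen (t + 1) + 1) :=
          Nat.mul_lt_mul'' this (Nat.lt_succ_self _)
    · exact not_le.1 h

lemma two_pow_mul_pred_le : ∀ t : ℕ, 2 ^ (numOpen t - 1) * (numOpen t - 1) ≤ t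
  | 0 => by simp [numOpen]
  | t + 1 => by
    have ih := two_pow_mul_pred_le t
    rw [numOpen]
    split_ifs with h
    · simpa using h
    · omega

lemma numOpen_mono : Monotone numOpen := by
  refine monotone_nat_of_le_succ fun t => ?_
  rw [numOpen]
  split_ifs <;> omega

lemma le_numOpen {r t : ℕ} (hr : 1 ≤ r) (h : 2 ^ r * r ≤ t) : r ≤ numOpen t := by
  by_contra hlt
  have h1 : 1 ≤ 2 ^ r * r := Nat.mul_pos (by positivity) hr
  exact absurd ((lt_two_pow_mul_numOpen (h1.trans h)).trans_le
    ((two_pow_mul_mono (not_le.1 hlt).le).trans h)) (lt_irrefl _)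

lemma numOpen_le {z t : ℕ} (h : t < 2 ^ z * z) : numOpen t ≤ z := by
  by_contra hlt
  exact absurd ((two_pow_mul_mono (show z ≤ numOpen t - 1 by omega)).trans
    (two_pow_mul_pred_le t)) (not_le.2 h)

lemma bracket_pos {t : ℕ} (ht : 1 ≤ t) : 1 ≤ bracket t := by
  obtain ⟨s, rfl⟩ : ∃ s, t = s + 1 := ⟨t - 1, by omega⟩
  rw [bracket]
  omega

lemma bracket_le_numOpen : ∀ t : ℕ, bracket t ≤ numOpen t
  | 0 => by simp [bracket]
  | t + 1 => by
    have h : 1 ≤ numOpen (t + 1) := by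
      have := numOpen_mono (show 1 ≤ t + 1 by omega)
      simpa [numOpen] using this
    rw [bracket]
    split_ifs <;> omega

/-- Brackets opened during a pass only lengthen it, so the pass goes up one bracket per round
without interruption. -/
lemma bracket_add {s m : ℕ} (hm : m ≤ numOpen s) :
    ∀ d, bracket s + d ≤ m → bracket (s + d) = bracket s + d
  | 0, _ => rfl
  | d + 1, h => by
    have ih := bracket_add hm d (by omega)
    have h1 : m ≤ numOpen (s + d + 1) := hm.trans (numOpen_mono (by omega))
    rw [← add_assoc, bracket, ih, if_pos (by omega)]
    omega

/-- Induction on the distance to the last open bracket: each round either moves up by one or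
restarts the pass. -/
lemma exists_bracket_eq_one {L : ℕ} : ∀ (k s : ℕ), L ≤ bracket s + k →
    numOpen (s + k + 1) ≤ L → ∃ d ≤ k + 1, bracket (s + d) = 1
  | k, s, h1, h2 => by
    by_cases hb : bracket s < numOpen (s + 1)
    · have e : bracket (s + 1) = bracket s + 1 := by rw [bracket, if_pos hb, add_comm]
      cases k with
      | zero => exact absurd (hb.trans_le h2) (by omega)
      | succ k =>
        obtain ⟨d, hd, h⟩ := exists_bracket_eq_one (L := L) k (s + 1) (by omega)
          (by rwa [show s + 1 + k + 1 = s + (k + 1) + 1 by omega])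
        exact ⟨d + 1, by omega, by rwa [show s + (d + 1) = s + 1 + d by omega]⟩
    · exact ⟨1, by omega, by rw [bracket, if_neg hb]⟩

/-- Every open bracket is played in each window whose length bounds the number of brackets. -/
lemma exists_bracket_eq {r a L : ℕ} (hr : 1 ≤ r) (ha : r ≤ numOpen a)
    (hL : numOpen (a + L) ≤ L) : ∃ s, a ≤ s ∧ s < a + L ∧ bracket s = r := by
  have ha1 : 1 ≤ a := by
    rcases Nat.eq_zero_or_pos a with rfl | h
    · simp [numOpen] at ha; omega
    · exact h
  have hb := bracket_pos ha1
  have hLr : r ≤ L := ha.trans ((numOpen_mono (Nat.le_add_right a L)).trans hL)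
  have hbL : bracket a ≤ L :=
    (bracket_le_numOpen a).trans ((numOpen_mono (Nat.le_add_right a L)).trans hL)
  -- Either bracket `r` lies ahead in the current pass, or the pass must restart first. In the
  -- second case `bracket a > r`, which makes room for both the restart and the climb to `r`.
  by_cases hbr : bracket a ≤ r
  · exact ⟨a + (r - bracket a), by omega, by omega,
      by rw [bracket_add ha _ (by omega)]; omega⟩
  · obtain ⟨d, hd, h1⟩ := exists_bracket_eq_one (L := L) (L - bracket a) a (by omega)
      ((numOpen_mono (by omega)).trans hL)
    refine ⟨a + d + (r - 1), by omega, by omega, ?_⟩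
    rw [bracket_add (m := r) (ha.trans (numOpen_mono (Nat.le_add_right a d))) _ (by omega), h1]
    omega

/-- The number of rounds before round `t` in which bracket `r` is played. -/
def plays (r t : ℕ) : ℕ := {s ∈ Finset.Ico 1 t | bracket s = r}.card

lemma le_plays_add {r a L : ℕ} (hr : 1 ≤ r) (ha1 : 1 ≤ a) (ha : r ≤ numOpen a) :
    ∀ N, numOpen (a + N * L) ≤ L → N ≤ plays r (a + N * L)
  | 0, _ => Nat.zero_le _
  | N + 1, h => by
    have e : a + (N + 1) * L = a + N * L + L := by ring
    rw [e] at h ⊢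
    have ih := le_plays_add hr ha1 ha N ((numOpen_mono (Nat.le_add_right _ L)).trans h)
    obtain ⟨s, h1, h2, h3⟩ := exists_bracket_eq hr
      (ha.trans (numOpen_mono (Nat.le_add_right a (N * L)))) h
    refine Nat.succ_le_of_lt (ih.trans_lt (Finset.card_lt_card ?_))
    refine (Finset.ssubset_iff_of_subset ?_).2 ⟨s, ?_, ?_⟩
    · exact Finset.filter_subset_filter _ (Finset.Ico_subset_Ico_right (Nat.le_add_right _ _))
    · simp only [Finset.mem_filter, Finset.mem_Ico]
      exact ⟨⟨by omega, h2⟩, h3⟩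
    · simp only [Finset.mem_filter, Finset.mem_Ico]
      omega

/-- Until round `2 ^ z * z` at most `z` brackets are open, so each window of `z` rounds plays
bracket `r`. It is open from round `2 ^ r * r ≤ 2 ^ (z - 1) * (z - 1)` on, which leaves room for `2
^ (z - 1)` such windows. -/
lemma le_plays {r z N : ℕ} (hr : 1 ≤ r) (hz : r + 1 ≤ z) (hN : 2 * N ≤ 2 ^ z) :
    N ≤ plays r (2 ^ z * z) := by
  obtain ⟨w, rfl⟩ : ∃ w, z = w + 1 := ⟨z - 1, by omega⟩
  have hN' : N ≤ 2 ^ w := by rw [pow_succ] at hN; omega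
  have h1 : 2 ^ r * r ≤ 2 ^ w * w := two_pow_mul_mono (by omega)
  have h2 : N * (w + 1) ≤ 2 ^ w * (w + 1) := Nat.mul_le_mul_right _ hN'
  have h3 : 0 < 2 ^ w := by positivity
  have hlt : 2 ^ r * r + N * (w + 1) < 2 ^ (w + 1) * (w + 1) := by
    rw [pow_succ]; nlinarith
  have h := le_plays_add (L := w + 1) hr (a := 2 ^ r * r) (Nat.mul_pos (by positivity) hr)
    (le_numOpen hr le_rfl) N (numOpen_le hlt)
  exact h.trans (Finset.card_le_card
    (Finset.filter_subset_filter _ (Finset.Ico_subset_Ico_right hlt.le)))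

/-! ### Runs of a bracketed upper confidence bound algorithm -/

section Run

variable {n : ℕ} {c μ₀ δ : ℝ} {lev : ℕ → ℝ} {A : ℕ → Finset (Fin n)} {x : Fin n → ℕ → ℕ → ℝ}
  {I : ℕ → Fin n} {O : ℕ → Finset (Fin n)}

/-- The common features of runs of FWER-TPR and FDR-TPR: the output sets `O` increase, and in every
round either an arm of the bracket is pulled for the first time, or an upper confidence bound is
maximized and all arms whose lower confidence bound at level `lev r` is at least `μ₀` are output. -/
structure IsRun (c μ₀ δ : ℝ) (lev : ℕ → ℝ) (A : ℕ → Finset (Fin n)) (x : Fin n → ℕ → ℕ → ℝ)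
    (I : ℕ → Fin n) (O : ℕ → Finset (Fin n)) : Prop where
  mono : Monotone O
  step : ∀ t, 1 ≤ t →
    (I t ∈ A (bracket t) ∧ pulls I (I t) (bracket t) t = 0) ∨
    ((∀ i ∈ A (bracket t), i ∉ O t → 0 < pulls I i (bracket t) t) ∧
      ((A (bracket t) \ O t).Nonempty → I t ∈ A (bracket t) \ O t ∧
        ∀ i ∈ A (bracket t) \ O t, ucb c δ x I t i ≤ ucb c δ x I t (I t)) ∧
      ∀ i ∈ A (bracket t), 0 < pulls I i (bracket t) t → i ∉ O (t + 1) →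
        empMean x i (bracket t) (pulls I i (bracket t) t)
          - confWidth c (pulls I i (bracket t) t) (lev (bracket t)) < μ₀)

lemma mem_lcbAbove {α : ℝ} {t : ℕ} {i : Fin n} : i ∈ lcbAbove c μ₀ α A x I t ↔
    i ∈ A (bracket t) ∧ 0 < pulls I i (bracket t) t ∧
      μ₀ ≤ empMean x i (bracket t) (pulls I i (bracket t) t)
        - confWidth c (pulls I i (bracket t) t) α := by
  simp [lcbAbove]

/-! ### Both algorithms are runs in this sense. -/

lemma fwerSet_mono : Monotone (fwerSet c μ₀ δ A x I) := by
  refine monotone_nat_of_le_succ fun t => ?_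
  rw [fwerSet]
  split_ifs
  · exact le_rfl
  · exact Finset.subset_union_left

lemma fdrSet_mono : Monotone (fdrSet c μ₀ δ A x I) := by
  refine monotone_nat_of_le_succ fun t => ?_
  rw [fdrSet]
  split_ifs
  · exact le_rfl
  · exact Finset.subset_union_left

lemma IsFWERRun.isRun (h : IsFWERRun c μ₀ δ A x I) :
    IsRun c μ₀ δ (fun r => δ / ((A r).card * (r : ℝ) ^ 2)) A x I (fwerSet c μ₀ δ A x I) := by
  refine ⟨fwerSet_mono, fun t ht => ?_⟩
  obtain ⟨h1, h2⟩ := h t ht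
  rcases (unpulled (A (bracket t)) I t).eq_empty_or_nonempty with he | hne
  · right
    refine ⟨fun i hi _ => ?_, h2 he, fun i hi hp hO => ?_⟩
    · rw [Nat.pos_iff_ne_zero]
      intro h0
      have : i ∈ unpulled (A (bracket t)) I t := by simp [unpulled, hi, h0]
      simp [he] at this
    · rw [fwerSet, if_neg (by simp [he]; omega)] at hO
      by_contra hge
      exact hO (Finset.mem_union_right _ (mem_lcbAbove.2 ⟨hi, hp, not_lt.1 hge⟩))
  · left
    simpa [unpulled] using h1 hne

lemma fdrLevel_nonneg (hδ : 0 ≤ δ) (r : ℕ) : 0 ≤ fdrLevel δ r := by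
  have := tlog_pos (36 / (δ / (r : ℝ) ^ 2))
  unfold fdrLevel
  positivity

lemma fdrLevel_pos (hδ : 0 < δ) {r : ℕ} (hr : 1 ≤ r) : 0 < fdrLevel δ r := by
  have := tlog_pos (36 / (δ / (r : ℝ) ^ 2))
  unfold fdrLevel
  positivity

/-- Levels grow with `p` and widths shrink, so the accepted step is at least as generous as the
Bonferroni step `p = 1`. If that step accepts an arm, then `p = 1` is admissible and the index is
not `0`. -/
lemma bhSet_one_subset (hc : 0 ≤ c) (hδ : 0 < δ) {t : ℕ} (ht : 1 ≤ t)
    (hne : bhSet c μ₀ δ A x I t 1 ≠ ∅) :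
    bhIndex c μ₀ δ A x I t ≠ 0 ∧
      bhSet c μ₀ δ A x I t 1 ⊆ bhSet c μ₀ δ A x I t (bhIndex c μ₀ δ A x I t) := by
  obtain ⟨i, hi⟩ := Finset.nonempty_iff_ne_empty.2 hne
  have hcard : 0 < (A (bracket t)).card := Finset.card_pos.2 ⟨i, (mem_lcbAbove.1 hi).1⟩
  have h1 : 1 ≤ bhIndex c μ₀ δ A x I t := by
    refine Finset.le_sup (f := id) (b := 1) ?_
    simp only [Finset.mem_filter, Finset.mem_Icc]
    exact ⟨⟨le_rfl, hcard⟩, Finset.card_pos.2 ⟨i, hi⟩⟩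
  refine ⟨by omega, fun i' hi' => ?_⟩
  obtain ⟨e1, e2, e3⟩ := mem_lcbAbove.1 hi'
  refine mem_lcbAbove.2 ⟨e1, e2, e3.trans (sub_le_sub_left (confWidth_anti hc _ ?_ ?_) _)⟩
  · have := fdrLevel_pos hδ (bracket_pos ht)
    positivity
  · have := fdrLevel_nonneg hδ.le (bracket t)
    gcongr

lemma IsFDRRun.isRun (hc : 0 ≤ c) (hδ : 0 < δ) (h : IsFDRRun c μ₀ δ A x I) :
    IsRun c μ₀ δ (fun r => ((1 : ℕ) : ℝ) / (A r).card * fdrLevel δ r) A x I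
      (fdrSet c μ₀ δ A x I) := by
  refine ⟨fdrSet_mono, fun t ht => ?_⟩
  obtain ⟨h1, h2⟩ := h t ht
  rcases (unpulled (A (bracket t) \ fdrSet c μ₀ δ A x I t) I t).eq_empty_or_nonempty with he | hne
  · right
    refine ⟨fun i hi hS => ?_, h2 he, fun i hi hp hO => ?_⟩
    · rw [Nat.pos_iff_ne_zero]
      intro h0
      have : i ∈ unpulled (A (bracket t) \ fdrSet c μ₀ δ A x I t) I t := by
        simp [unpulled, hi, h0, hS]
      simp [he] at this
    · by_contra hge
      have hmem : i ∈ bhSet c μ₀ δ A x I t 1 := mem_lcbAbove.2 ⟨hi, hp, not_lt.1 hge⟩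
      obtain ⟨e1, e2⟩ := bhSet_one_subset hc hδ ht (Finset.ne_empty_of_mem hmem)
      rw [fdrSet, if_neg (by omega)] at hO
      exact hO (Finset.mem_union_right _ (e2 hmem))
  · left
    have := h1 hne
    simp only [unpulled, Finset.mem_filter, Finset.mem_sdiff] at this
    exact ⟨this.1.1, this.2⟩

/-! ### Charging the plays of a bracket to its arms. -/

lemma exists_last_pull {i : Fin n} {r : ℕ} : ∀ {t : ℕ}, 0 < pulls I i r t →
    ∃ s, 1 ≤ s ∧ s < t ∧ bracket s = r ∧ I s = i ∧ pulls I i r t = pulls I i r s + 1 := by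
  intro t ht
  set F := {s ∈ Finset.Ico 1 t | bracket s = r ∧ I s = i} with hF
  have hne : F.Nonempty := Finset.card_pos.1 ht
  have hmem := Finset.max'_mem F hne
  set s := F.max' hne
  have hs := hmem
  simp only [hF, Finset.mem_filter, Finset.mem_Ico] at hs
  refine ⟨s, hs.1.1, hs.1.2, hs.2.1, hs.2.2, ?_⟩
  have he : F.erase s = {s' ∈ Finset.Ico 1 s | bracket s' = r ∧ I s' = i} := by
    ext s'
    simp only [Finset.mem_erase, hF, Finset.mem_filter, Finset.mem_Ico]
    constructor
    · rintro ⟨h1, h2⟩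
      have : s' ≤ s := Finset.le_max' F s' (by simpa [hF] using h2)
      exact ⟨⟨h2.1.1, by omega⟩, h2.2⟩
    · rintro ⟨h1, h2⟩
      exact ⟨by omega, ⟨h1.1, by omega⟩, h2⟩
  have : F.card = (F.erase s).card + 1 := (Finset.card_erase_add_one hmem).symm
  rw [he] at this
  exact this

lemma plays_eq_sum_pulls {r t : ℕ} (h : ∀ s, 1 ≤ s → s < t → bracket s = r → I s ∈ A r) :
    plays r t = ∑ i ∈ A r, pulls I i r t := by
  unfold plays
  rw [Finset.card_eq_sum_card_fiberwise (f := I) (t := A r)]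
  · refine Finset.sum_congr rfl fun i _ => ?_
    rw [Finset.filter_filter]
    rfl
  · intro s hs
    have hs' : s ∈ Finset.Ico 1 t ∧ bracket s = r := by simpa using hs
    have := Finset.mem_Ico.1 hs'.1
    exact h s this.1 this.2 hs'.2

/-- In a round in which some arm `g` of the bracket has not been output and has an upper confidence
bound at least `θ`, the pulled arm has upper confidence bound at least `θ`, and its lower confidence
bound was below `μ₀` at its previous pull. -/
lemma IsRun.pull_of_active (h : IsRun c μ₀ δ lev A x I O) {θ : ℝ} {t : ℕ} (ht : 1 ≤ t)
    {g : Fin n} (hg : g ∈ A (bracket t)) (hgO : g ∉ O t)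
    (hgU : 0 < pulls I g (bracket t) t → θ ≤ ucb c δ x I t g) :
    I t ∈ A (bracket t) ∧ (0 < pulls I (I t) (bracket t) t → θ ≤ ucb c δ x I t (I t) ∧
      (2 ≤ pulls I (I t) (bracket t) t →
        empMean x (I t) (bracket t) (pulls I (I t) (bracket t) t - 1)
          - confWidth c (pulls I (I t) (bracket t) t - 1) (lev (bracket t)) < μ₀)) := by
  rcases h.step t ht with ⟨h1, h2⟩ | ⟨h1, h2, -⟩
  · exact ⟨h1, fun h0 => absurd h0 (by omega)⟩
  obtain ⟨e1, e2⟩ := h2 ⟨g, Finset.mem_sdiff.2 ⟨hg, hgO⟩⟩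
  obtain ⟨e3, e4⟩ := Finset.mem_sdiff.1 e1
  refine ⟨e3, fun h0 => ⟨(hgU (h1 g hg hgO)).trans (e2 g (Finset.mem_sdiff.2 ⟨hg, hgO⟩)),
    fun h2' => ?_⟩⟩
  -- At the last pull of this arm its count was one lower. It was not output then, since outputs are
  -- never withdrawn, so its lower bound failed the test after `u - 1` samples. With `u ≥ 2` that
  -- round was not a first pull.
  obtain ⟨s, hs1, hst, hsr, hsI, hp⟩ := exists_last_pull h0
  rw [hp, Nat.add_sub_cancel]
  rcases h.step s hs1 with ⟨-, k2⟩ | ⟨-, -, k3⟩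
  · rw [hsr, hsI] at k2
    omega
  · have := k3 (I t) (by rw [hsr]; exact e3) (by rw [hsr]; omega)
      fun hmem => e4 (h.mono hst hmem)
    rwa [hsr] at this

/-- If bracket `r` has been played often enough, then there was a round in which every arm of the
bracket had been output or had an upper confidence bound below `θ`. -/
lemma IsRun.exists_done (h : IsRun c μ₀ δ lev A x I O) {θ : ℝ} {r : ℕ} {B : Fin n → ℝ}
    (hB1 : ∀ i ∈ A r, 1 ≤ B i)
    (hB : ∀ i ∈ A r, ∀ u : ℕ, 1 ≤ u → θ ≤ empMean x i r u + confWidth c u δ →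
      (2 ≤ u → empMean x i r (u - 1) - confWidth c (u - 1) (lev r) < μ₀) → (u : ℝ) + 1 ≤ B i)
    {t : ℕ} (ht : ∑ i ∈ A r, B i < plays r t) :
    ∃ s, 1 ≤ s ∧ s < t ∧ bracket s = r ∧
      ∀ g ∈ A r, g ∈ O s ∨ (0 < pulls I g r s ∧ ucb c δ x I s g < θ) := by
  by_contra hcon
  push Not at hcon
  -- Under the contrary assumption every play of the bracket has an active arm, so each pull obeys
  -- the budget of the pulled arm. Evaluating this at the last pull of each arm bounds the total
  -- count, whence the `+ 1` in the budget.
  have key : ∀ s, 1 ≤ s → s < t → bracket s = r → I s ∈ A r ∧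
      (0 < pulls I (I s) r s → (pulls I (I s) r s : ℝ) + 1 ≤ B (I s)) := by
    intro s hs1 hst hsr
    obtain ⟨g, hg, hgO, hgU⟩ := hcon s hs1 hst hsr
    have := h.pull_of_active (θ := θ) hs1 (g := g) (by rwa [hsr]) hgO (by rwa [hsr])
    unfold ucb at this
    rw [hsr] at this
    refine ⟨this.1, fun h0 => ?_⟩
    obtain ⟨k1, k2⟩ := this.2 h0
    refine hB _ this.1 _ h0 k1 fun h2 => ?_
    have := k2 h2
    exact this
  have hle : ∀ i ∈ A r, (pulls I i r t : ℝ) ≤ B i := by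
    intro i hi
    rcases Nat.eq_zero_or_pos (pulls I i r t) with h0 | h0
    · rw [h0]
      push_cast
      linarith [hB1 i hi]
    · obtain ⟨s, hs1, hst, hsr, hsI, hp⟩ := exists_last_pull h0
      rw [hp]
      push_cast
      rcases Nat.eq_zero_or_pos (pulls I i r s) with h0' | h0'
      · rw [h0']
        push_cast
        linarith [hB1 i hi]
      · have := (key s hs1 hst hsr).2
        rw [hsI] at this
        exact this h0'
  rw [plays_eq_sum_pulls (A := A) (I := I) fun s hs1 hst hsr => (key s hs1 hst hsr).1] at ht
  push_cast at ht
  exact absurd (Finset.sum_le_sum hle) (not_le.2 ht)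

end Run

/-! ### The number of pulls of a single arm -/

/-- The contribution of arm `i` to the complexity `hFWER`. -/
def armWeight {n : ℕ} (μ : Fin n → ℝ) (μ₀ δ : ℝ) (k : ℕ) (j i : Fin n) : ℝ :=
  if μ₀ < μ i then topGap μ μ₀ i j ^ (-2 : ℤ) *
      tlog ((n : ℝ) * k / (((j : ℝ) + 1) * δ) * tlog (topGap μ μ₀ i j ^ (-2 : ℤ)))
  else (μ j - μ i) ^ (-2 : ℤ) * tlog (tlog ((μ j - μ i) ^ (-2 : ℤ)) / δ)

lemma hFWER_eq {n : ℕ} (μ : Fin n → ℝ) (μ₀ δ : ℝ) (k : ℕ) (j : Fin n) :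
    hFWER μ μ₀ δ k j = (k : ℝ) / ((j : ℝ) + 1) * ∑ i, armWeight μ μ₀ δ k j i := by
  classical
  unfold hFWER armsAbove armsBelow armWeight
  congr 1
  rw [Finset.sum_ite]
  simp only [not_lt]

lemma one_le_zpow_neg_two {g : ℝ} (hg : 0 < g) (hg1 : g ≤ 1) : 1 ≤ g ^ (-2 : ℤ) := by
  rw [zpow_neg]
  exact (one_le_inv₀ (by positivity)).2 (by
    rw [show (2 : ℤ) = ((2 : ℕ) : ℤ) by rfl, zpow_natCast]; exact pow_le_one₀ hg.le hg1)

/-- Tightening a level by `exp (-q)` multiplies the logarithm by at most `1 + q`; this is the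
inflation of the arm weights. -/
lemma tlog_mul_exp_le (y : ℝ) (q : ℕ) (hy : 0 < y) :
    tlog (y * Real.exp q) ≤ (1 + q) * tlog y := by
  have h1 := one_le_tlog y
  have h2 := log_le_tlog y
  have hq : (0 : ℝ) ≤ q := Nat.cast_nonneg q
  refine max_le ?_ ?_
  · rw [Real.log_mul hy.ne' (Real.exp_pos _).ne', Real.log_exp]
    nlinarith
  · nlinarith

lemma tlog_two_pow_le (s : ℕ) : tlog ((2 : ℝ) ^ s) ≤ s + 1 := by
  have hs : (0 : ℝ) ≤ s := Nat.cast_nonneg s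
  refine max_le ?_ (by linarith)
  rw [Real.log_pow]
  nlinarith [Real.log_two_lt_d9]

lemma sq_le_two_mul_two_pow : ∀ r : ℕ, r ^ 2 ≤ 2 * 2 ^ r
  | 0 => by norm_num
  | 1 => by norm_num
  | 2 => by norm_num
  | r + 3 => by
    have h := sq_le_two_mul_two_pow (r + 2)
    have e : 2 ^ (r + 3) = 2 * 2 ^ (r + 2) := by ring
    rw [e]
    rcases Nat.eq_zero_or_pos r with rfl | hr
    · norm_num
    · nlinarith

/-- A level that is not much smaller than `δ` in bracket `r`. -/
structure LevelBound (δ : ℝ) (r : ℕ) (l : ℝ) : Prop where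
  pos : 0 < l
  le : l ≤ δ
  inv_le : l⁻¹ ≤ 1000 * 8 ^ r / δ ^ 2

lemma levelBound_fwer {δ : ℝ} (hδ : 0 < δ) (hδ1 : δ ≤ 1) {r b : ℕ} (hr : 1 ≤ r) (hb : 1 ≤ b)
    (hb2 : b ≤ 2 ^ r) : LevelBound δ r (δ / (b * (r : ℝ) ^ 2)) := by
  have hr' : (1 : ℝ) ≤ r := by exact_mod_cast hr
  have hb' : (1 : ℝ) ≤ b := by exact_mod_cast hb
  have hb2' : (b : ℝ) ≤ 2 ^ r := by exact_mod_cast hb2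
  have hr2 : (r : ℝ) ^ 2 ≤ 2 * 2 ^ r := by exact_mod_cast sq_le_two_mul_two_pow r
  have h2 : (1 : ℝ) ≤ 2 ^ r := one_le_pow₀ (by norm_num)
  have h8 : (8 : ℝ) ^ r = 2 ^ r * 2 ^ r * 2 ^ r := by
    rw [← mul_pow, ← mul_pow]; norm_num
  refine ⟨by positivity, ?_, ?_⟩
  · rw [div_le_iff₀ (by positivity)]
    have : 1 ≤ (b : ℝ) * (r : ℝ) ^ 2 := one_le_mul_of_one_le_of_one_le hb' (one_le_pow₀ hr')
    nlinarith
  · rw [inv_div, div_le_div_iff₀ hδ (by positivity)]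
    have h1 : (b : ℝ) * (r : ℝ) ^ 2 ≤ 2 ^ r * (2 * 2 ^ r) := by gcongr
    have h3 : (2 : ℝ) ^ r * (2 * 2 ^ r) ≤ 1000 * 8 ^ r := by
      rw [h8]; nlinarith [mul_pos (show (0 : ℝ) < 2 ^ r by positivity)
        (show (0 : ℝ) < 2 ^ r by positivity)]
    have h4 : δ ^ 2 ≤ δ := by nlinarith
    exact mul_le_mul (h1.trans h3) h4 (by positivity) (by positivity)

/-- The extra logarithm is bounded by its argument `36 r ^ 2 / δ`, which explains the second power
of `1 / δ`. With `r ^ 2 ≤ 2 * 2 ^ r`, the constant is `6.4 * 36 * 4 = 921.6`. -/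
lemma levelBound_fdr {δ : ℝ} (hδ : 0 < δ) (hδ1 : δ ≤ 1) {r b : ℕ} (hr : 1 ≤ r) (hb : 1 ≤ b)
    (hb2 : b ≤ 2 ^ r) : LevelBound δ r (((1 : ℕ) : ℝ) / b * fdrLevel δ r) := by
  have hr' : (1 : ℝ) ≤ r := by exact_mod_cast hr
  have hb' : (1 : ℝ) ≤ b := by exact_mod_cast hb
  have hb2' : (b : ℝ) ≤ 2 ^ r := by exact_mod_cast hb2
  have hr2 : (r : ℝ) ^ 2 ≤ 2 * 2 ^ r := by exact_mod_cast sq_le_two_mul_two_pow r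
  have h8 : (8 : ℝ) ^ r = 2 ^ r * 2 ^ r * 2 ^ r := by
    rw [← mul_pow, ← mul_pow]; norm_num
  set T := tlog (36 / (δ / (r : ℝ) ^ 2)) with hT
  have hT1 : 1 ≤ T := one_le_tlog _
  have hrr : 1 ≤ (r : ℝ) ^ 2 := one_le_pow₀ hr'
  have hT2 : T ≤ 36 * (r : ℝ) ^ 2 / δ := by
    have e : 36 / (δ / (r : ℝ) ^ 2) = 36 * (r : ℝ) ^ 2 / δ := by field_simp
    rw [hT, e]
    refine tlog_le_self ?_
    rw [le_div_iff₀ hδ]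
    linarith
  have hlev : ((1 : ℕ) : ℝ) / b * fdrLevel δ r = δ / (b * (r : ℝ) ^ 2 * (6.4 * T)) := by
    unfold fdrLevel
    rw [← hT]
    push_cast
    field_simp
  rw [hlev]
  refine ⟨by positivity, ?_, ?_⟩
  · rw [div_le_iff₀ (by positivity)]
    have : 1 ≤ (b : ℝ) * (r : ℝ) ^ 2 * (6.4 * T) :=
      one_le_mul_of_one_le_of_one_le (one_le_mul_of_one_le_of_one_le hb' hrr) (by linarith)
    nlinarith
  · rw [inv_div, div_le_div_iff₀ hδ (by positivity)]
    calc (b : ℝ) * (r : ℝ) ^ 2 * (6.4 * T) * δ ^ 2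
        ≤ 2 ^ r * (r : ℝ) ^ 2 * (6.4 * (36 * (r : ℝ) ^ 2 / δ)) * δ ^ 2 := by gcongr
      _ = 230.4 * (2 ^ r * ((r : ℝ) ^ 2 * (r : ℝ) ^ 2)) * δ := by field_simp; ring
      _ ≤ 230.4 * (2 ^ r * ((2 * 2 ^ r) * (2 * 2 ^ r))) * δ := by gcongr
      _ = 921.6 * 8 ^ r * δ := by rw [h8]; ring
      _ ≤ 1000 * 8 ^ r * δ := by gcongr; norm_num

/-- A level polynomially small in `2 ^ r` and `δ` changes the logarithm by a constant factor only,
and `2 ^ r` is `p` up to `64 * 2 ^ s`. The cube matches `8 ^ r = (2 ^ r) ^ 3`, and `1000 * 64 ^ 3 =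
640 ^ 3`. -/
lemma tlog_div_level_le {δ p T l : ℝ} {r s : ℕ} (hδ : 0 < δ) (hδ1 : δ ≤ 1) (hp : 0 < p)
    (hT : 1 ≤ T) (hl : LevelBound δ r l) (hr : (2 : ℝ) ^ r ≤ 64 * 2 ^ s * p) :
    tlog (T / l) ≤ 36 * (s + 1) * tlog (p / δ * T) := by
  have hTp : 0 < T := by linarith
  have h8 : (8 : ℝ) ^ r = (2 ^ r) ^ 3 := by
    rw [← pow_mul, mul_comm, pow_mul]; norm_num
  have h1 : T / l ≤ (640 * 2 ^ s * (p / δ * T)) ^ 3 := by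
    rw [div_eq_mul_inv]
    calc T * l⁻¹ ≤ T * (1000 * 8 ^ r / δ ^ 2) := by gcongr; exact hl.inv_le
      _ ≤ T * (1000 * (64 * 2 ^ s * p) ^ 3 / δ ^ 2) := by rw [h8]; gcongr
      _ = (640 * 2 ^ s * (p / δ)) ^ 3 * (T * δ) := by field_simp; ring
      _ ≤ (640 * 2 ^ s * (p / δ)) ^ 3 * T ^ 3 := by
        gcongr
        have : 1 ≤ T ^ 2 := one_le_pow₀ hT
        nlinarith
      _ = _ := by ring
  have hs : (0 : ℝ) ≤ s := Nat.cast_nonneg s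
  have h2 : tlog (640 * 2 ^ s) ≤ 10 + (s + 1) := by
    refine (tlog_mul_le (by norm_num) (by positivity)).trans (add_le_add ?_ (tlog_two_pow_le s))
    have h3 : tlog (640 : ℝ) ≤ tlog ((2 : ℝ) ^ 10) := tlog_mono (by norm_num) (by norm_num)
    have h4 : tlog ((2 : ℝ) ^ 10) ≤ (10 : ℕ) * tlog 2 := tlog_pow_le 2 10 (by norm_num)
    have h5 : tlog 2 = 1 := max_eq_right (by linarith [Real.log_two_lt_d9])
    rw [h5] at h4
    push_cast at h4
    linarith
  have hL := one_le_tlog (p / δ * T)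
  have h6 : tlog (640 * 2 ^ s * (p / δ * T)) ≤ 10 + (s + 1) + tlog (p / δ * T) :=
    (tlog_mul_le (by positivity) (by positivity)).trans (add_le_add h2 le_rfl)
  have h7 : tlog ((640 * 2 ^ s * (p / δ * T)) ^ 3)
      ≤ ((3 : ℕ) : ℝ) * tlog (640 * 2 ^ s * (p / δ * T)) := tlog_pow_le _ 3 (by norm_num)
  push_cast at h7
  have h8 := tlog_mono (div_pos hTp hl.pos) h1
  nlinarith

section Arm

variable {n : ℕ} {μ : Fin n → ℝ} {μ₀ δ : ℝ} {k : ℕ} {j : Fin n}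

lemma topGap_pos (hj : μ₀ < μ j) (i : Fin n) : 0 < topGap μ μ₀ i j :=
  (sub_pos.2 hj).trans_le (le_max_right _ _)

lemma topGap_le_one (hμ : ∀ i, μ i ∈ Set.Icc (0 : ℝ) 1) (hμ₀ : μ₀ ∈ Set.Icc (0 : ℝ) 1)
    (i : Fin n) : topGap μ μ₀ i j ≤ 1 :=
  max_le (by linarith [(hμ i).2, hμ₀.1]) (by linarith [(hμ j).2, hμ₀.1])

lemma one_le_armWeight (hμ : ∀ i, μ i ∈ Set.Icc (0 : ℝ) 1) (hμ₀ : μ₀ ∈ Set.Icc (0 : ℝ) 1)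
    (hj : μ₀ < μ j) (i : Fin n) : 1 ≤ armWeight μ μ₀ δ k j i := by
  unfold armWeight
  split_ifs with h
  · exact one_le_mul_of_one_le_of_one_le
      (one_le_zpow_neg_two (topGap_pos hj i) (topGap_le_one hμ hμ₀ i)) (one_le_tlog _)
  · exact one_le_mul_of_one_le_of_one_le (one_le_zpow_neg_two (by linarith)
      (by linarith [(hμ j).2, (hμ i).1])) (one_le_tlog _)

end Arm

/-- In bracket `r`, an arm whose samples obey the confidence bound at level `exp (-q)` is pulled at
most about `(1 + q) armWeight` times before the bracket is done. -/
lemma exists_pull_bound {c : ℝ} (hc : 0 < c) : ∃ C : ℝ, 1 ≤ C ∧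
    ∀ (n : ℕ) (μ : Fin n → ℝ) (μ₀ δ : ℝ) (k : ℕ) (j i : Fin n) (r s q : ℕ) (l : ℝ) (m : ℕ → ℝ),
      (∀ i, μ i ∈ Set.Icc (0 : ℝ) 1) → μ₀ ∈ Set.Icc (0 : ℝ) 1 → 0 < δ → δ ≤ 1 → 1 ≤ k →
      μ₀ < μ j → LevelBound δ r l → (2 : ℝ) ^ r ≤ 64 * 2 ^ s * (n * k / ((j : ℝ) + 1)) →
      (∀ u : ℕ, 1 ≤ u → |m u - μ i| ≤ confWidth c u (Real.exp (-q))) →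
      ∀ u : ℕ, 1 ≤ u → μ j ≤ m u + confWidth c u δ →
        (2 ≤ u → m (u - 1) - confWidth c (u - 1) l < μ₀) →
        (u : ℝ) + 1 ≤ C * (s + 1) * ((1 + q) * armWeight μ μ₀ δ k j i) := by
  obtain ⟨K, hK1, hK⟩ := exists_count_bound c
  -- `108 = 3 * 36`: the factor `36` is that of `tlog_div_level_le`, and `3` comes from `u + 1 ≤ 3
  -- v` below.
  refine ⟨108 * K, by linarith, ?_⟩
  intro n μ μ₀ δ k j i r s q l m hμ hμ₀ hδ hδ1 hk hj hl hr hm u hu hU hLow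
  have hw := one_le_armWeight (δ := δ) (k := k) hμ hμ₀ hj i
  have hs : (0 : ℝ) ≤ s := Nat.cast_nonneg s
  have hq : (0 : ℝ) ≤ q := Nat.cast_nonneg q
  have hu' : (1 : ℝ) ≤ u := by exact_mod_cast hu
  have hn : 0 < n := j.pos
  have hp : 0 < (n : ℝ) * k / ((j : ℝ) + 1) := by
    have : (0 : ℝ) < n := by exact_mod_cast hn
    have : (0 : ℝ) < k := by exact_mod_cast hk
    positivity
  have heq : 0 < Real.exp (-(q : ℝ)) := Real.exp_pos _
  have heq1 : Real.exp (-(q : ℝ)) ≤ 1 := Real.exp_le_one_iff.2 (by linarith)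
  have hexp : ∀ y a : ℝ, y / (a * Real.exp (-q)) = y / a * Real.exp q := by
    intro y a
    rw [Real.exp_neg]
    field_simp
  -- The widths of the samples' own level and of the algorithm's level are merged into one, at the
  -- product level.
  have width : ∀ (v : ℕ) (a b : ℝ), 0 < a → a ≤ b → a ≤ 1 →
      confWidth c v (Real.exp (-q)) + confWidth c v b
        ≤ 2 * confWidth c v (a * Real.exp (-q)) := by
    intro v a b ha hab ha1
    have h1 : confWidth c v (Real.exp (-q)) ≤ confWidth c v (a * Real.exp (-q)) :=
      confWidth_anti hc.le v (by positivity) (by nlinarith)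
    have h2 : confWidth c v b ≤ confWidth c v (a * Real.exp (-q)) :=
      confWidth_anti hc.le v (by positivity) (by nlinarith)
    linarith
  have hmu := (abs_le.1 (hm u hu)).2
  have hws : (1 + q) * armWeight μ μ₀ δ k j i
      ≤ (s + 1) * ((1 + q) * armWeight μ μ₀ δ k j i) :=
    le_mul_of_one_le_left (by nlinarith) (by linarith)
  by_cases hi : μ₀ < μ i
  · have hw' : armWeight μ μ₀ δ k j i = topGap μ μ₀ i j ^ (-2 : ℤ) *
        tlog ((n : ℝ) * k / (((j : ℝ) + 1) * δ) * tlog (topGap μ μ₀ i j ^ (-2 : ℤ))) := if_pos hi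
    rcases Nat.lt_or_ge u 2 with h1 | h2
    -- With one pull there has been no earlier lower-bound test to exploit; the weight, being at
    -- least `1`, pays for it.
    · have hu1 : (u : ℝ) = 1 := by exact_mod_cast (show u = 1 by omega)
      rw [hu1]
      have h3 : 1 ≤ (1 + q) * armWeight μ μ₀ δ k j i := by nlinarith
      nlinarith
    · have hlow := hLow h2
      have hmu' := (abs_le.1 (hm (u - 1) (by omega))).1
      set β := l * Real.exp (-q) with hβ
      have hβ0 : 0 < β := mul_pos hl.pos heq
      have w1 := width (u - 1) l l hl.pos le_rfl (hl.le.trans hδ1)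
      have w2 := width u l δ hl.pos hl.le (hl.le.trans hδ1)
      have n1 := confWidth_nonneg hc.le u β
      have n2 := confWidth_nonneg hc.le (u - 1) β
      -- The lower-bound test bounds `μ i - μ₀` after `u - 1` samples, the upper bound controls `μ j
      -- - μ i` after `u` samples, and their sum controls `μ j - μ₀`.
      have hgap : topGap μ μ₀ i j ≤ 2 * confWidth c u β + 2 * confWidth c (u - 1) β :=
        max_le (by linarith) (by linarith)
      -- Keep the larger of the two widths; the shift by one sample is absorbed by `u + 1 ≤ v + 2 ≤
      -- 3 v`.
      obtain ⟨v, hv1, hvu, hv⟩ : ∃ v : ℕ, 1 ≤ v ∧ u ≤ v + 1 ∧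
          topGap μ μ₀ i j ≤ 4 * confWidth c v β := by
        rcases le_total (confWidth c u β) (confWidth c (u - 1) β) with h | h
        · exact ⟨u - 1, by omega, by omega, by linarith⟩
        · exact ⟨u, hu, by omega, by linarith⟩
      have hb := hK _ β v (topGap_pos hj i) (topGap_le_one hμ hμ₀ i) hβ0 hv1 hv
      set D := topGap μ μ₀ i j ^ (-2 : ℤ) with hD
      have hD1 : 1 ≤ D := one_le_zpow_neg_two (topGap_pos hj i) (topGap_le_one hμ hμ₀ i)
      rw [hβ, hexp] at hb
      have t1 := tlog_mul_exp_le (tlog D / l) q (div_pos (tlog_pos _) hl.pos)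
      have t2 := tlog_div_level_le hδ hδ1 hp (one_le_tlog D) hl hr
      rw [div_div] at t2
      set L := tlog ((n : ℝ) * k / (((j : ℝ) + 1) * δ) * tlog D)
      rw [hw']
      have hv1' : (1 : ℝ) ≤ v := by exact_mod_cast hv1
      have huv : (u : ℝ) ≤ v + 1 := by exact_mod_cast hvu
      calc (u : ℝ) + 1 ≤ 3 * v := by linarith
        _ ≤ 3 * (K * (D * ((1 + q) * (36 * (s + 1) * L)))) := by
          have : tlog (tlog D / l * Real.exp q) ≤ (1 + q) * (36 * (s + 1) * L) :=
            t1.trans (mul_le_mul_of_nonneg_left t2 (by linarith))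
          have : K * (D * tlog (tlog D / l * Real.exp q))
              ≤ K * (D * ((1 + q) * (36 * (s + 1) * L))) := by gcongr
          linarith
        _ = 108 * K * (s + 1) * ((1 + q) * (D * L)) := by ring
  · have hw' : armWeight μ μ₀ δ k j i = (μ j - μ i) ^ (-2 : ℤ) *
        tlog (tlog ((μ j - μ i) ^ (-2 : ℤ)) / δ) := if_neg hi
    -- An arm at or below the threshold is limited by its upper bound alone. That bound has level
    -- `δ` in every bracket, so neither `r` nor `n k / j` enters the logarithm.
    have hg : 0 < μ j - μ i := by linarith
    have hg1 : μ j - μ i ≤ 1 := by linarith [(hμ j).2, (hμ i).1]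
    have w2 := width u δ δ hδ le_rfl hδ1
    have n1 := confWidth_nonneg hc.le u (δ * Real.exp (-q))
    have hb := hK _ (δ * Real.exp (-q)) u hg hg1 (by positivity) hu (by linarith)
    set D := (μ j - μ i) ^ (-2 : ℤ) with hD
    have hD1 : 1 ≤ D := one_le_zpow_neg_two hg hg1
    rw [hexp] at hb
    have t1 := tlog_mul_exp_le (tlog D / δ) q (div_pos (tlog_pos _) hδ)
    have h3 : (u : ℝ) ≤ K * ((1 + q) * armWeight μ μ₀ δ k j i) := by
      calc (u : ℝ) ≤ K * (D * tlog (tlog D / δ * Real.exp q)) := hb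
        _ ≤ K * (D * ((1 + q) * tlog (tlog D / δ))) := by gcongr
        _ = _ := by rw [hw']; ring
    have h4 : 1 ≤ (1 + q) * armWeight μ μ₀ δ k j i := by nlinarith
    have h5 : K * ((1 + q) * armWeight μ μ₀ δ k j i)
        ≤ K * ((s + 1) * ((1 + q) * armWeight μ μ₀ δ k j i)) := by gcongr
    have h6 : 1 ≤ K * ((s + 1) * ((1 + q) * armWeight μ μ₀ δ k j i)) :=
      one_le_mul_of_one_le_of_one_le hK1 (h4.trans hws)
    linarith

/-! ### The level at which the confidence bound of a sample sequence holds -/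

/-- The sequences whose empirical means obey the confidence bound at level `α`. -/
def confSet (c : ℝ) (ν : Measure ℝ) (α : ℝ) : Set (ℕ → ℝ) :=
  {y | ∀ u : ℕ, 1 ≤ u → |(∑ s ∈ Finset.range u, y s) / u - ∫ z, z ∂ν| ≤ confWidth c u α}

/-- The least `q ≥ 1` such that the confidence bound holds at level `exp (-q)`. -/
def confLevel (c : ℝ) (ν : Measure ℝ) (y : ℕ → ℝ) : ℕ :=
  sInf {q : ℕ | 1 ≤ q ∧ y ∈ confSet c ν (Real.exp (-q))}

/-- A bound for the second moment of `1 + confLevel`. -/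
def momentConst : ℝ := ∑' q : ℕ, (1 + (q : ℝ)) ^ 2 * Real.exp (1 - q)

section Level

variable {c : ℝ} {ν : Measure ℝ}

lemma measurableSet_confSet (α : ℝ) : MeasurableSet (confSet c ν α) := by
  have : confSet c ν α = ⋂ u : ℕ, {y | 1 ≤ u →
      |(∑ s ∈ Finset.range u, y s) / u - ∫ z, z ∂ν| ≤ confWidth c u α} := by
    ext y; simp [confSet]
  rw [this]
  refine MeasurableSet.iInter fun u => ?_
  by_cases hu : 1 ≤ u
  · simp only [hu, true_imp_iff]
    exact measurableSet_le (by fun_prop) measurable_const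
  · simp [hu]

lemma measurable_confLevel : Measurable (confLevel c ν) := by
  refine measurable_of_Iic fun q => ?_
  -- Since `sInf ∅ = 0`, sequences that obey the bound at no level belong to every `Set.Iic q`.
  have : confLevel c ν ⁻¹' Set.Iic q
      = (⋂ q : ℕ, {y | 1 ≤ q → y ∉ confSet c ν (Real.exp (-q))}) ∪
        ⋃ q' ∈ Finset.Icc 1 q, confSet c ν (Real.exp (-q')) := by
    ext y
    simp only [Set.mem_preimage, Set.mem_Iic, Set.mem_union, Set.mem_iInter, Set.mem_ofPred_eq,
      Set.mem_iUnion, Finset.mem_Icc, exists_prop]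
    constructor
    · intro h
      rcases Set.eq_empty_or_nonempty {q : ℕ | 1 ≤ q ∧ y ∈ confSet c ν (Real.exp (-q))} with
        he | hne
      · exact Or.inl fun q hq hy => Set.eq_empty_iff_forall_notMem.1 he q ⟨hq, hy⟩
      · have hm := Nat.sInf_mem hne
        exact Or.inr ⟨confLevel c ν y, ⟨hm.1, h⟩, hm.2⟩
    · rintro (h | ⟨q', hq', hy⟩)
      · have : {q : ℕ | 1 ≤ q ∧ y ∈ confSet c ν (Real.exp (-q))} = ∅ := by
          ext q
          simpa using h q
        rw [confLevel, this, Nat.sInf_empty]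
        exact Nat.zero_le _
      · have hle : confLevel c ν y ≤ q' := Nat.sInf_le ⟨hq'.1, hy⟩
        exact hle.trans hq'.2
  rw [this]
  refine MeasurableSet.union (MeasurableSet.iInter fun q => ?_)
    (Finset.measurableSet_biUnion _ fun q _ => measurableSet_confSet _)
  by_cases hq : 1 ≤ q
  · simp only [hq, true_imp_iff]
    exact (measurableSet_confSet _).compl
  · simp [hq]

variable [IsProbabilityMeasure ν]

lemma measure_compl_confSet_le (hc : IsAnytimeBound c) (hν : IsOneSubGaussian ν) {α : ℝ}
    (hα : 0 < α) (hα1 : α < 1) :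
    Measure.infinitePi (fun _ : ℕ => ν) (confSet c ν α)ᶜ ≤ ENNReal.ofReal α := by
  rw [prob_compl_eq_one_sub (measurableSet_confSet α)]
  have h := hc ν inferInstance hν α hα hα1
  rw [ENNReal.ofReal_sub _ hα.le, ENNReal.ofReal_one] at h
  refine tsub_le_iff_right.2 ((tsub_le_iff_right.1 h).trans ?_)
  rw [add_comm]
  rfl

lemma measure_compl_confSet_exp_le (hc : IsAnytimeBound c) (hν : IsOneSubGaussian ν) (q : ℕ) :
    Measure.infinitePi (fun _ : ℕ => ν) (confSet c ν (Real.exp (-q)))ᶜ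
      ≤ ENNReal.ofReal (Real.exp (-q)) := by
  rcases Nat.eq_zero_or_pos q with rfl | hq
  · simpa using prob_le_one
  · exact measure_compl_confSet_le hc hν (Real.exp_pos _)
      (by rw [← Real.exp_zero]; exact Real.exp_lt_exp.2 (by simpa using hq))

/-- Violating the bounds at all levels has probability at most `exp (-q)` for every `q`. The clause
`1 ≤ confLevel` excludes the default value `0` of an empty infimum. -/
lemma ae_confLevel (hc : IsAnytimeBound c) (hν : IsOneSubGaussian ν) :
    ∀ᵐ y ∂(Measure.infinitePi fun _ : ℕ => ν), 1 ≤ confLevel c ν y ∧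
      y ∈ confSet c ν (Real.exp (-(confLevel c ν y))) := by
  have h0 : Measure.infinitePi (fun _ : ℕ => ν)
      (⋂ q : ℕ, (confSet c ν (Real.exp (-(q + 1 : ℕ))))ᶜ) = 0 := by
    refine le_antisymm (ge_of_tendsto' (x := Filter.atTop) ?_ fun q : ℕ =>
      (measure_mono (Set.iInter_subset _ q)).trans (measure_compl_confSet_exp_le hc hν (q + 1)))
      zero_le
    rw [← ENNReal.ofReal_zero]
    refine ENNReal.tendsto_ofReal (Real.tendsto_exp_atBot.comp
      (Filter.tendsto_neg_atTop_atBot.comp (tendsto_natCast_atTop_atTop.comp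
        (Filter.tendsto_add_atTop_nat 1))))
  have h1 : ∀ᵐ y ∂(Measure.infinitePi fun _ : ℕ => ν),
      y ∉ ⋂ q : ℕ, (confSet c ν (Real.exp (-(q + 1 : ℕ))))ᶜ := measure_eq_zero_iff_ae_notMem.1 h0
  filter_upwards [h1] with y hy
  simp only [Set.mem_iInter, Set.mem_compl_iff, not_forall, not_not] at hy
  obtain ⟨q, hq⟩ := hy
  exact Nat.sInf_mem (s := {q : ℕ | 1 ≤ q ∧ y ∈ confSet c ν (Real.exp (-q))})
    ⟨q + 1, by omega, hq⟩

/-- If the least level is `q ≥ 2`, the bound at `q - 1` failed; for `q ≤ 1` the right side is at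
least `1`. -/
lemma measure_confLevel_eq_le (hc : IsAnytimeBound c) (hν : IsOneSubGaussian ν) (q : ℕ) :
    Measure.infinitePi (fun _ : ℕ => ν) (confLevel c ν ⁻¹' {q})
      ≤ ENNReal.ofReal (Real.exp (1 - q)) := by
  rcases Nat.lt_or_ge q 2 with h | h
  · refine prob_le_one.trans ?_
    rw [← ENNReal.ofReal_one]
    refine ENNReal.ofReal_le_ofReal (Real.one_le_exp ?_)
    have : (q : ℝ) ≤ 1 := by exact_mod_cast Nat.lt_succ_iff.1 h
    linarith
  · obtain ⟨p, rfl⟩ : ∃ p, q = p + 1 := ⟨q - 1, by omega⟩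
    have e : (1 : ℝ) - ((p + 1 : ℕ) : ℝ) = -p := by push_cast; ring
    rw [e]
    refine (measure_mono ?_).trans (measure_compl_confSet_exp_le hc hν p)
    intro y hy hy'
    have h1 : confLevel c ν y = p + 1 := hy
    have h2 : confLevel c ν y ≤ p := Nat.sInf_le ⟨by omega, hy'⟩
    omega

lemma summable_momentConst :
    Summable fun q : ℕ => (1 + (q : ℝ)) ^ 2 * Real.exp (1 - q) := by
  have h : ∀ k : ℕ, Summable fun q : ℕ => (q : ℝ) ^ k * Real.exp (-(q : ℝ)) := fun k => by
    simpa using Real.summable_pow_mul_exp_neg_nat_mul k one_pos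
  have := (((h 0).add ((h 1).mul_left 2)).add (h 2)).mul_left (Real.exp 1)
  refine this.congr fun q => ?_
  rw [sub_eq_add_neg, Real.exp_add]
  ring

lemma momentConst_nonneg : 0 ≤ momentConst :=
  tsum_nonneg fun q => by positivity

lemma lintegral_confLevel_sq_le (hc : IsAnytimeBound c) (hν : IsOneSubGaussian ν) :
    ∫⁻ y, ENNReal.ofReal ((1 + (confLevel c ν y : ℝ)) ^ 2) ∂(Measure.infinitePi fun _ : ℕ => ν)
      ≤ ENNReal.ofReal momentConst := by
  set P := Measure.infinitePi fun _ : ℕ => ν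
  rw [← lintegral_map (μ := P) (f := fun q : ℕ => ENNReal.ofReal ((1 + (q : ℝ)) ^ 2))
    (measurable_of_countable _) measurable_confLevel, lintegral_countable', momentConst,
    ENNReal.ofReal_tsum_of_nonneg (fun q => by positivity) summable_momentConst]
  refine ENNReal.tsum_le_tsum fun q => ?_
  rw [Measure.map_apply measurable_confLevel (measurableSet_singleton q),
    ENNReal.ofReal_mul (by positivity)]
  gcongr
  exact measure_confLevel_eq_le hc hν q

end Level

/-! ### Laws of brackets and samples -/

namespace IsModel

variable {n : ℕ} {Ω : Type*} [MeasurableSpace Ω] {P : Measure Ω} {ν : Fin n → Measure ℝ}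
  {A : Ω → ℕ → Finset (Fin n)} {X : Ω → Fin n → ℕ → ℕ → ℝ}

/-- The samples of bracket `r`. -/
def bracketSamples (X : Ω → Fin n → ℕ → ℕ → ℝ) (r : ℕ) (ω : Ω) : Fin n → ℕ → ℝ :=
  fun i s => X ω i r s

lemma measurable_bracketSamples (hM : IsModel P ν A X) (r : ℕ) :
    Measurable (bracketSamples X r) := by
  have := hM.measurable_samples
  unfold bracketSamples
  fun_prop

lemma map_samples (hM : IsModel P ν A X) (i : Fin n) (r : ℕ) :
    P.map (fun ω s => X ω i r s) = Measure.infinitePi fun _ : ℕ => ν i := by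
  have hX := hM.measurable_samples
  have h := hM.indep_samples.precomp (g := fun s : ℕ => (i, r, s)) (fun a b hab => by simpa using hab)
  rw [h.map_fun_eq_infinitePi_map fun s => by fun_prop]
  congr 1
  funext s
  exact hM.law_samples i r s

lemma measure_samples (hM : IsModel P ν A X) (i : Fin n) (r : ℕ) {F : Set (ℕ → ℝ)}
    (hF : MeasurableSet F) :
    P {ω | (fun s => X ω i r s) ∈ F} = Measure.infinitePi (fun _ : ℕ => ν i) F := by
  have hX := hM.measurable_samples
  rw [← hM.map_samples i r, Measure.map_apply (by fun_prop) hF]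
  rfl

lemma measurable_bracket (hM : IsModel P ν A X) (r : ℕ) : Measurable fun ω => A ω r :=
  (measurable_pi_apply r).comp hM.measurable_brackets

lemma indepFun_bracket (hM : IsModel P ν A X) (r : ℕ) :
    IndepFun (fun ω => A ω r) (bracketSamples X r) P :=
  hM.indep_samples_brackets.symm.comp (φ := fun a : ℕ → Finset (Fin n) => a r)
    (ψ := fun x : Fin n → ℕ → ℕ → ℝ => fun i s => x i r s) (measurable_pi_apply r) (by fun_prop)

/-- The probability that the samples of a bracket lie in a set that depends on the bracket. -/
lemma measure_bracket_mem (hM : IsModel P ν A X) (r : ℕ)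
    {F : Finset (Fin n) → Set (Fin n → ℕ → ℝ)} (hF : ∀ a, MeasurableSet (F a)) :
    P {ω | bracketSamples X r ω ∈ F (A ω r)}
      = ∑ a, P {ω | A ω r = a} * P {ω | bracketSamples X r ω ∈ F a} := by
  have e : {ω | bracketSamples X r ω ∈ F (A ω r)}
      = ⋃ a ∈ (Finset.univ : Finset (Finset (Fin n))),
        ({ω | A ω r = a} ∩ {ω | bracketSamples X r ω ∈ F a}) := by
    ext ω
    simp
  have hA := hM.measurable_bracket r
  have hY := hM.measurable_bracketSamples r
  rw [e, measure_biUnion_finset]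
  · refine Finset.sum_congr rfl fun a _ => ?_
    exact (hM.indepFun_bracket r).measure_inter_preimage_eq_mul _ _ (measurableSet_singleton a) (hF a)
  · intro B _ B' _ hne
    refine Set.disjoint_left.2 fun ω h h' => hne ?_
    exact (show A ω r = B from h.1).symm.trans h'.1
  · exact fun a _ => (hA (measurableSet_singleton a)).inter (hY (hF a))

variable [IsProbabilityMeasure P]

/-- The joint law of all samples is a product measure. Reordering the indices with the bracket first
and currying turns it into a product over brackets. -/
lemma iIndepFun_bracketSamples [∀ i, IsProbabilityMeasure (ν i)] (hM : IsModel P ν A X) :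
    iIndepFun (fun r => bracketSamples X r) P := by
  have hX := hM.measurable_samples
  set g : ℕ × (Fin n × ℕ) → Fin n × ℕ × ℕ := fun p => (p.2.1, p.1, p.2.2)
  have hg : g.Injective := by
    rintro ⟨a, b, c⟩ ⟨a', b', c'⟩ h
    simp only [g, Prod.mk.injEq] at h ⊢
    tauto
  have h1 := (hM.indep_samples.precomp hg).map_fun_eq_infinitePi_map
    (fun p => by fun_prop)
  have h2 : ∀ p : ℕ × (Fin n × ℕ), P.map (fun ω => X ω (g p).1 (g p).2.1 (g p).2.2)
      = ν p.2.1 := fun p => hM.law_samples _ _ _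
  simp only [h2] at h1
  have h3 := congrArg (Measure.map (MeasurableEquiv.curry ℕ (Fin n × ℕ) ℝ)) h1
  rw [Measure.infinitePi_map_curry (fun _ (p : Fin n × ℕ) => ν p.1),
    Measure.map_map (by fun_prop) (by fun_prop)] at h3
  have h4 : P.map (fun ω (r : ℕ) (p : Fin n × ℕ) => X ω p.1 r p.2)
      = Measure.infinitePi fun _ : ℕ => Measure.infinitePi fun p : Fin n × ℕ => ν p.1 := h3
  have h5 : ∀ r : ℕ, P.map (fun ω (p : Fin n × ℕ) => X ω p.1 r p.2)
      = Measure.infinitePi fun p : Fin n × ℕ => ν p.1 := by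
    intro r
    rw [← Measure.infinitePi_map_eval (fun _ : ℕ => Measure.infinitePi
      fun p : Fin n × ℕ => ν p.1) r, ← h4, Measure.map_map (by fun_prop) (by fun_prop)]
    rfl
  have h6 : iIndepFun (fun (r : ℕ) ω (p : Fin n × ℕ) => X ω p.1 r p.2) P := by
    rw [iIndepFun_iff_map_fun_eq_infinitePi_map (fun r => by fun_prop), h4]
    congr 1
    funext r
    exact (h5 r).symm
  exact h6.comp (fun _ (f : Fin n × ℕ → ℝ) i s => f (i, s)) fun _ => by fun_prop

/-- The `n.choose b` sets of the right size each have mass `1 / n.choose b`, which exhausts the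
total mass. -/
lemma ae_card_bracket (hM : IsModel P ν A X) (r : ℕ) :
    ∀ᵐ ω ∂P, (A ω r).card = min n (2 ^ r) := by
  set b := min n (2 ^ r) with hb
  have hA := hM.measurable_bracket r
  have hmeas : MeasurableSet {ω | (A ω r).card = b} :=
    hA (Set.to_countable {B : Finset (Fin n) | B.card = b}).measurableSet
  have h1 : P {ω | (A ω r).card = b} = 1 := by
    have e : {ω | (A ω r).card = b}
        = ⋃ B ∈ Finset.powersetCard b Finset.univ, {ω | A ω r = B} := by
      ext ω
      simp [Finset.mem_powersetCard]
    rw [e, measure_biUnion_finset]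
    · rw [Finset.sum_congr rfl fun B hB => hM.law_brackets r B (Finset.mem_powersetCard.1 hB).2,
        Finset.sum_const, Finset.card_powersetCard, Finset.card_univ, Fintype.card_fin,
        nsmul_eq_mul]
      refine ENNReal.mul_inv_cancel ?_ (ENNReal.natCast_ne_top _)
      exact_mod_cast (Nat.choose_pos (min_le_left _ _)).ne'
    · intro B _ B' _ hne
      refine Set.disjoint_left.2 fun ω h h' => hne ?_
      exact (show A ω r = B from h).symm.trans h'
    · exact fun B _ => hA (measurableSet_singleton B)
  exact (prob_compl_eq_zero_iff hmeas).2 h1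

/-- Events that concern different brackets are independent. -/
lemma measure_forall_bracket_mem [∀ i, IsProbabilityMeasure (ν i)] (hM : IsModel P ν A X) (J : Finset ℕ)
    {F : ℕ → Finset (Fin n) → Set (Fin n → ℕ → ℝ)} (hF : ∀ r a, MeasurableSet (F r a)) :
    P {ω | ∀ r ∈ J, bracketSamples X r ω ∈ F r (A ω r)}
      = ∏ r ∈ J, P {ω | bracketSamples X r ω ∈ F r (A ω r)} := by
  classical
  have hA := fun r => hM.measurable_bracket r
  have hY := fun r => hM.measurable_bracketSamples r
  simp_rw [fun r => hM.measure_bracket_mem r (hF r)]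
  -- Split according to the joint value `p` of the brackets in `J`. For fixed `p` the sample events
  -- no longer involve the random brackets, so the three independence assumptions factorise each
  -- piece.
  rw [Finset.prod_sum]
  have e : {ω | ∀ r ∈ J, bracketSamples X r ω ∈ F r (A ω r)}
      = ⋃ p ∈ J.pi fun _ => (Finset.univ : Finset (Finset (Fin n))),
        ({ω | ∀ r (hr : r ∈ J), A ω r = p r hr} ∩
          {ω | ∀ r (hr : r ∈ J), bracketSamples X r ω ∈ F r (p r hr)}) := by
    ext ω
    simp only [Set.mem_ofPred_eq, Set.mem_iUnion, Finset.mem_pi, Finset.mem_univ, exists_prop,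
      implies_true, true_and, Set.mem_inter_iff]
    constructor
    · exact fun h => ⟨fun r _ => A ω r, fun r _ => rfl, h⟩
    · rintro ⟨p, h1, h2⟩ r hr
      rw [h1 r hr]
      exact h2 r hr
  have hmA : ∀ p : (r : ℕ) → r ∈ J → Finset (Fin n),
      MeasurableSet {a : ℕ → Finset (Fin n) | ∀ r (hr : r ∈ J), a r = p r hr} := fun p => by
    simp only [Set.ofPred_forall]
    exact MeasurableSet.iInter fun r => MeasurableSet.iInter fun hr =>
      (measurable_pi_apply (X := fun _ : ℕ => Finset (Fin n)) r) (measurableSet_singleton _)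
  have hmX : ∀ p : (r : ℕ) → r ∈ J → Finset (Fin n),
      MeasurableSet {x : Fin n → ℕ → ℕ → ℝ |
        ∀ r (hr : r ∈ J), (fun i s => x i r s) ∈ F r (p r hr)} := fun p => by
    simp only [Set.ofPred_forall]
    refine MeasurableSet.iInter fun r => MeasurableSet.iInter fun hr => ?_
    have : Measurable fun x : Fin n → ℕ → ℕ → ℝ => fun i s => x i r s := by fun_prop
    exact this (hF r _)
  rw [e, measure_biUnion_finset]
  · refine Finset.sum_congr rfl fun p _ => ?_
    rw [Finset.prod_mul_distrib]
    have h0 := hM.indep_samples_brackets.symm.measure_inter_preimage_eq_mul _ _ (hmA p) (hmX p)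
    have h1 : P (A ⁻¹' {a | ∀ r (hr : r ∈ J), a r = p r hr})
        = ∏ r ∈ J.attach, P {ω | A ω r = p r r.2} := by
      have := hM.indep_brackets.measure_inter_preimage_eq_mul J
        (sets := fun r => {a | ∀ hr : r ∈ J, a = p r hr})
        (fun r _ => (Set.to_countable _).measurableSet)
      rw [← Finset.prod_attach] at this
      have e1 : A ⁻¹' {a | ∀ r (hr : r ∈ J), a r = p r hr}
          = ⋂ r ∈ J, (fun ω => A ω r) ⁻¹' {a | ∀ hr : r ∈ J, a = p r hr} := by
        ext ω
        simp only [Set.mem_preimage, Set.mem_ofPred_eq, Set.mem_iInter]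
        exact ⟨fun h r _ hr => h r hr, fun h r hr => h r hr hr⟩
      rw [e1, this]
      refine Finset.prod_congr rfl fun r _ => ?_
      congr 1
      ext ω
      simp only [Set.mem_preimage, Set.mem_ofPred_eq]
      exact ⟨fun h => h r.2, fun h _ => h⟩
    have h2 : P (X ⁻¹' {x | ∀ r (hr : r ∈ J), (fun i s => x i r s) ∈ F r (p r hr)})
        = ∏ r ∈ J.attach, P {ω | bracketSamples X r ω ∈ F r (p r r.2)} := by
      have := hM.iIndepFun_bracketSamples.measure_inter_preimage_eq_mul J
        (sets := fun r => if hr : r ∈ J then F r (p r hr) else ∅)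
        (fun r hr => by simp only [hr, dif_pos]; exact hF r _)
      rw [← Finset.prod_attach] at this
      have e1 : X ⁻¹' {x | ∀ r (hr : r ∈ J), (fun i s => x i r s) ∈ F r (p r hr)}
          = ⋂ r ∈ J, bracketSamples X r ⁻¹' (if hr : r ∈ J then F r (p r hr) else ∅) := by
        ext ω
        simp only [Set.mem_preimage, Set.mem_ofPred_eq, Set.mem_iInter]
        refine forall_congr' fun r => forall_congr' fun hr => ?_
        rw [dif_pos hr]
        rfl
      rw [e1, this]
      refine Finset.prod_congr rfl fun r _ => ?_
      rw [dif_pos r.2]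
      rfl
    rw [← h1, ← h2]
    exact h0
  · intro p _ p' _ hne
    refine Set.disjoint_left.2 fun ω h h' => hne ?_
    funext r hr
    exact (h.1 r hr).symm.trans (h'.1 r hr)
  · exact fun p _ => (hM.measurable_brackets (hmA p)).inter (hM.measurable_samples (hmX p))

end IsModel

/-! ### Uniform sets of fixed size -/

section Uniform

variable {n b : ℕ}

/-- Removing `S` is a bijection onto the sets of size `b - S.card` in the complement of `S`. -/
lemma card_filter_superset (S : Finset (Fin n)) (hS : S.card ≤ b) :
    {B ∈ Finset.powersetCard b (Finset.univ : Finset (Fin n)) | S ⊆ B}.card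
      = (n - S.card).choose (b - S.card) := by
  have h : (Finset.powersetCard (b - S.card) Sᶜ).card = (n - S.card).choose (b - S.card) := by
    rw [Finset.card_powersetCard, Finset.card_compl, Fintype.card_fin]
  rw [← h]
  refine Finset.card_bij' (fun B _ => B \ S) (fun B _ => B ∪ S) ?_ ?_ ?_ ?_
  · intro B hB
    simp only [Finset.mem_filter, Finset.mem_powersetCard] at hB ⊢
    refine ⟨fun x hx => ?_, by rw [Finset.card_sdiff_of_subset hB.2, hB.1.2]⟩
    exact Finset.mem_compl.2 (Finset.mem_sdiff.1 hx).2
  · intro B hB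
    simp only [Finset.mem_filter, Finset.mem_powersetCard] at hB ⊢
    have hd : Disjoint B S := Finset.disjoint_left.2 fun x hx => Finset.mem_compl.1 (hB.1 hx)
    refine ⟨⟨Finset.subset_univ _, ?_⟩, Finset.subset_union_right⟩
    rw [Finset.card_union_of_disjoint hd, hB.2]
    omega
  · intro B hB
    simp only [Finset.mem_filter] at hB
    exact Finset.sdiff_union_of_subset hB.2
  · intro B hB
    simp only [Finset.mem_powersetCard] at hB
    have hd : Disjoint B S := Finset.disjoint_left.2 fun x hx => Finset.mem_compl.1 (hB.1 hx)
    rw [Finset.union_sdiff_right, Finset.sdiff_eq_self_of_disjoint hd]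

lemma card_filter_mem (hb : 1 ≤ b) (i : Fin n) :
    ({B ∈ Finset.powersetCard b (Finset.univ : Finset (Fin n)) | i ∈ B}.card : ℝ)
      = (b / n : ℝ) * n.choose b := by
  have hn : 0 < n := i.pos
  have h := card_filter_superset (b := b) {i} (by simpa using hb)
  simp only [Finset.singleton_subset_iff, Finset.card_singleton] at h
  rw [h]
  obtain ⟨m, rfl⟩ : ∃ m, n = m + 1 := ⟨n - 1, by omega⟩
  obtain ⟨a, rfl⟩ : ∃ a, b = a + 1 := ⟨b - 1, by omega⟩
  have := Nat.add_one_mul_choose_eq m a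
  have h2 : ((m : ℝ) + 1) * (m.choose a : ℝ) = ((m + 1).choose (a + 1) : ℝ) * (a + 1) := by
    exact_mod_cast this
  simp only [Nat.add_sub_cancel]
  push_cast
  field_simp
  linarith

/-- Sampling without replacement is negatively correlated: `(b - 1) / (n - 1) ≤ b / n`. -/
lemma card_filter_mem_mem_le (hbn : b ≤ n) {i i' : Fin n} (hii : i ≠ i') :
    ({B ∈ Finset.powersetCard b (Finset.univ : Finset (Fin n)) | i ∈ B ∧ i' ∈ B}.card : ℝ)
      ≤ (b / n : ℝ) ^ 2 * n.choose b := by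
  rcases Nat.lt_or_ge b 2 with hb | hb
  · have h0 : {B ∈ Finset.powersetCard b (Finset.univ : Finset (Fin n)) | i ∈ B ∧ i' ∈ B} = ∅ := by
      refine Finset.filter_eq_empty_iff.2 fun B hB hmem => ?_
      have h1 : ({i, i'} : Finset (Fin n)) ⊆ B := by
        intro x hx
        simp only [Finset.mem_insert, Finset.mem_singleton] at hx
        rcases hx with rfl | rfl
        exacts [hmem.1, hmem.2]
      have h2 := Finset.card_le_card h1
      rw [Finset.card_pair hii, (Finset.mem_powersetCard.1 hB).2] at h2
      omega
    rw [h0]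
    simp only [Finset.card_empty, Nat.cast_zero]
    positivity
  have h := card_filter_superset (b := b) {i, i'} (by rw [Finset.card_pair hii]; exact hb)
  simp only [Finset.insert_subset_iff, Finset.singleton_subset_iff, Finset.card_pair hii] at h
  rw [h]
  obtain ⟨m, rfl⟩ : ∃ m, n = m + 2 := ⟨n - 2, by omega⟩
  obtain ⟨a, rfl⟩ : ∃ a, b = a + 2 := ⟨b - 2, by omega⟩
  have e1 := Nat.add_one_mul_choose_eq m a
  have e2 := Nat.add_one_mul_choose_eq (m + 1) (a + 1)
  have h1 : ((m : ℝ) + 1) * (m.choose a : ℝ) = ((m + 1).choose (a + 1) : ℝ) * (a + 1) := by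
    exact_mod_cast e1
  have h2 : ((m : ℝ) + 2) * ((m + 1).choose (a + 1) : ℝ)
      = ((m + 2).choose (a + 2) : ℝ) * (a + 2) := by
    exact_mod_cast e2
  have ham : (a : ℝ) ≤ m := by exact_mod_cast (show a ≤ m by omega)
  simp only [Nat.add_sub_cancel]
  push_cast
  set c0 := (m.choose a : ℝ)
  set c1 := ((m + 1).choose (a + 1) : ℝ)
  set c2 := ((m + 2).choose (a + 2) : ℝ)
  have hc1 : c1 = c2 * (a + 2) / (m + 2) := by field_simp; linarith
  have hc0 : c0 = c1 * (a + 1) / (m + 1) := by field_simp; linarith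
  have hq : ((a : ℝ) + 1) / (m + 1) ≤ (a + 2) / (m + 2) := by
    rw [div_le_div_iff₀ (by positivity) (by positivity)]
    nlinarith
  have hc1' : 0 ≤ c1 := Nat.cast_nonneg _
  calc c0 = c1 * ((a + 1) / (m + 1)) := by rw [hc0]; ring
    _ ≤ c1 * ((a + 2) / (m + 2)) := by gcongr
    _ = _ := by rw [hc1]; ring

lemma sum_card_inter (hb : 1 ≤ b) (J : Finset (Fin n)) :
    ∑ B ∈ Finset.powersetCard b (Finset.univ : Finset (Fin n)), ((B ∩ J).card : ℝ)
      = (b * J.card / n : ℝ) * n.choose b := by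
  have h1 : ∀ B : Finset (Fin n), ((B ∩ J).card : ℝ) = ∑ i ∈ J, if i ∈ B then (1 : ℝ) else 0 := by
    intro B
    rw [Finset.inter_comm, ← Finset.filter_mem_eq_inter, Finset.sum_boole]
  simp_rw [h1]
  rw [Finset.sum_comm]
  simp_rw [Finset.sum_boole, fun i => card_filter_mem hb i]
  rw [Finset.sum_const, nsmul_eq_mul]
  ring

/-- The diagonal contributes the mean and, by negative correlation, the other pairs at most its
square. Hence the variance is at most the mean. -/
lemma sum_card_inter_sq_le (hb : 1 ≤ b) (hbn : b ≤ n) (J : Finset (Fin n)) :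
    ∑ B ∈ Finset.powersetCard b (Finset.univ : Finset (Fin n)), ((B ∩ J).card : ℝ) ^ 2
      ≤ ((b * J.card / n : ℝ) + (b * J.card / n : ℝ) ^ 2) * n.choose b := by
  have h1 : ∀ B : Finset (Fin n), ((B ∩ J).card : ℝ) = ∑ i ∈ J, if i ∈ B then (1 : ℝ) else 0 := by
    intro B
    rw [Finset.inter_comm, ← Finset.filter_mem_eq_inter, Finset.sum_boole]
  have h2 : ∀ B : Finset (Fin n), ((B ∩ J).card : ℝ) ^ 2
      = ∑ i ∈ J, ∑ i' ∈ J, if i ∈ B ∧ i' ∈ B then (1 : ℝ) else 0 := by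
    intro B
    rw [sq, h1, Finset.sum_mul_sum]
    refine Finset.sum_congr rfl fun i _ => Finset.sum_congr rfl fun i' _ => ?_
    by_cases hi : i ∈ B <;> by_cases hi' : i' ∈ B <;> simp [hi, hi']
  simp_rw [h2]
  rw [Finset.sum_comm]
  have h3 : ∀ i ∈ J, ∑ B ∈ Finset.powersetCard b (Finset.univ : Finset (Fin n)),
      ∑ i' ∈ J, (if i ∈ B ∧ i' ∈ B then (1 : ℝ) else 0)
      ≤ ((b / n : ℝ) + J.card * (b / n : ℝ) ^ 2) * n.choose b := by
    intro i hi
    rw [Finset.sum_comm, ← Finset.add_sum_erase J _ hi]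
    simp_rw [and_self, Finset.sum_boole]
    rw [card_filter_mem hb i, add_mul]
    refine add_le_add le_rfl ?_
    calc ∑ i' ∈ J.erase i,
        ({B ∈ Finset.powersetCard b (Finset.univ : Finset (Fin n)) | i ∈ B ∧ i' ∈ B}.card : ℝ)
        ≤ ∑ i' ∈ J.erase i, (b / n : ℝ) ^ 2 * n.choose b :=
          Finset.sum_le_sum fun i' hi' =>
            card_filter_mem_mem_le hbn (Finset.ne_of_mem_erase hi').symm
      _ ≤ J.card * (b / n : ℝ) ^ 2 * n.choose b := by
          rw [Finset.sum_const, nsmul_eq_mul, mul_assoc]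
          gcongr
          exact Finset.erase_subset _ _
  refine (Finset.sum_le_sum h3).trans (le_of_eq ?_)
  rw [Finset.sum_const, nsmul_eq_mul]
  ring

/-- Chebyshev's inequality for the number of elements of `J` in a uniform set of size `b`. -/
lemma card_filter_inter_lt_le (hb : 1 ≤ b) (hbn : b ≤ n) (J : Finset (Fin n)) {x : ℝ}
    (hx : 0 < x) (hJ : 16 * x ≤ b * J.card / n) (hJ' : 32 ≤ (b * J.card / n : ℝ)) :
    ({B ∈ Finset.powersetCard b (Finset.univ : Finset (Fin n)) | ((B ∩ J).card : ℝ) < x}.card : ℝ)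
      ≤ 1 / 16 * n.choose b := by
  set m : ℝ := b * J.card / n with hm
  set S := Finset.powersetCard b (Finset.univ : Finset (Fin n))
  have hS : (S.card : ℝ) = n.choose b := by
    rw [Finset.card_powersetCard, Finset.card_univ, Fintype.card_fin]
  have h1 : ∑ B ∈ S, (((B ∩ J).card : ℝ) - m) ^ 2 ≤ m * n.choose b := by
    have e : ∀ B : Finset (Fin n), (((B ∩ J).card : ℝ) - m) ^ 2
        = ((B ∩ J).card : ℝ) ^ 2 - 2 * m * ((B ∩ J).card : ℝ) + m ^ 2 := fun B => by ring
    simp_rw [e]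
    rw [Finset.sum_add_distrib, Finset.sum_sub_distrib, ← Finset.mul_sum, sum_card_inter hb,
      Finset.sum_const, nsmul_eq_mul, hS]
    have := sum_card_inter_sq_le hb hbn J
    rw [← hm] at this ⊢
    linarith
  -- As `x ≤ m / 16`, a count below `x` deviates from `m` by more than `15 m / 16`; `m ≥ 32` then
  -- makes the squared deviation at least `16 m`.
  have h2 : ({B ∈ S | ((B ∩ J).card : ℝ) < x}.card : ℝ) * (15 / 16 * m) ^ 2
      ≤ ∑ B ∈ S, (((B ∩ J).card : ℝ) - m) ^ 2 := by
    rw [← nsmul_eq_mul, ← Finset.sum_const]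
    refine (Finset.sum_le_sum fun B hB => ?_).trans
      (Finset.sum_le_sum_of_subset_of_nonneg (Finset.filter_subset _ S) fun _ _ _ => sq_nonneg _)
    have hlt := (Finset.mem_filter.1 hB).2
    nlinarith
  have h3 := h2.trans h1
  have hC : (0 : ℝ) ≤ n.choose b := Nat.cast_nonneg _
  have h4 : (15 / 16 * m) ^ 2 ≥ 16 * m := by nlinarith
  have h5 := mul_le_mul_of_nonneg_left h4
    (Nat.cast_nonneg (α := ℝ) {B ∈ S | ((B ∩ J).card : ℝ) < x}.card)
  have h6 : ({B ∈ S | ((B ∩ J).card : ℝ) < x}.card : ℝ) * 16 * m ≤ n.choose b * m := by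
    linarith
  have := le_of_mul_le_mul_right h6 (by linarith)
  linarith

end Uniform

namespace IsModel

variable {n : ℕ} {Ω : Type*} [MeasurableSpace Ω] {P : Measure Ω} [IsProbabilityMeasure P]
  {ν : Fin n → Measure ℝ} {A : Ω → ℕ → Finset (Fin n)} {X : Ω → Fin n → ℕ → ℕ → ℝ}

lemma sum_bracket (hM : IsModel P ν A X) (r : ℕ) (f : Finset (Fin n) → ℝ≥0∞) :
    ∑ a, P {ω | A ω r = a} * f a
      = ∑ a ∈ Finset.powersetCard (min n (2 ^ r)) Finset.univ,
        ENNReal.ofReal (1 / n.choose (min n (2 ^ r))) * f a := by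
  rw [← Finset.sum_subset (Finset.subset_univ
    (Finset.powersetCard (min n (2 ^ r)) (Finset.univ : Finset (Fin n))))]
  · refine Finset.sum_congr rfl fun a ha => ?_
    rw [hM.law_brackets r a (Finset.mem_powersetCard.1 ha).2, one_div, ENNReal.ofReal_inv_of_pos
      (by exact_mod_cast Nat.choose_pos (min_le_left _ _)), ENNReal.ofReal_natCast]
  · intro a _ ha
    have h0 : P {ω | A ω r = a} = 0 := by
      refine measure_mono_null ?_ (ae_iff.1 (hM.ae_card_bracket r))
      intro ω hω
      have hω' : A ω r = a := hω
      simp only [Set.mem_ofPred_eq, hω']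
      intro hcard
      exact ha (Finset.mem_powersetCard.2 ⟨Finset.subset_univ _, hcard⟩)
    rw [h0, zero_mul]

lemma sum_bracket_weight (hM : IsModel P ν A X) (hn : 1 ≤ n) (r : ℕ) {w : Fin n → ℝ}
    (hw : ∀ i, 0 ≤ w i) :
    ∑ a, P {ω | A ω r = a} * ENNReal.ofReal (∑ i ∈ a, w i)
      = ENNReal.ofReal ((min n (2 ^ r) : ℕ) / n * ∑ i, w i) := by
  set b := min n (2 ^ r) with hb
  have hb1 : 1 ≤ b := le_min hn Nat.one_le_two_pow
  have hC : (0 : ℝ) < n.choose b := by exact_mod_cast Nat.choose_pos (min_le_left _ _)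
  rw [hM.sum_bracket, ← hb]
  simp_rw [← ENNReal.ofReal_mul (show (0 : ℝ) ≤ 1 / n.choose b by positivity)]
  rw [← ENNReal.ofReal_sum_of_nonneg fun a _ =>
    mul_nonneg (by positivity) (Finset.sum_nonneg fun i _ => hw i), ← Finset.mul_sum]
  congr 1
  have e : ∀ a : Finset (Fin n), ∑ i ∈ a, w i = ∑ i, if i ∈ a then w i else 0 := fun a => by
    rw [Finset.sum_ite_mem, Finset.univ_inter]
  rw [Finset.sum_congr rfl fun a _ => e a, Finset.sum_comm]
  have e2 : ∀ i : Fin n, ∑ a ∈ Finset.powersetCard b Finset.univ, (if i ∈ a then w i else 0)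
      = (b / n : ℝ) * n.choose b * w i := fun i => by
    rw [← Finset.sum_filter, Finset.sum_const, nsmul_eq_mul, card_filter_mem hb1]
  simp_rw [e2]
  rw [← Finset.mul_sum]
  field_simp

/-- The probability that a fixed arm is in bracket `r`. -/
lemma measure_mem_bracket (hM : IsModel P ν A X) (r : ℕ) (i : Fin n) :
    P {ω | i ∈ A ω r} = ENNReal.ofReal ((min n (2 ^ r) : ℕ) / n) := by
  have h1 := hM.sum_bracket_weight i.pos r (w := fun i' => if i' = i then 1 else 0)
    (fun i' => by split_ifs <;> norm_num)
  simp only [Finset.sum_ite_eq', Finset.mem_univ, if_true, mul_one] at h1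
  rw [← h1]
  have h2 := hM.measure_bracket_mem r (F := fun a => if i ∈ a then Set.univ else ∅)
    (fun a => by split_ifs <;> simp)
  have e : {ω | bracketSamples X r ω ∈ (if i ∈ A ω r then Set.univ else (∅ : Set _))}
      = {ω | i ∈ A ω r} := by
    ext ω
    by_cases h : i ∈ A ω r <;> simp [h]
  rw [e] at h2
  rw [h2]
  refine Finset.sum_congr rfl fun a _ => ?_
  by_cases h : i ∈ a <;> simp [h]

lemma measure_bracket_card_lt (hM : IsModel P ν A X) (hn : 1 ≤ n) (r : ℕ) (J : Finset (Fin n))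
    {x : ℝ} (hx : 0 < x) (hJ : 16 * x ≤ ((min n (2 ^ r) : ℕ) : ℝ) * J.card / n)
    (hJ' : 32 ≤ (((min n (2 ^ r) : ℕ) : ℝ) * J.card / n)) :
    ∑ a, P {ω | A ω r = a} * (if ((a ∩ J).card : ℝ) < x then 1 else 0)
      ≤ ENNReal.ofReal (1 / 16) := by
  set b := min n (2 ^ r) with hb
  have hb1 : 1 ≤ b := le_min hn Nat.one_le_two_pow
  have hC : (0 : ℝ) < n.choose b := by exact_mod_cast Nat.choose_pos (min_le_left _ _)
  have h := card_filter_inter_lt_le hb1 (min_le_left _ _) J hx hJ hJ'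
  rw [hM.sum_bracket, ← hb, ← Finset.mul_sum, Finset.sum_boole, ← ENNReal.ofReal_natCast,
    ← ENNReal.ofReal_mul (by positivity)]
  refine ENNReal.ofReal_le_ofReal ?_
  calc 1 / (n.choose b : ℝ) * _ ≤ 1 / (n.choose b : ℝ) * (1 / 16 * n.choose b) := by gcongr
    _ = 1 / 16 := by field_simp

end IsModel

/-! ### Control of false discoveries -/

lemma exists_mem_lcbAbove_of_mem_fwerSet {n : ℕ} {c μ₀ δ : ℝ} {A : ℕ → Finset (Fin n)}
    {x : Fin n → ℕ → ℕ → ℝ} {I : ℕ → Fin n} {i : Fin n} :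
    ∀ {t : ℕ}, i ∈ fwerSet c μ₀ δ A x I t → ∃ s, 1 ≤ s ∧
      i ∈ lcbAbove c μ₀ (δ / ((A (bracket s)).card * (bracket s : ℝ) ^ 2)) A x I s
  | 0, h => by simp [fwerSet] at h
  | t + 1, h => by
    rw [fwerSet] at h
    split_ifs at h with h0
    · exact exists_mem_lcbAbove_of_mem_fwerSet h
    · rcases Finset.mem_union.1 h with h | h
      · exact exists_mem_lcbAbove_of_mem_fwerSet h
      · exact ⟨t, by omega, h⟩

/-- A false discovery in bracket `r` forces an arm of the bracket to violate its bound at a level of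
order `δ / (b r ^ 2)`. A fixed arm lies in the bracket with probability `b / n`, so summing over the
`n` arms cancels `b` and leaves a convergent sum over `r`. -/
lemma measure_fwer_error_le {n : ℕ} {Ω : Type*} [MeasurableSpace Ω] {P : Measure Ω}
    [IsProbabilityMeasure P] {ν : Fin n → Measure ℝ} [∀ i, IsProbabilityMeasure (ν i)]
    {A : Ω → ℕ → Finset (Fin n)} {X : Ω → Fin n → ℕ → ℕ → ℝ} (hM : IsModel P ν A X)
    (I : Ω → ℕ → Fin n) {c : ℝ} (hc : IsAnytimeBound c) (hν : ∀ i, IsOneSubGaussian (ν i))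
    {μ : Fin n → ℝ} (hμ : ∀ i, μ i = ∫ y, y ∂(ν i)) (μ₀ : ℝ) {δ : ℝ} (hδ : 0 < δ)
    (hδ' : δ ≤ 1 / 40) (hn : 1 ≤ n) :
    P {ω | ∃ t, (fwerSet c μ₀ δ (A ω) (X ω) (I ω) t ∩ armsBelow μ μ₀).Nonempty}
      ≤ ENNReal.ofReal (2 * δ) := by
  have hcp := hc.pos
  set b : ℕ → ℕ := fun r => min n (2 ^ (r + 1)) with hb
  have hb1 : ∀ r, 1 ≤ b r := fun r => le_min hn Nat.one_le_two_pow
  -- A level slightly larger than the tested one makes the width strictly smaller, which excludes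
  -- equality in the test. The slack is affordable: `6 / 5 * π ^ 2 / 6 ≤ 6 / 5 * 33 / 20 < 2`.
  set β : ℕ → ℝ := fun r => 6 / 5 * (δ / (b r * ((r + 1 : ℕ) : ℝ) ^ 2)) with hβ
  have hsub : ∀ᵐ ω ∂P, ω ∈ {ω | ∃ t, (fwerSet c μ₀ δ (A ω) (X ω) (I ω) t ∩
        armsBelow μ μ₀).Nonempty} →
      ω ∈ ⋃ r, ⋃ i, ({ω | i ∈ A ω (r + 1)} ∩
        {ω | (fun s => X ω i (r + 1) s) ∈ (confSet c (ν i) (β r))ᶜ}) := by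
    filter_upwards [ae_all_iff.2 hM.ae_card_bracket] with ω hω
    rintro ⟨t, i, hi⟩
    obtain ⟨hi1, hi2⟩ := Finset.mem_inter.1 hi
    obtain ⟨s, hs, hmem⟩ := exists_mem_lcbAbove_of_mem_fwerSet hi1
    obtain ⟨e1, e2, e3⟩ := mem_lcbAbove.1 hmem
    obtain ⟨r, hr⟩ : ∃ r, bracket s = r + 1 := ⟨bracket s - 1, by have := bracket_pos hs; omega⟩
    rw [hr] at e1 e2 e3
    rw [hω] at e3
    refine Set.mem_iUnion.2 ⟨r, Set.mem_iUnion.2 ⟨i, e1, ?_⟩⟩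
    intro hgood
    set u := pulls (I ω) i (r + 1) s
    have h1 := (abs_le.1 (hgood u e2)).2
    rw [← hμ i] at h1
    have h2 : μ i ≤ μ₀ := by simpa [armsBelow] using hi2
    have hb1' : (1 : ℝ) ≤ b r := by exact_mod_cast hb1 r
    have hr1 : (1 : ℝ) ≤ ((r + 1 : ℕ) : ℝ) := by exact_mod_cast Nat.le_add_left 1 r
    have hα : 0 < δ / (b r * ((r + 1 : ℕ) : ℝ) ^ 2) := by positivity
    have hα1 : δ / (b r * ((r + 1 : ℕ) : ℝ) ^ 2) ≤ δ :=
      div_le_self hδ.le (one_le_mul_of_one_le_of_one_le hb1' (one_le_pow₀ hr1))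
    have h3 : confWidth c u (β r) < confWidth c u (δ / (b r * ((r + 1 : ℕ) : ℝ) ^ 2)) :=
      confWidth_strictAnti hcp e2 hα (by rw [hβ]; linarith) (by rw [hβ]; linarith)
    have h4 : empMean (X ω) i (r + 1) u = (∑ s ∈ Finset.range u, X ω i (r + 1) s) / u := rfl
    linarith
  have hterm : ∀ r i, P ({ω | i ∈ A ω (r + 1)} ∩
      {ω | (fun s => X ω i (r + 1) s) ∈ (confSet c (ν i) (β r))ᶜ})
      ≤ ENNReal.ofReal ((b r : ℝ) / n * β r) := by
    intro r i
    have hb1' : (1 : ℝ) ≤ b r := by exact_mod_cast hb1 r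
    have hr1 : (1 : ℝ) ≤ ((r + 1 : ℕ) : ℝ) := by exact_mod_cast Nat.le_add_left 1 r
    have hα : 0 < δ / (b r * ((r + 1 : ℕ) : ℝ) ^ 2) := by positivity
    have hα1 : δ / (b r * ((r + 1 : ℕ) : ℝ) ^ 2) ≤ δ :=
      div_le_self hδ.le (one_le_mul_of_one_le_of_one_le hb1' (one_le_pow₀ hr1))
    have hind := (hM.indepFun_bracket (r + 1)).measure_inter_preimage_eq_mul
      {a | i ∈ a} {y | y i ∈ (confSet c (ν i) (β r))ᶜ} (Set.to_countable _).measurableSet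
      ((measurable_pi_apply i) (measurableSet_confSet _).compl)
    have h1 : P ((fun ω => A ω (r + 1)) ⁻¹' {a | i ∈ a})
        = ENNReal.ofReal ((b r : ℕ) / n) := hM.measure_mem_bracket (r + 1) i
    have h2 : P (IsModel.bracketSamples X (r + 1) ⁻¹' {y | y i ∈ (confSet c (ν i) (β r))ᶜ})
        ≤ ENNReal.ofReal (β r) := by
      have := hM.measure_samples i (r + 1) (measurableSet_confSet (c := c) (ν := ν i) (β r)).compl
      refine (le_of_eq this).trans ?_
      exact measure_compl_confSet_le hc (hν i) (by rw [hβ]; positivity) (by rw [hβ]; linarith)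
    refine (le_of_eq hind).trans ?_
    rw [h1, ENNReal.ofReal_mul (by positivity)]
    gcongr
  have hn' : (0 : ℝ) < n := by exact_mod_cast hn
  calc P {ω | ∃ t, (fwerSet c μ₀ δ (A ω) (X ω) (I ω) t ∩ armsBelow μ μ₀).Nonempty}
      ≤ P (⋃ r, ⋃ i, ({ω | i ∈ A ω (r + 1)} ∩
        {ω | (fun s => X ω i (r + 1) s) ∈ (confSet c (ν i) (β r))ᶜ})) := measure_mono_ae hsub
    _ ≤ ∑' r, ∑ i : Fin n, ENNReal.ofReal ((b r : ℝ) / n * β r) := by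
        refine (measure_iUnion_le _).trans (ENNReal.tsum_le_tsum fun r => ?_)
        refine (measure_iUnion_le _).trans ?_
        rw [tsum_fintype]
        exact Finset.sum_le_sum fun i _ => hterm r i
    _ = ∑' r : ℕ, ENNReal.ofReal (6 / 5 * δ) * ENNReal.ofReal (1 / ((r : ℝ) + 1) ^ 2) := by
        refine tsum_congr fun r => ?_
        have hb1' : (1 : ℝ) ≤ b r := by exact_mod_cast hb1 r
        rw [Finset.sum_const, Finset.card_univ, Fintype.card_fin, nsmul_eq_mul,
          ← ENNReal.ofReal_natCast, ← ENNReal.ofReal_mul hn'.le, ← ENNReal.ofReal_mul (by positivity)]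
        congr 1
        rw [hβ]
        push_cast
        field_simp
    _ ≤ ENNReal.ofReal (2 * δ) := by
        rw [ENNReal.tsum_mul_left, tsum_inv_sq_succ, ← ENNReal.ofReal_mul (by positivity)]
        refine ENNReal.ofReal_le_ofReal ?_
        have := pi_sq_div_six_le
        nlinarith

/-! ### From pulls in a bracket to rounds -/

lemma tlog_mul_mul_le {a b c : ℝ} (ha : 0 < a) (hb : 0 < b) (hc : 0 < c) :
    tlog (a * b * c) ≤ 3 * (tlog a * tlog b * tlog c) := by
  have h1 := (tlog_mul_le (mul_pos ha hb) hc).trans (add_le_add (tlog_mul_le ha hb) le_rfl)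
  have ea := one_le_tlog a
  have eb := one_le_tlog b
  have ec := one_le_tlog c
  have h2 : 1 ≤ tlog a * tlog b := one_le_mul_of_one_le_of_one_le ea eb
  have h3 : 1 ≤ tlog b * tlog c := one_le_mul_of_one_le_of_one_le eb ec
  have h4 : 1 ≤ tlog a * tlog c := one_le_mul_of_one_le_of_one_le ea ec
  have h5 : tlog a ≤ tlog a * (tlog b * tlog c) := le_mul_of_one_le_right (by linarith) h3
  have h6 : tlog b ≤ tlog b * (tlog a * tlog c) := le_mul_of_one_le_right (by linarith) h4
  have h7 : tlog c ≤ tlog c * (tlog a * tlog b) := le_mul_of_one_le_right (by linarith) h2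
  nlinarith

lemma exists_plays_gt {r : ℕ} (hr : 1 ≤ r) {x : ℝ} (hx : 0 ≤ x) :
    ∃ t : ℕ, x < plays r t ∧
      (t : ℝ) ≤ 2 * ((2 * 2 ^ r + 4 * (x + 1)) * tlog (2 * 2 ^ r + 4 * (x + 1))) := by
  set N := ⌊x⌋₊ + 1 with hN
  -- The round is `2 ^ z * z`, with the least `z > r` for which `2 ^ (z - 1)` windows provide `N`
  -- plays. Minimality gives `2 ^ z ≤ Y`, and so `z ≤ 2 tlog Y`.
  set z := max (r + 1) (Nat.clog 2 (2 * N)) with hz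
  have hNx : (N : ℝ) ≤ x + 1 := by
    rw [hN]; push_cast; linarith [Nat.floor_le hx]
  have h2N : 2 * N ≤ 2 ^ z :=
    (Nat.le_pow_clog one_lt_two _).trans (Nat.pow_le_pow_right two_pos (le_max_right _ _))
  refine ⟨2 ^ z * z, ?_, ?_⟩
  · refine (Nat.lt_floor_add_one x).trans_le ?_
    have := le_plays hr (le_max_left _ _) h2N
    exact_mod_cast this
  · set Y : ℝ := 2 * 2 ^ r + 4 * (x + 1) with hY
    have h2r : (0 : ℝ) < 2 ^ r := by positivity
    have hzY : (2 : ℝ) ^ z ≤ Y := by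
      rcases max_choice (r + 1) (Nat.clog 2 (2 * N)) with h | h
      · rw [hz, h, pow_succ]; linarith
      · rw [hz, h]
        have h1 : 2 ^ (Nat.clog 2 (2 * N) - 1) < 2 * N :=
          Nat.pow_pred_clog_lt_self one_lt_two (show 1 < 2 * N by omega)
        have h3 : 1 ≤ Nat.clog 2 (2 * N) := Nat.clog_pos one_lt_two (by omega)
        have h4 : 2 ^ Nat.clog 2 (2 * N) = 2 * 2 ^ (Nat.clog 2 (2 * N) - 1) := by
          rw [← pow_succ', Nat.sub_add_cancel h3]
        have h5 : 2 ^ Nat.clog 2 (2 * N) ≤ 4 * N := by omega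
        have h6 : (2 : ℝ) ^ Nat.clog 2 (2 * N) ≤ 4 * N := by exact_mod_cast h5
        linarith
    have hzlog : (z : ℝ) ≤ 2 * tlog Y := by
      have h1 : Real.log ((2 : ℝ) ^ z) ≤ Real.log Y := Real.log_le_log (by positivity) hzY
      rw [Real.log_pow] at h1
      have h2 := log_le_tlog Y
      have hz0 : (0 : ℝ) ≤ z := Nat.cast_nonneg z
      nlinarith [Real.log_two_gt_d9]
    push_cast
    calc (2 : ℝ) ^ z * z ≤ Y * (2 * tlog Y) := by gcongr
      _ = _ := by ring

/-- The inflation `y` enters once as a factor and once through `tlog y ≤ y` inside the logarithm.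
This is why second moments of the levels are needed. -/
lemma exists_time_bound {D : ℝ} (hD : 1 ≤ D) : ∃ C : ℝ, 0 < C ∧
    ∀ (r : ℕ) (x y H : ℝ), 1 ≤ r → 0 ≤ x → 1 ≤ y → 1 ≤ H → (2 : ℝ) ^ r ≤ D * y * H →
      x ≤ D * y * H → ∃ t : ℕ, x < plays r t ∧ (t : ℝ) ≤ C * (y ^ 2 * (H * tlog H)) := by
  have hT := tlog_pos (10 * D)
  refine ⟨2 * (10 * D) * 3 * tlog (10 * D), by positivity, ?_⟩
  intro r x y H hr hx hy hH h2r hxle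
  obtain ⟨t, ht, htle⟩ := exists_plays_gt hr hx
  refine ⟨t, ht, htle.trans ?_⟩
  have h1 : 1 ≤ D * y * H :=
    one_le_mul_of_one_le_of_one_le (one_le_mul_of_one_le_of_one_le hD hy) hH
  have hpos : (0 : ℝ) < 2 * 2 ^ r + 4 * (x + 1) := by positivity
  have hY : 2 * 2 ^ r + 4 * (x + 1) ≤ 10 * D * y * H := by linarith
  have h3 : tlog (2 * 2 ^ r + 4 * (x + 1)) ≤ 3 * (tlog (10 * D) * y * tlog H) :=
    (tlog_mono hpos hY).trans ((tlog_mul_mul_le (by positivity) (by positivity)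
      (by positivity)).trans (by
        have := tlog_le_self hy
        have := (tlog_pos H).le
        gcongr))
  have := tlog_pos H
  calc 2 * ((2 * 2 ^ r + 4 * (x + 1)) * tlog (2 * 2 ^ r + 4 * (x + 1)))
      ≤ 2 * ((10 * D * y * H) * (3 * (tlog (10 * D) * y * tlog H))) := by
        have := (tlog_pos (2 * 2 ^ r + 4 * (x + 1))).le
        gcongr
    _ = _ := by ring

/-! ### First times and the play filtration -/

/-- The least element of a set of times, `⊤` if the set is empty. -/
def firstTime (S : Set ℕ) : ℕ∞ := ⨅ t ∈ S, (t : ℕ∞)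

lemma firstTime_le_of_mem {S : Set ℕ} {t : ℕ} (h : t ∈ S) : firstTime S ≤ t :=
  iInf₂_le t h

lemma firstTime_le_iff {S : Set ℕ} {t : ℕ} : firstTime S ≤ t ↔ ∃ s ∈ S, s ≤ t := by
  refine ⟨fun h => ?_, fun ⟨s, hs, hst⟩ => (firstTime_le_of_mem hs).trans (by exact_mod_cast hst)⟩
  by_contra hcon
  push Not at hcon
  have h1 : ((t + 1 : ℕ) : ℕ∞) ≤ firstTime S :=
    le_iInf₂ fun s hs => by exact_mod_cast hcon s hs
  have h2 := h1.trans h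
  have : t + 1 ≤ t := by exact_mod_cast h2
  omega

lemma isStoppingTime_firstTime {Ω : Type*} [mΩ : MeasurableSpace Ω] (ℱ : Filtration ℕ mΩ)
    {cond : ℕ → Ω → Prop} (h : ∀ t, MeasurableSet[ℱ t] {ω | cond t ω}) :
    IsStoppingTime ℱ fun ω => firstTime {t | cond t ω} := by
  intro t
  have e : {ω | firstTime {t | cond t ω} ≤ (t : ℕ∞)} = ⋃ s ∈ Finset.range (t + 1), {ω | cond s ω} := by
    ext ω
    simp only [Set.mem_ofPred_eq, firstTime_le_iff, Set.mem_iUnion, Finset.mem_range, exists_prop,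
      Nat.lt_succ_iff]
    exact ⟨fun ⟨s, h1, h2⟩ => ⟨s, h2, h1⟩, fun ⟨s, h1, h2⟩ => ⟨s, h2, h1⟩⟩
  have key : MeasurableSet[ℱ t] (⋃ s ∈ Finset.range (t + 1), {ω | cond s ω}) :=
    Finset.measurableSet_biUnion _ fun s hs =>
      ℱ.mono (Nat.lt_succ_iff.1 (Finset.mem_range.1 hs)) _ (h s)
  rw [← e] at key
  exact key

section Play

variable {n : ℕ} {Ω : Type*} [mΩ : MeasurableSpace Ω] {X : Ω → Fin n → ℕ → ℕ → ℝ}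
  {I : Ω → ℕ → Fin n} {out : Ω → ℕ → Finset (Fin n)}
  {hX : ∀ t, Measurable fun ω => reward (X ω) (I ω) t} {hI : Measurable I}
  {hout : ∀ t, Measurable fun ω => out ω t}

lemma measurable_play {s t : ℕ} (hs : 1 ≤ s) (hst : s ≤ t) :
    Measurable[playFiltration X I out hX hI hout t]
      fun ω => (I ω s, reward (X ω) (I ω) s, out ω s) := by
  refine measurable_iff_comap_le.2 ?_
  exact le_iSup₂_of_le (f := fun s (_ : s ∈ Finset.Icc 1 t) => MeasurableSpace.comap
    (fun ω => (I ω s, reward (X ω) (I ω) s, out ω s)) inferInstance) s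
    (Finset.mem_Icc.2 ⟨hs, hst⟩) le_rfl

lemma measurable_play_out {s t : ℕ} (hs : 1 ≤ s) (hst : s ≤ t) :
    Measurable[playFiltration X I out hX hI hout t] fun ω => out ω s :=
  (measurable_snd.comp measurable_snd).comp (measurable_play hs hst)

lemma measurable_play_reward {s t : ℕ} (hs : 1 ≤ s) (hst : s ≤ t) :
    Measurable[playFiltration X I out hX hI hout t] fun ω => reward (X ω) (I ω) s :=
  (measurable_fst.comp measurable_snd).comp (measurable_play hs hst)

lemma measurable_play_arm {s t : ℕ} (hs : 1 ≤ s) (hst : s ≤ t) :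
    Measurable[playFiltration X I out hX hI hout t] fun ω => I ω s :=
  measurable_fst.comp (measurable_play hs hst)

lemma pulls_succ {I : ℕ → Fin n} (i : Fin n) (r : ℕ) {t : ℕ} (ht : 1 ≤ t) :
    pulls I i r (t + 1) = pulls I i r t + if bracket t = r ∧ I t = i then 1 else 0 := by
  unfold pulls
  rw [← Finset.insert_Ico_right_eq_Ico_add_one ht, Finset.filter_insert]
  split_ifs with h
  · rw [Finset.card_insert_of_notMem (by simp)]
  · rfl

/-- The index may be `t + 1` because the counts at round `s` involve only rounds before `s`. -/
lemma measurable_play_pulls (i : Fin n) (r : ℕ) {t : ℕ} :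
    ∀ {s : ℕ}, s ≤ t + 1 →
      Measurable[playFiltration X I out hX hI hout t] fun ω => pulls (I ω) i r s
  | 0, _ => by simp [pulls]
  | 1, _ => by simp [pulls]
  | s + 2, hs => by
    have ih := measurable_play_pulls i r (t := t) (s := s + 1) (by omega)
    simp_rw [fun ω => pulls_succ (I := I ω) i r (t := s + 1) (by omega)]
    refine Measurable.add ih (Measurable.ite ?_ measurable_const measurable_const)
    exact (MeasurableSet.const _).inter ((measurable_play_arm (by omega) (by omega))
      (measurableSet_singleton i))

/-- The sum of the samples of arm `i` in bracket `r` that are observed before round `s`. -/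
lemma measurable_play_sum (i : Fin n) (r : ℕ) {t : ℕ} :
    ∀ {s : ℕ}, s ≤ t + 1 → Measurable[playFiltration X I out hX hI hout t]
      fun ω => ∑ v ∈ Finset.range (pulls (I ω) i r s), X ω i r v
  | 0, _ => by simp [pulls]
  | 1, _ => by simp [pulls]
  | s + 2, hs => by
    have ih := measurable_play_sum i r (t := t) (s := s + 1) (by omega)
    have e : (fun ω => ∑ v ∈ Finset.range (pulls (I ω) i r (s + 2)), X ω i r v)
        = fun ω => (∑ v ∈ Finset.range (pulls (I ω) i r (s + 1)), X ω i r v)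
          + if bracket (s + 1) = r ∧ I ω (s + 1) = i then reward (X ω) (I ω) (s + 1) else 0 := by
      funext ω
      rw [pulls_succ (I := I ω) i r (t := s + 1) (by omega)]
      split_ifs with h
      · rw [Finset.sum_range_succ]
        unfold reward
        rw [h.1, h.2]
      · simp
    rw [e]
    refine Measurable.add ih (Measurable.ite ?_ (measurable_play_reward (by omega) (by omega))
      measurable_const)
    exact (MeasurableSet.const _).inter ((measurable_play_arm (by omega) (by omega))
      (measurableSet_singleton i))

lemma measurable_play_ucb (c δ : ℝ) (i : Fin n) {s t : ℕ} (hs : s ≤ t + 1) :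
    Measurable[playFiltration X I out hX hI hout t] fun ω => ucb c δ (X ω) (I ω) s i := by
  have h1 := measurable_play_pulls (X := X) (out := out) (hX := hX) (hI := hI) (hout := hout)
    i (bracket s) hs
  have h2 := measurable_play_sum (X := X) (out := out) (hX := hX) (hI := hI) (hout := hout)
    i (bracket s) hs
  unfold ucb empMean
  refine Measurable.add (h2.div ((measurable_of_countable (fun u : ℕ => (u : ℝ))).comp h1)) ?_
  exact (measurable_of_countable (fun u : ℕ => confWidth c u δ)).comp h1

end Play

/-! ### Detection: the common setting -/

/-- The common setting of the detection guarantees of FWER-TPR and FDR-TPR. -/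
structure Setting {n : ℕ} {Ω : Type*} [MeasurableSpace Ω] (P : Measure Ω) (ν : Fin n → Measure ℝ)
    (A : Ω → ℕ → Finset (Fin n)) (X : Ω → Fin n → ℕ → ℕ → ℝ) (I : Ω → ℕ → Fin n)
    (lev : Ω → ℕ → ℝ) (out : Ω → ℕ → Finset (Fin n)) (c : ℝ) (μ : Fin n → ℝ) (μ₀ δ : ℝ) (k : ℕ) :
    Prop where
  anytime : IsAnytimeBound c
  subGaussian : ∀ i, IsOneSubGaussian (ν i)
  mean_eq : ∀ i, μ i = ∫ y, y ∂(ν i)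
  antitone : Antitone μ
  mean_mem : ∀ i, μ i ∈ Set.Icc (0 : ℝ) 1
  threshold_mem : μ₀ ∈ Set.Icc (0 : ℝ) 1
  pos : 0 < δ
  le : δ ≤ 1 / 40
  one_le : 1 ≤ k
  model : IsModel P ν A X
  run : ∀ᵐ ω ∂P, IsRun c μ₀ δ (lev ω) (A ω) (X ω) (I ω) (out ω)
  level : ∀ᵐ ω ∂P, ∀ r, 1 ≤ r → LevelBound δ r (lev ω r)

lemma lt_mean_of_le_card {n : ℕ} {μ : Fin n → ℝ} (hμ : Antitone μ) {μ₀ : ℝ} {j : Fin n}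
    (hj : (j : ℕ) + 1 ≤ (armsAbove μ μ₀).card) : μ₀ < μ j := by
  by_contra hle
  have hsub : armsAbove μ μ₀ ⊆ Finset.Iio j := by
    intro i hi
    have hi' : μ₀ < μ i := by simpa [armsAbove] using hi
    rw [Finset.mem_Iio]
    by_contra hge
    exact absurd (hμ (not_lt.1 hge)) (by linarith [not_lt.1 hle])
  have := Finset.card_le_card hsub
  rw [Fin.card_Iio] at this
  omega

lemma Iic_subset_armsAbove {n : ℕ} {μ : Fin n → ℝ} (hμ : Antitone μ) {μ₀ : ℝ} {j : Fin n}
    (hj : μ₀ < μ j) : Finset.Iic j ⊆ armsAbove μ μ₀ := by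
  intro i hi
  simpa [armsAbove] using hj.trans_le (hμ (Finset.mem_Iic.1 hi))

/-- The weights of the arms of `a`, inflated by the levels at which their confidence bounds hold. -/
def levelSum {n : ℕ} (c : ℝ) (ν : Fin n → Measure ℝ) (w : Fin n → ℝ) (a : Finset (Fin n))
    (y : Fin n → ℕ → ℝ) : ℝ :=
  ∑ i ∈ a, (1 + (confLevel c (ν i) (y i) : ℝ)) * w i

lemma measurable_levelSum {n : ℕ} {c : ℝ} {ν : Fin n → Measure ℝ} {w : Fin n → ℝ}
    {a : Finset (Fin n)} : Measurable (levelSum c ν w a) := by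
  unfold levelSum
  refine Finset.measurable_sum _ fun i _ => Measurable.mul_const (measurable_const.add ?_) _
  exact (measurable_of_countable (fun q : ℕ => (q : ℝ))).comp
    (measurable_confLevel.comp (measurable_pi_apply i))

section Setting

variable {n : ℕ} {Ω : Type*} [MeasurableSpace Ω] {P : Measure Ω} {ν : Fin n → Measure ℝ}
  {A : Ω → ℕ → Finset (Fin n)} {X : Ω → Fin n → ℕ → ℕ → ℝ} {I : Ω → ℕ → Fin n} {lev : Ω → ℕ → ℝ}
  {out : Ω → ℕ → Finset (Fin n)} {c : ℝ} {μ : Fin n → ℝ} {μ₀ δ : ℝ} {k : ℕ}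

lemma IsModel.ae_samples (hM : IsModel P ν A X) {p : Fin n → (ℕ → ℝ) → Prop}
    (h : ∀ i, ∀ᵐ y ∂(Measure.infinitePi fun _ : ℕ => ν i), p i y) :
    ∀ᵐ ω ∂P, ∀ i r, p i (X ω i r) := by
  have hX := hM.measurable_samples
  refine ae_all_iff.2 fun i => ae_all_iff.2 fun r => ?_
  have h1 := h i
  rw [← hM.map_samples i r] at h1
  exact ae_of_ae_map (by fun_prop) h1

lemma measure_bracketSamples_preimage (hM : IsModel P ν A X) (r : ℕ) (i : Fin n)
    {f : (ℕ → ℝ) → ℝ≥0∞} (hf : Measurable f) :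
    ∫⁻ ω, f (X ω i r) ∂P = ∫⁻ y, f y ∂(Measure.infinitePi fun _ : ℕ => ν i) := by
  have hX := hM.measurable_samples
  rw [← hM.map_samples i r, lintegral_map hf (by fun_prop)]

variable [∀ i, IsProbabilityMeasure (ν i)]

/-- Once a bracket has been played often enough, all its arms have been output or have an upper
confidence bound below the mean of arm `j`. -/
lemma exists_done_bound {c : ℝ} (hc : 0 < c) : ∃ C : ℝ, 1 ≤ C ∧
    ∀ {n : ℕ} {Ω : Type*} [MeasurableSpace Ω] {P : Measure Ω} [IsProbabilityMeasure P]
      {ν : Fin n → Measure ℝ} [∀ i, IsProbabilityMeasure (ν i)]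
      {A : Ω → ℕ → Finset (Fin n)} {X : Ω → Fin n → ℕ → ℕ → ℝ} {I : Ω → ℕ → Fin n}
      {lev : Ω → ℕ → ℝ} {out : Ω → ℕ → Finset (Fin n)} {μ : Fin n → ℝ} {μ₀ δ : ℝ} {k : ℕ},
      Setting P ν A X I lev out c μ μ₀ δ k → ∀ j : Fin n, μ₀ < μ j →
      ∀ᵐ ω ∂P, ∀ r s t : ℕ, 1 ≤ r → (2 : ℝ) ^ r ≤ 64 * 2 ^ s * (n * k / ((j : ℝ) + 1)) →
        C * (s + 1) * levelSum c ν (armWeight μ μ₀ δ k j) (A ω r)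
          (IsModel.bracketSamples X r ω) < plays r t →
        ∃ s', 1 ≤ s' ∧ s' < t ∧ bracket s' = r ∧ ∀ g ∈ A ω r, g ∈ out ω s' ∨
          (0 < pulls (I ω) g r s' ∧ ucb c δ (X ω) (I ω) s' g < μ j) := by
  obtain ⟨C, hC1, hC⟩ := exists_pull_bound hc
  refine ⟨C, hC1, ?_⟩
  intro n Ω _ P _ ν _ A X I lev out μ μ₀ δ k hS j hj
  have hlev := hS.model.ae_samples (p := fun i y => 1 ≤ confLevel c (ν i) y ∧
    y ∈ confSet c (ν i) (Real.exp (-(confLevel c (ν i) y))))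
    fun i => ae_confLevel hS.anytime (hS.subGaussian i)
  filter_upwards [hS.run, hS.level, hlev] with ω hrun hlevel hconf
  intro r s t hr h2r ht
  have hs : (0 : ℝ) ≤ s := Nat.cast_nonneg s
  unfold levelSum at ht
  rw [Finset.mul_sum] at ht
  refine hrun.exists_done (θ := μ j) ?_ ?_ ht
  · intro i _
    have hw := one_le_armWeight (δ := δ) (k := k) hS.mean_mem hS.threshold_mem hj i
    have hq : (0 : ℝ) ≤ confLevel c (ν i) (IsModel.bracketSamples X r ω i) := Nat.cast_nonneg _
    exact one_le_mul_of_one_le_of_one_le (one_le_mul_of_one_le_of_one_le hC1 (by linarith))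
      (one_le_mul_of_one_le_of_one_le (by linarith) hw)
  · intro i _ u hu hU hLow
    refine hC n μ μ₀ δ k j i r s (confLevel c (ν i) (X ω i r)) (lev ω r) (empMean (X ω) i r)
      hS.mean_mem hS.threshold_mem hS.pos (by linarith [hS.le]) hS.one_le hj (hlevel r hr) h2r
      ?_ u hu hU hLow
    intro v hv
    rw [hS.mean_eq i]
    exact (hconf i r).2 v hv

lemma lintegral_sum_confLevel_sq_le (hM : IsModel P ν A X) (hc : IsAnytimeBound c)
    (hν : ∀ i, IsOneSubGaussian (ν i)) {w : Fin n → ℝ} (hw : ∀ i, 0 ≤ w i) (a : Finset (Fin n))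
    (r : ℕ) :
    ∫⁻ ω, ENNReal.ofReal (∑ i ∈ a, (1 + (confLevel c (ν i) (X ω i r) : ℝ)) ^ 2 * w i) ∂P
      ≤ ENNReal.ofReal (momentConst * ∑ i ∈ a, w i) := by
  have hmeas : ∀ i, Measurable fun y : ℕ → ℝ =>
      ENNReal.ofReal ((1 + (confLevel c (ν i) y : ℝ)) ^ 2) := fun i =>
    (measurable_of_countable (fun q : ℕ => ENNReal.ofReal ((1 + (q : ℝ)) ^ 2))).comp
      measurable_confLevel
  have hX := hM.measurable_samples
  have hm2 : ∀ i, Measurable fun ω =>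
      ENNReal.ofReal ((1 + (confLevel c (ν i) (X ω i r) : ℝ)) ^ 2) := fun i =>
    (hmeas i).comp (by fun_prop)
  have e : ∀ ω, ENNReal.ofReal (∑ i ∈ a, (1 + (confLevel c (ν i) (X ω i r) : ℝ)) ^ 2 * w i)
      = ∑ i ∈ a, ENNReal.ofReal ((1 + (confLevel c (ν i) (X ω i r) : ℝ)) ^ 2)
          * ENNReal.ofReal (w i) := fun ω => by
    rw [ENNReal.ofReal_sum_of_nonneg fun i _ => mul_nonneg (by positivity) (hw i)]
    exact Finset.sum_congr rfl fun i _ => ENNReal.ofReal_mul (by positivity)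
  simp_rw [e]
  rw [lintegral_finsetSum _ fun i _ => (hm2 i).mul_const _]
  calc _ ≤ ∑ i ∈ a, ENNReal.ofReal momentConst * ENNReal.ofReal (w i) := by
        refine Finset.sum_le_sum fun i _ => ?_
        rw [lintegral_mul_const _ (hm2 i)]
        gcongr
        rw [measure_bracketSamples_preimage hM r i (hmeas i)]
        exact lintegral_confLevel_sq_le hc (hν i)
    _ = ENNReal.ofReal (momentConst * ∑ i ∈ a, w i) := by
        rw [← Finset.mul_sum, ← ENNReal.ofReal_sum_of_nonneg fun i _ => hw i,
          ← ENNReal.ofReal_mul momentConst_nonneg]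

lemma lintegral_levelSum_le (hM : IsModel P ν A X) (hc : IsAnytimeBound c)
    (hν : ∀ i, IsOneSubGaussian (ν i)) {w : Fin n → ℝ} (hw : ∀ i, 0 ≤ w i) (a : Finset (Fin n))
    (r : ℕ) :
    ∫⁻ ω, ENNReal.ofReal (levelSum c ν w a (IsModel.bracketSamples X r ω)) ∂P
      ≤ ENNReal.ofReal (momentConst * ∑ i ∈ a, w i) := by
  refine le_trans (lintegral_mono fun ω => ENNReal.ofReal_le_ofReal ?_)
    (lintegral_sum_confLevel_sq_le hM hc hν hw a r)
  refine Finset.sum_le_sum fun i _ => mul_le_mul_of_nonneg_right ?_ (hw i)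
  have : (0 : ℝ) ≤ confLevel c (ν i) (X ω i r) := Nat.cast_nonneg _
  change 1 + (confLevel c (ν i) (X ω i r) : ℝ) ≤ _
  nlinarith

/-- Cauchy-Schwarz with weights `w` reduces the square to second moments of single levels, so no
independence between arms is used. -/
lemma lintegral_levelSum_sq_le (hM : IsModel P ν A X) (hc : IsAnytimeBound c)
    (hν : ∀ i, IsOneSubGaussian (ν i)) {w : Fin n → ℝ} (hw : ∀ i, 0 ≤ w i) (a : Finset (Fin n))
    (r : ℕ) :
    ∫⁻ ω, ENNReal.ofReal (levelSum c ν w a (IsModel.bracketSamples X r ω) ^ 2) ∂P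
      ≤ ENNReal.ofReal (momentConst * (∑ i ∈ a, w i) ^ 2) := by
  have hW : 0 ≤ ∑ i ∈ a, w i := Finset.sum_nonneg fun i _ => hw i
  calc ∫⁻ ω, ENNReal.ofReal (levelSum c ν w a (IsModel.bracketSamples X r ω) ^ 2) ∂P
      ≤ ∫⁻ ω, ENNReal.ofReal (∑ i ∈ a, w i)
          * ENNReal.ofReal (∑ i ∈ a, (1 + (confLevel c (ν i) (X ω i r) : ℝ)) ^ 2 * w i) ∂P := by
        refine lintegral_mono fun ω => ?_
        rw [← ENNReal.ofReal_mul hW]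
        refine ENNReal.ofReal_le_ofReal ?_
        exact Finset.sum_sq_le_sum_mul_sum_of_sq_le_mul a (fun i _ => hw i)
          (fun i _ => mul_nonneg (sq_nonneg _) (hw i)) fun i _ => by
            change ((1 + (confLevel c (ν i) (X ω i r) : ℝ)) * w i) ^ 2 ≤ _
            exact le_of_eq (by ring)
    _ = ENNReal.ofReal (∑ i ∈ a, w i) * ∫⁻ ω, ENNReal.ofReal
          (∑ i ∈ a, (1 + (confLevel c (ν i) (X ω i r) : ℝ)) ^ 2 * w i) ∂P :=
        lintegral_const_mul' _ _ ENNReal.ofReal_ne_top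
    _ ≤ ENNReal.ofReal (∑ i ∈ a, w i) * ENNReal.ofReal (momentConst * ∑ i ∈ a, w i) := by
        gcongr
        exact lintegral_sum_confLevel_sq_le hM hc hν hw a r
    _ = _ := by
        rw [← ENNReal.ofReal_mul hW]
        congr 1
        ring

end Setting

lemma one_le_momentConst : 1 ≤ momentConst := by
  have h := summable_momentConst.le_tsum 0 fun q _ => by positivity
  unfold momentConst
  exact le_trans (by simp) h

/-! ### Brackets that fail -/

open Classical in
/-- The samples for which a bracket `a` does not detect `k` arms of `J` quickly: there are less than
`2 k` arms of `J`, or more than half of them violate their confidence bounds at level `δ`, or the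
level sum exceeds `V`. -/
def failSet {n : ℕ} (c : ℝ) (ν : Fin n → Measure ℝ) (δ : ℝ) (k : ℕ) (J : Finset (Fin n))
    (w : Fin n → ℝ) (V : ℝ) (a : Finset (Fin n)) : Set (Fin n → ℕ → ℝ) :=
  {_y | ((a ∩ J).card : ℝ) < 2 * k} ∪
    ({y | (a ∩ J).card < 2 * {i ∈ a ∩ J | y i ∉ confSet c (ν i) δ}.card} ∪
      {y | V < levelSum c ν w a y})

section Fail

variable {n : ℕ} {Ω : Type*} [MeasurableSpace Ω] {P : Measure Ω} {ν : Fin n → Measure ℝ}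
  {A : Ω → ℕ → Finset (Fin n)} {X : Ω → Fin n → ℕ → ℕ → ℝ} {c : ℝ} {δ : ℝ} {k : ℕ}

open Classical in
lemma measurable_card_bad (J : Finset (Fin n)) : Measurable fun y : Fin n → ℕ → ℝ =>
    {i ∈ J | y i ∉ confSet c (ν i) δ}.card := by
  simp_rw [Finset.card_filter]
  refine Finset.measurable_sum _ fun i _ => Measurable.ite ?_ measurable_const measurable_const
  have hi : Measurable fun y : Fin n → ℕ → ℝ => y i := measurable_pi_apply i
  exact hi (measurableSet_confSet δ).compl

lemma measurableSet_failSet (J : Finset (Fin n)) (w : Fin n → ℝ) (V : ℝ) (a : Finset (Fin n)) :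
    MeasurableSet (failSet c ν δ k J w V a) := by
  refine (MeasurableSet.const _).union (MeasurableSet.union ?_ ?_)
  · exact measurableSet_lt measurable_const ((measurable_card_bad _).const_mul 2)
  · exact measurableSet_lt measurable_const measurable_levelSum

variable [∀ i, IsProbabilityMeasure (ν i)]

open Classical in
lemma lintegral_card_bad_le (hM : IsModel P ν A X) (hc : IsAnytimeBound c)
    (hν : ∀ i, IsOneSubGaussian (ν i)) (hδ : 0 < δ) (hδ1 : δ < 1) (J : Finset (Fin n)) (r : ℕ) :
    ∫⁻ ω, ({i ∈ J | X ω i r ∉ confSet c (ν i) δ}.card : ℝ≥0∞) ∂P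
      ≤ J.card * ENNReal.ofReal δ := by
  have hX := hM.measurable_samples
  have hmeas : ∀ i, MeasurableSet {ω | X ω i r ∉ confSet c (ν i) δ} := fun i => by
    have : Measurable fun ω => X ω i r := by fun_prop
    exact this (measurableSet_confSet δ).compl
  simp_rw [Finset.card_filter]
  push_cast
  rw [lintegral_finsetSum _ fun i _ => Measurable.ite (hmeas i) measurable_const measurable_const,
    ← nsmul_eq_mul, ← Finset.sum_const]
  refine Finset.sum_le_sum fun i _ => ?_
  have e : (fun ω => if X ω i r ∉ confSet c (ν i) δ then (1 : ℝ≥0∞) else 0)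
      = {ω | X ω i r ∉ confSet c (ν i) δ}.indicator 1 := by
    ext ω
    simp [Set.indicator_apply]
  rw [e, lintegral_indicator_one (hmeas i)]
  have h1 := hM.measure_samples i r (measurableSet_confSet (c := c) (ν := ν i) δ).compl
  exact (le_of_eq h1).trans (measure_compl_confSet_le hc (hν i) hδ hδ1)

/-- For a fixed bracket the first cause is deterministic. The other two are Markov bounds: twice the
number of violations has mean at most `2 δ ≤ 1 / 20` of the good arms, and the level sum has mean at
most `momentConst` times the weight. -/
lemma measure_failSet_le (hM : IsModel P ν A X) (hc : IsAnytimeBound c)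
    (hν : ∀ i, IsOneSubGaussian (ν i)) (hδ : 0 < δ) (hδ' : δ ≤ 1 / 40) (J : Finset (Fin n))
    {w : Fin n → ℝ} (hw : ∀ i, 0 ≤ w i) {V : ℝ} (hV : 0 < V) (r : ℕ) (a : Finset (Fin n)) :
    P {ω | IsModel.bracketSamples X r ω ∈ failSet c ν δ k J w V a}
      ≤ (if ((a ∩ J).card : ℝ) < 2 * k then 1 else 0) + ENNReal.ofReal (1 / 20)
        + ENNReal.ofReal (momentConst / V) * ENNReal.ofReal (∑ i ∈ a, w i) := by
  classical
  have hPu : P Set.univ ≤ 1 := by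
    rw [← hM.indep_samples.isProbabilityMeasure.measure_univ]
  have hY := hM.measurable_bracketSamples r
  have h1 : P {_ω : Ω | ((a ∩ J).card : ℝ) < 2 * k}
      ≤ if ((a ∩ J).card : ℝ) < 2 * k then 1 else 0 := by
    split_ifs with h
    · exact (measure_mono (Set.subset_univ _)).trans hPu
    · simp [h]
  have h2 : P {ω | (a ∩ J).card < 2 * {i ∈ a ∩ J | X ω i r ∉ confSet c (ν i) δ}.card}
      ≤ ENNReal.ofReal (1 / 20) := by
    rcases Nat.eq_zero_or_pos (a ∩ J).card with h0 | h0
    · rw [Finset.card_eq_zero] at h0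
      simp [h0]
    · have hg0 : ((a ∩ J).card : ℝ≥0∞) ≠ 0 := by exact_mod_cast h0.ne'
      have hm := mul_meas_ge_le_lintegral₀ (μ := P) (f := fun ω =>
        (2 : ℝ≥0∞) * ({i ∈ a ∩ J | X ω i r ∉ confSet c (ν i) δ}.card : ℝ≥0∞))
        (((measurable_of_countable (fun q : ℕ => (2 : ℝ≥0∞) * (q : ℝ≥0∞))).comp
          ((measurable_card_bad (a ∩ J)).comp hY)).aemeasurable) ((a ∩ J).card : ℝ≥0∞)
      have hi : ∫⁻ ω, (2 : ℝ≥0∞) * ({i ∈ a ∩ J | X ω i r ∉ confSet c (ν i) δ}.card : ℝ≥0∞) ∂P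
          ≤ (a ∩ J).card * ENNReal.ofReal (1 / 20) := by
        rw [lintegral_const_mul' _ _ (by simp)]
        calc _ ≤ 2 * ((a ∩ J).card * ENNReal.ofReal δ) := by
              gcongr
              exact lintegral_card_bad_le hM hc hν hδ (by linarith) (a ∩ J) r
          _ = (a ∩ J).card * ENNReal.ofReal (2 * δ) := by
              rw [ENNReal.ofReal_mul (by norm_num)]
              simp only [ENNReal.ofReal_ofNat]
              ring
          _ ≤ _ := by gcongr; linarith
      have hle := (ENNReal.mul_le_mul_iff_right hg0 (ENNReal.natCast_ne_top _)).1 (hm.trans hi)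
      refine (measure_mono fun ω hω => ?_).trans hle
      have hω' : (a ∩ J).card < 2 * {i ∈ a ∩ J | X ω i r ∉ confSet c (ν i) δ}.card := hω
      simp only [Set.mem_ofPred_eq]
      exact_mod_cast hω'.le
  have h3 : P {ω | V < levelSum c ν w a (IsModel.bracketSamples X r ω)}
      ≤ ENNReal.ofReal (momentConst / V) * ENNReal.ofReal (∑ i ∈ a, w i) := by
    have hV0 : ENNReal.ofReal V ≠ 0 := by simpa using hV
    have hm := mul_meas_ge_le_lintegral₀ (μ := P) (f := fun ω =>
      ENNReal.ofReal (levelSum c ν w a (IsModel.bracketSamples X r ω)))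
      ((measurable_levelSum.comp hY).ennreal_ofReal.aemeasurable) (ENNReal.ofReal V)
    have hi := lintegral_levelSum_le hM hc hν hw a r
    have e : ENNReal.ofReal (momentConst * ∑ i ∈ a, w i)
        = ENNReal.ofReal V * (ENNReal.ofReal (momentConst / V) * ENNReal.ofReal (∑ i ∈ a, w i)) := by
      have := momentConst_nonneg
      rw [← ENNReal.ofReal_mul (by positivity), ← ENNReal.ofReal_mul hV.le]
      congr 1
      field_simp
    rw [e] at hi
    have hle := (ENNReal.mul_le_mul_iff_right hV0 ENNReal.ofReal_ne_top).1 (hm.trans hi)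
    refine (measure_mono fun ω hω => ?_).trans hle
    exact ENNReal.ofReal_le_ofReal (le_of_lt hω)
  calc P {ω | IsModel.bracketSamples X r ω ∈ failSet c ν δ k J w V a}
      ≤ P ({_ω : Ω | ((a ∩ J).card : ℝ) < 2 * k} ∪
        ({ω | (a ∩ J).card < 2 * {i ∈ a ∩ J | X ω i r ∉ confSet c (ν i) δ}.card} ∪
        {ω | V < levelSum c ν w a (IsModel.bracketSamples X r ω)})) := by
        refine measure_mono fun ω hω => ?_
        rcases hω with h | h | h
        · exact Or.inl h
        · exact Or.inr (Or.inl h)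
        · exact Or.inr (Or.inr h)
    _ ≤ _ := by
        rw [add_assoc]
        exact (measure_union_le _ _).trans (add_le_add h1
          ((measure_union_le _ _).trans (add_le_add h2 h3)))

/-- A large enough bracket fails with probability at most `1 / 6`. -/
lemma measure_bracket_fail_le [IsProbabilityMeasure P] (hM : IsModel P ν A X) (hc : IsAnytimeBound c)
    (hν : ∀ i, IsOneSubGaussian (ν i)) (hδ : 0 < δ) (hδ' : δ ≤ 1 / 40) (hk : 1 ≤ k) (hn : 1 ≤ n)
    (J : Finset (Fin n)) {w : Fin n → ℝ} (hw : ∀ i, 0 ≤ w i) {V : ℝ} (hV : 0 < V) (r : ℕ)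
    (hJ : 32 * (k : ℝ) ≤ ((min n (2 ^ r) : ℕ) : ℝ) * J.card / n)
    (hVw : 32 * (momentConst * (((min n (2 ^ r) : ℕ) : ℝ) / n * ∑ i, w i)) ≤ V) :
    P {ω | IsModel.bracketSamples X r ω ∈ failSet c ν δ k J w V (A ω r)}
      ≤ ENNReal.ofReal (1 / 6) := by
  have hk' : (1 : ℝ) ≤ k := by exact_mod_cast hk
  have hsum1 : ∑ a, P {ω | A ω r = a} = 1 := by
    have h := hM.measure_bracket_mem r (F := fun _ => Set.univ) fun _ => MeasurableSet.univ
    simpa using h.symm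
  rw [hM.measure_bracket_mem r fun a => measurableSet_failSet J w V a]
  calc ∑ a, P {ω | A ω r = a} * P {ω | IsModel.bracketSamples X r ω ∈ failSet c ν δ k J w V a}
      ≤ ∑ a, P {ω | A ω r = a} * ((if ((a ∩ J).card : ℝ) < 2 * k then 1 else 0)
        + ENNReal.ofReal (1 / 20)
        + ENNReal.ofReal (momentConst / V) * ENNReal.ofReal (∑ i ∈ a, w i)) :=
        Finset.sum_le_sum fun a _ => by
          gcongr
          exact measure_failSet_le hM hc hν hδ hδ' J hw hV r a
    _ = ∑ a, P {ω | A ω r = a} * (if ((a ∩ J).card : ℝ) < 2 * k then 1 else 0)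
        + ENNReal.ofReal (1 / 20)
        + ENNReal.ofReal (momentConst / V) *
          ∑ a, P {ω | A ω r = a} * ENNReal.ofReal (∑ i ∈ a, w i) := by
        simp_rw [mul_add, Finset.sum_add_distrib, ← Finset.sum_mul]
        rw [hsum1, one_mul, Finset.mul_sum]
        congr 1
        exact Finset.sum_congr rfl fun a _ => by ring
    -- Chebyshev with `x = 2 k`, then violated bounds, then the level sum. The total must stay below
    -- `1 / 4` to beat the cost `4 ^ s` of later brackets.
    _ ≤ ENNReal.ofReal (1 / 16) + ENNReal.ofReal (1 / 20) + ENNReal.ofReal (1 / 32) := by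
        refine add_le_add (add_le_add ?_ le_rfl) ?_
        · exact hM.measure_bracket_card_lt hn r J (by positivity) (by linarith) (by linarith)
        · have := momentConst_nonneg
          rw [hM.sum_bracket_weight hn r hw, ← ENNReal.ofReal_mul (by positivity)]
          refine ENNReal.ofReal_le_ofReal ?_
          rw [div_mul_eq_mul_div, div_le_iff₀ hV]
          linarith
    _ ≤ ENNReal.ofReal (1 / 6) := by
        rw [← ENNReal.ofReal_add (by norm_num) (by norm_num),
          ← ENNReal.ofReal_add (by norm_num) (by norm_num)]
        exact ENNReal.ofReal_le_ofReal (by norm_num)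

end Fail

/-! ### Detection when many good arms are available -/

lemma integrable_card_out {n : ℕ} {Ω : Type*} [MeasurableSpace Ω] {P : Measure Ω}
    [IsFiniteMeasure P] {out : Ω → ℕ → Finset (Fin n)} (hout : ∀ t, Measurable fun ω => out ω t)
    {σ : Ω → ℕ} (hσ : Measurable σ) (S : Finset (Fin n)) :
    Integrable (fun ω => ((out ω (σ ω) ∩ S).card : ℝ)) P := by
  have h1 : Measurable fun ω => out ω (σ ω) :=
    measurable_comp_countable (fun t ω => out ω t) hout hσ
  have h2 : Measurable fun ω => ((out ω (σ ω) ∩ S).card : ℝ) :=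
    (measurable_of_countable (fun B : Finset (Fin n) => ((B ∩ S).card : ℝ))).comp h1
  refine Integrable.of_bound h2.aestronglyMeasurable (S.card : ℝ) (ae_of_all _ fun ω => ?_)
  rw [Real.norm_of_nonneg (Nat.cast_nonneg _)]
  exact_mod_cast Finset.card_le_card Finset.inter_subset_right

/-- Under the bound at level `δ` the upper confidence bound of `g` is at least `μ g ≥ μ j`. -/
lemma notMem_confSet_of_ucb_lt {n : ℕ} {Ω : Type*} {ν : Fin n → Measure ℝ}
    {X : Ω → Fin n → ℕ → ℕ → ℝ} {I : Ω → ℕ → Fin n} {c δ : ℝ} {μ : Fin n → ℝ} {g j : Fin n}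
    (hmean : μ g = ∫ y, y ∂(ν g)) (hle : μ j ≤ μ g) {ω : Ω} {s : ℕ}
    (h1 : 0 < pulls (I ω) g (bracket s) s) (h2 : ucb c δ (X ω) (I ω) s g < μ j) :
    X ω g (bracket s) ∉ confSet c (ν g) δ := by
  intro hg
  have h3 := (abs_le.1 (hg _ h1)).1
  rw [← hmean] at h3
  unfold ucb empMean at h2
  linarith

/-! ### The complexity dominates the bracket size. -/

section Rank

variable {n : ℕ} {μ : Fin n → ℝ} {μ₀ δ : ℝ} {k : ℕ} {j : Fin n}

lemma one_le_bracket_ratio (hk : 1 ≤ k) : 1 ≤ (n : ℝ) * k / ((j : ℝ) + 1) := by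
  have hk' : (1 : ℝ) ≤ k := by exact_mod_cast hk
  have hj : (j : ℝ) + 1 ≤ n := by exact_mod_cast j.2
  rw [one_le_div (by positivity)]
  nlinarith

/-- Every arm weight is at least `1`, so the cost of opening a bracket of size `n k / j` is already
part of the complexity. -/
lemma bracket_ratio_le_hFWER (hμ : ∀ i, μ i ∈ Set.Icc (0 : ℝ) 1) (hμ₀ : μ₀ ∈ Set.Icc (0 : ℝ) 1)
    (hj : μ₀ < μ j) : (n : ℝ) * k / ((j : ℝ) + 1) ≤ hFWER μ μ₀ δ k j := by
  rw [hFWER_eq]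
  have h : (n : ℝ) ≤ ∑ i, armWeight μ μ₀ δ k j i := by
    calc (n : ℝ) = ∑ _i : Fin n, (1 : ℝ) := by simp
      _ ≤ _ := Finset.sum_le_sum fun i _ => one_le_armWeight hμ hμ₀ hj i
  calc (n : ℝ) * k / ((j : ℝ) + 1) = k / ((j : ℝ) + 1) * n := by ring
    _ ≤ _ := by gcongr

/-- The argument delivers `H log H`; the additional nonnegative term inside the logarithm only
enlarges the claimed bound. -/
lemma hFWER_mul_tlog_le_sampleBound (hμ : ∀ i, μ i ∈ Set.Icc (0 : ℝ) 1)
    (hμ₀ : μ₀ ∈ Set.Icc (0 : ℝ) 1) (hk : 1 ≤ k) (hj : μ₀ < μ j) :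
    hFWER μ μ₀ δ k j * tlog (hFWER μ μ₀ δ k j) ≤ sampleBound μ μ₀ δ k j := by
  have h1 : 1 ≤ hFWER μ μ₀ δ k j :=
    (one_le_bracket_ratio (n := n) (j := j) hk).trans (bracket_ratio_le_hFWER hμ hμ₀ hj)
  unfold sampleBound
  refine mul_le_mul_of_nonneg_left (tlog_mono (by linarith) ?_) (by linarith)
  have h2 : 0 < μ j - μ₀ := by linarith
  have := tlog_pos ((n : ℝ) / ((j : ℝ) + 1) * k * tlog ((μ j - μ₀) ^ (-2 : ℤ)) / δ)
  have : 0 ≤ (μ j - μ₀) ^ (-2 : ℤ) *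
    tlog ((n : ℝ) / ((j : ℝ) + 1) * k * tlog ((μ j - μ₀) ^ (-2 : ℤ)) / δ) := by positivity
  linarith

end Rank

/-- The first round after which `k` arms above the threshold have been output. -/
def countTime {n : ℕ} {Ω : Type*} (out : Ω → ℕ → Finset (Fin n)) (μ : Fin n → ℝ) (μ₀ : ℝ) (k : ℕ)
    (ω : Ω) : ℕ∞ :=
  firstTime {t | 1 ≤ t ∧ k ≤ (out ω t ∩ armsAbove μ μ₀).card}

lemma isStoppingTime_countTime {n : ℕ} {Ω : Type*} [mΩ : MeasurableSpace Ω]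
    {X : Ω → Fin n → ℕ → ℕ → ℝ} {I : Ω → ℕ → Fin n} {out : Ω → ℕ → Finset (Fin n)}
    {hX : ∀ t, Measurable fun ω => reward (X ω) (I ω) t} {hI : Measurable I}
    {hout : ∀ t, Measurable fun ω => out ω t} (μ : Fin n → ℝ) (μ₀ : ℝ) (k : ℕ) :
    IsStoppingTime (playFiltration X I out hX hI hout) (countTime out μ μ₀ k) := by
  refine isStoppingTime_firstTime _ (cond := fun t ω => 1 ≤ t ∧
    k ≤ (out ω t ∩ armsAbove μ μ₀).card) fun t => ?_
  by_cases ht : 1 ≤ t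
  · simp only [ht, true_and]
    have h := measurable_play_out (X := X) (I := I) (out := out) (hX := hX) (hI := hI)
      (hout := hout) ht le_rfl
    exact h (Set.to_countable {B : Finset (Fin n) | k ≤ (B ∩ armsAbove μ μ₀).card}).measurableSet
  · simp [ht]

section Many

variable {n : ℕ} {Ω : Type*} [MeasurableSpace Ω] {P : Measure Ω}
  {ν : Fin n → Measure ℝ} {A : Ω → ℕ → Finset (Fin n)} {X : Ω → Fin n → ℕ → ℕ → ℝ}
  {I : Ω → ℕ → Fin n} {lev : Ω → ℕ → ℝ} {out : Ω → ℕ → Finset (Fin n)} {c : ℝ} {μ : Fin n → ℝ}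
  {μ₀ δ : ℝ} {k : ℕ}

/-- Outputs increase, so the count is at least `k` almost surely from this time on. -/
lemma Setting.le_integral_of_countTime_le [IsProbabilityMeasure P] (hS : Setting P ν A X I lev out c μ μ₀ δ k)
    (hout : ∀ t, Measurable fun ω => out ω t) {σ : Ω → ℕ} (hσ : Measurable σ)
    (h : ∀ᵐ ω ∂P, countTime out μ μ₀ k ω ≤ (σ ω : ℕ∞)) :
    (1 - δ) * k ≤ ∫ ω, ((out ω (σ ω) ∩ armsAbove μ μ₀).card : ℝ) ∂P := by
  have h1 : ∀ᵐ ω ∂P, (k : ℝ) ≤ ((out ω (σ ω) ∩ armsAbove μ μ₀).card : ℝ) := by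
    filter_upwards [h, hS.run] with ω hω hrun
    obtain ⟨s, ⟨-, hs⟩, hsσ⟩ := firstTime_le_iff.1 hω
    exact_mod_cast hs.trans (Finset.card_le_card
      (Finset.inter_subset_inter_right (hrun.mono hsσ)))
  have h2 := integral_mono_ae (integrable_const (k : ℝ))
    (integrable_card_out hout hσ (armsAbove μ μ₀)) h1
  simp only [integral_const, probReal_univ, one_smul] at h2
  have : 0 ≤ δ * k := mul_nonneg hS.pos.le (Nat.cast_nonneg k)
  linarith

open Classical in
lemma card_good_of_notMem_failSet {J : Finset (Fin n)} {w : Fin n → ℝ} {V : ℝ}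
    {a : Finset (Fin n)} {y : Fin n → ℕ → ℝ} (h : y ∉ failSet c ν δ k J w V a) :
    k ≤ {i ∈ a ∩ J | y i ∈ confSet c (ν i) δ}.card ∧ levelSum c ν w a y ≤ V := by
  simp only [failSet, Set.mem_union, Set.mem_ofPred_eq, not_or, not_lt] at h
  obtain ⟨h1, h2, h3⟩ := h
  refine ⟨?_, h3⟩
  have h1' : 2 * k ≤ (a ∩ J).card := by exact_mod_cast h1
  have h4 := Finset.card_filter_add_card_filter_not (s := a ∩ J)
    (fun i => y i ∈ confSet c (ν i) δ)
  omega

/-- The constant `∑ (2 / 3) ^ s (s + 1) ^ 2`. -/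
def geomConst : ℝ := ∑' s : ℕ, (2 / 3 : ℝ) ^ s * ((s : ℝ) + 1) ^ 2

lemma summable_geomConst : Summable fun s : ℕ => (2 / 3 : ℝ) ^ s * ((s : ℝ) + 1) ^ 2 := by
  have h : ∀ m : ℕ, Summable fun s : ℕ => (s : ℝ) ^ m * (2 / 3 : ℝ) ^ s := fun m =>
    summable_pow_mul_geometric_of_norm_lt_one m (by rw [Real.norm_of_nonneg] <;> norm_num)
  refine (((h 2).add ((h 1).mul_left 2)).add (h 0)).congr fun s => ?_
  ring

lemma geomConst_pos : 0 < geomConst :=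
  summable_geomConst.tsum_pos (fun s => by positivity) 0 (by norm_num)

/-- If brackets fail independently with probability at most `1 / 6` and a bracket that does not fail
bounds a random time, then the expectation of this time is bounded. -/
lemma lintegral_le_of_geometric {T : Ω → ℝ≥0∞} {bad : ℕ → Ω → Prop} {B : ℝ} (hB : 0 < B)
    (hmeas : ∀ s, MeasurableSet {ω | ∀ s' < s, bad s' ω})
    (hbad : ∀ s, P {ω | ∀ s' < s, bad s' ω} ≤ ENNReal.ofReal (1 / 6) ^ s)
    (hT : ∀ᵐ ω ∂P, ∀ s, ¬ bad s ω → T ω ≤ ENNReal.ofReal (B * (4 ^ s * ((s : ℝ) + 1) ^ 2))) :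
    ∫⁻ ω, T ω ∂P ≤ ENNReal.ofReal (geomConst * B) := by
  -- The time is charged to the first bracket that does not fail. If all fail, the series diverges
  -- because its terms are at least `B`, so no separate null-set argument is needed.
  have hpt : ∀ᵐ ω ∂P, T ω ≤ ∑' s, {ω | ∀ s' < s, bad s' ω}.indicator
      (fun _ => ENNReal.ofReal (B * (4 ^ s * ((s : ℝ) + 1) ^ 2))) ω := by
    filter_upwards [hT] with ω hω
    by_cases hex : ∃ s, ¬ bad s ω
    · classical
      have hs := Nat.find_spec hex
      have hmin : ∀ s' < Nat.find hex, bad s' ω := fun s' hs' => not_not.1 (Nat.find_min hex hs')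
      refine (hω _ hs).trans (le_trans (le_of_eq ?_) (ENNReal.le_tsum (Nat.find hex)))
      rw [Set.indicator_of_mem (show ω ∈ {ω | ∀ s' < Nat.find hex, bad s' ω} from hmin)]
    · push Not at hex
      have htop : ∑' s, {ω | ∀ s' < s, bad s' ω}.indicator
          (fun _ => ENNReal.ofReal (B * (4 ^ s * ((s : ℝ) + 1) ^ 2))) ω = ⊤ := by
        refine top_le_iff.1 ?_
        rw [← ENNReal.tsum_const_eq_top_of_ne_zero (α := ℕ) (c := ENNReal.ofReal B) (by simpa using hB)]
        refine ENNReal.tsum_le_tsum fun s => ?_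
        rw [Set.indicator_of_mem (show ω ∈ {ω | ∀ s' < s, bad s' ω} from fun s' _ => hex s')]
        refine ENNReal.ofReal_le_ofReal (le_mul_of_one_le_right hB.le ?_)
        have hs : (0 : ℝ) ≤ s := Nat.cast_nonneg s
        exact one_le_mul_of_one_le_of_one_le (one_le_pow₀ (by norm_num))
          (one_le_pow₀ (by linarith))
      rw [htop]
      exact le_top
  refine (lintegral_mono_ae hpt).trans ?_
  rw [lintegral_tsum fun s => (measurable_const.indicator (hmeas s)).aemeasurable, geomConst,
    ← tsum_mul_right, ENNReal.ofReal_tsum_of_nonneg (fun s => by positivity)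
      (summable_geomConst.mul_right B)]
  refine ENNReal.tsum_le_tsum fun s => ?_
  rw [lintegral_indicator_const (hmeas s)]
  calc ENNReal.ofReal (B * (4 ^ s * ((s : ℝ) + 1) ^ 2)) * P {ω | ∀ s' < s, bad s' ω}
      ≤ ENNReal.ofReal (B * (4 ^ s * ((s : ℝ) + 1) ^ 2)) * ENNReal.ofReal (1 / 6) ^ s := by
        gcongr
        exact hbad s
    _ = ENNReal.ofReal ((2 / 3 : ℝ) ^ s * ((s : ℝ) + 1) ^ 2 * B) := by
        rw [← ENNReal.ofReal_pow (by norm_num), ← ENNReal.ofReal_mul (by positivity)]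
        congr 1
        have : (2 / 3 : ℝ) ^ s = 4 ^ s * (1 / 6) ^ s := by rw [← mul_pow]; norm_num
        rw [this]
        ring

end Many

/-- Many good arms: small brackets already contain `2 k` of them. Wait for the first bracket `r0 +
s` that does not fail; it outputs `k` good arms within its budget. -/
lemma exists_countTime_bound {c : ℝ} (hc : 0 < c) : ∃ C : ℝ, 0 < C ∧
    ∀ {n : ℕ} {Ω : Type*} [MeasurableSpace Ω] {P : Measure Ω} [IsProbabilityMeasure P]
      {ν : Fin n → Measure ℝ} [∀ i, IsProbabilityMeasure (ν i)]
      {A : Ω → ℕ → Finset (Fin n)} {X : Ω → Fin n → ℕ → ℕ → ℝ} {I : Ω → ℕ → Fin n}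
      {lev : Ω → ℕ → ℝ} {out : Ω → ℕ → Finset (Fin n)} {μ : Fin n → ℝ} {μ₀ δ : ℝ} {k : ℕ},
      Setting P ν A X I lev out c μ μ₀ δ k → ∀ j : Fin n, μ₀ < μ j → 32 * k ≤ (j : ℕ) + 1 →
      ∫⁻ ω, (countTime out μ μ₀ k ω : ℝ≥0∞) ∂P ≤ ENNReal.ofReal (C * sampleBound μ μ₀ δ k j) := by
  classical
  obtain ⟨C1, hC1, hdone⟩ := exists_done_bound hc
  have hK := one_le_momentConst
  set D : ℝ := 2048 * C1 * momentConst with hD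
  have hD64 : 64 ≤ D := by nlinarith [mul_le_mul hC1 hK zero_le_one (by linarith)]
  obtain ⟨C2, hC2, htime⟩ := exists_time_bound (D := D) (by linarith)
  refine ⟨geomConst * C2, mul_pos geomConst_pos hC2, ?_⟩
  intro n Ω _ P _ ν _ A X I lev out μ μ₀ δ k hS j hj hjk
  have hn : 1 ≤ n := j.pos
  have hn' : (0 : ℝ) < n := by exact_mod_cast hn
  have hk' : (1 : ℝ) ≤ k := by exact_mod_cast hS.one_le
  have hjk' : 32 * (k : ℝ) ≤ (j : ℝ) + 1 := by exact_mod_cast hjk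
  set w := armWeight μ μ₀ δ k j with hw
  have hw1 : ∀ i, 1 ≤ w i := one_le_armWeight hS.mean_mem hS.threshold_mem hj
  have hw0 : ∀ i, 0 ≤ w i := fun i => zero_le_one.trans (hw1 i)
  set p : ℝ := n * k / ((j : ℝ) + 1) with hp
  set H := hFWER μ μ₀ δ k j with hH
  have hp1 : 1 ≤ p := one_le_bracket_ratio hS.one_le
  have hpH : p ≤ H := bracket_ratio_le_hFWER hS.mean_mem hS.threshold_mem hj
  have hH1 : 1 ≤ H := hp1.trans hpH
  have hexr : ∃ r : ℕ, 32 * p ≤ 2 ^ r := by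
    obtain ⟨r, hr⟩ := pow_unbounded_of_one_lt (32 * p) one_lt_two
    exact ⟨r, hr.le⟩
  -- The smallest bracket with an expected number of good arms of at least `32 k`; minimality gives
  -- `2 ^ r0 ≤ 64 p`.
  set r0 := Nat.find hexr with hr0
  have hr0le : 32 * p ≤ 2 ^ r0 := Nat.find_spec hexr
  have hr0pos : 1 ≤ r0 := by
    by_contra h0
    have : r0 = 0 := by omega
    rw [this] at hr0le
    norm_num at hr0le
    linarith
  have hr0ge : (2 : ℝ) ^ r0 ≤ 64 * p := by
    have := Nat.find_min hexr (show r0 - 1 < r0 by omega)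
    have e : (2 : ℝ) ^ r0 = 2 * 2 ^ (r0 - 1) := by rw [← pow_succ', Nat.sub_add_cancel hr0pos]
    rw [e]
    linarith [not_le.1 this]
  have h2r : ∀ s : ℕ, (2 : ℝ) ^ (r0 + s) ≤ 64 * 2 ^ s * p := fun s => by
    rw [pow_add]
    nlinarith [show (0 : ℝ) < 2 ^ s by positivity]
  -- `2048 = 32 * 64`: the Markov factor times the size bound `64 * 2 ^ s * p`, and `p / n` times
  -- the total weight equals `H`.
  set V : ℕ → ℝ := fun s => 2048 * momentConst * 2 ^ s * H with hV
  have hV0 : ∀ s, 0 < V s := fun s => by positivity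
  set J := Finset.Iic j with hJ
  have hJcard : (J.card : ℝ) = (j : ℝ) + 1 := by rw [hJ, Fin.card_Iic]; push_cast; rfl
  set F : ℕ → Finset (Fin n) → Set (Fin n → ℕ → ℝ) := fun r a =>
    failSet c ν δ k J w (V (r - r0)) a with hF
  set bad : ℕ → Ω → Prop := fun s ω =>
    IsModel.bracketSamples X (r0 + s) ω ∈ F (r0 + s) (A ω (r0 + s)) with hbad
  have hFmeas : ∀ r a, MeasurableSet (F r a) := fun r a => measurableSet_failSet J w _ a
  have hprob : ∀ s, P {ω | bad s ω} ≤ ENNReal.ofReal (1 / 6) := by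
    intro s
    refine measure_bracket_fail_le hS.model hS.anytime hS.subGaussian hS.pos hS.le hS.one_le hn J
      hw0 (hV0 _) (r0 + s) ?_ ?_
    · have hb : 32 * p ≤ ((min n (2 ^ (r0 + s)) : ℕ) : ℝ) := by
        push_cast
        -- Here `32 k ≤ j + 1` is used: it says `32 p ≤ n`, so capping brackets at `n` arms loses
        -- nothing.
        refine le_min ?_ (hr0le.trans (pow_le_pow_right₀ (by norm_num) (by omega)))
        rw [hp, ← mul_div_assoc, div_le_iff₀ (by positivity)]
        nlinarith
      rw [hJcard, le_div_iff₀ hn']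
      calc 32 * (k : ℝ) * n = 32 * p * ((j : ℝ) + 1) := by rw [hp]; field_simp
        _ ≤ _ := by gcongr
    · have hb : ((min n (2 ^ (r0 + s)) : ℕ) : ℝ) ≤ 64 * 2 ^ s * p := by
        refine le_trans ?_ (h2r s)
        push_cast
        exact min_le_right _ _
      have hsum : 0 ≤ ∑ i, w i := Finset.sum_nonneg fun i _ => hw0 i
      rw [Nat.add_sub_cancel_left]
      calc 32 * (momentConst * (((min n (2 ^ (r0 + s)) : ℕ) : ℝ) / n * ∑ i, w i))
          ≤ 32 * (momentConst * ((64 * 2 ^ s * p) / n * ∑ i, w i)) := by gcongr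
        _ = V s := by
          rw [hV, hH, hFWER_eq, hp]
          field_simp
          ring
  have hall : ∀ s, {ω | ∀ s' < s, bad s' ω}
      = {ω | ∀ r ∈ Finset.Ico r0 (r0 + s), IsModel.bracketSamples X r ω ∈ F r (A ω r)} := by
    intro s
    ext ω
    simp only [Set.mem_ofPred_eq, Finset.mem_Ico]
    constructor
    · intro h r hr
      have := h (r - r0) (by omega)
      simp only [hbad] at this
      rwa [Nat.add_sub_cancel' hr.1] at this
    · exact fun h s' hs' => h (r0 + s') ⟨by omega, by omega⟩
  have hsm : ∀ s, MeasurableSet {ω | bad s ω} := by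
    intro s
    have e : {ω | bad s ω} = ⋃ a : Finset (Fin n), ({ω | A ω (r0 + s) = a} ∩
        {ω | IsModel.bracketSamples X (r0 + s) ω ∈ F (r0 + s) a}) := by
      ext ω
      simp [hbad]
    rw [e]
    exact MeasurableSet.iUnion fun a =>
      ((hS.model.measurable_bracket (r0 + s)) (measurableSet_singleton a)).inter
        ((hS.model.measurable_bracketSamples (r0 + s)) (hFmeas _ a))
  have key := lintegral_le_of_geometric (P := P) (T := fun ω => (countTime out μ μ₀ k ω : ℝ≥0∞))
    (bad := bad) (B := C2 * (H * tlog H)) (by have := tlog_pos H; positivity)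
    (fun s => by
      have e : {ω | ∀ s' < s, bad s' ω} = ⋂ s' ∈ Finset.range s, {ω | bad s' ω} := by
        ext ω; simp
      rw [e]
      exact Finset.measurableSet_biInter _ fun s' _ => hsm s')
    (fun s => by
      rw [hall s, hS.model.measure_forall_bracket_mem _ hFmeas]
      calc ∏ r ∈ Finset.Ico r0 (r0 + s), P {ω | IsModel.bracketSamples X r ω ∈ F r (A ω r)}
          ≤ ∏ _r ∈ Finset.Ico r0 (r0 + s), ENNReal.ofReal (1 / 6) := by
            refine Finset.prod_le_prod' fun r hr => ?_
            have hr' := (Finset.mem_Ico.1 hr).1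
            have := hprob (r - r0)
            simp only [hbad] at this
            rwa [Nat.add_sub_cancel' hr'] at this
        _ = _ := by simp)
    (by
      filter_upwards [hdone hS j hj] with ω hω s hs
      have hs' : IsModel.bracketSamples X (r0 + s) ω ∉
        failSet c ν δ k J w (V s) (A ω (r0 + s)) := by
        have h' := hs
        simp only [hbad, hF, Nat.add_sub_cancel_left] at h'
        exact h'
      obtain ⟨hgood, hlev⟩ := card_good_of_notMem_failSet hs'
      -- With inflation `y = (s + 1) * 2 ^ s`, both `2 ^ (r0 + s)` and the budget are at most `D * y
      -- * H`, and `y ^ 2` is the growth `4 ^ s * (s + 1) ^ 2` of the geometric lemma.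
      have hy1 : (1 : ℝ) ≤ ((s : ℝ) + 1) * 2 ^ s :=
        one_le_mul_of_one_le_of_one_le (by linarith [Nat.cast_nonneg (α := ℝ) s])
          (one_le_pow₀ (by norm_num))
      obtain ⟨t, ht1, ht2⟩ := htime (r0 + s) (C1 * (s + 1) * V s) (((s : ℝ) + 1) * 2 ^ s) H
        (by omega) (by have := (hV0 s).le; positivity) hy1 hH1
        (by
          refine (h2r s).trans ?_
          have h0 : (0 : ℝ) ≤ s := Nat.cast_nonneg s
          calc 64 * 2 ^ s * p ≤ D * 2 ^ s * H := by gcongr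
            _ ≤ D * (((s : ℝ) + 1) * 2 ^ s) * H := by
              gcongr
              exact le_mul_of_one_le_left (by positivity) (by linarith))
        (by rw [hV, hD]; exact le_of_eq (by ring))
      obtain ⟨s', hs1, hst, hbr, hout⟩ := hω (r0 + s) s t (by omega) (h2r s)
        ((mul_le_mul_of_nonneg_left hlev (by positivity)).trans_lt ht1)
      have hcount : k ≤ (out ω s' ∩ armsAbove μ μ₀).card := by
        refine hgood.trans (Finset.card_le_card fun g hg => ?_)
        obtain ⟨hg1, hg2⟩ := Finset.mem_filter.1 hg
        obtain ⟨hgA, hgJ⟩ := Finset.mem_inter.1 hg1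
        refine Finset.mem_inter.2 ⟨?_, Iic_subset_armsAbove hS.antitone hj hgJ⟩
        rcases hout g hgA with h | ⟨h1, h2⟩
        · exact h
        · rw [← hbr] at h1 hg2
          exact absurd hg2 (notMem_confSet_of_ucb_lt (hS.mean_eq g)
            (hS.antitone (Finset.mem_Iic.1 hgJ)) h1 h2)
      have hle : countTime out μ μ₀ k ω ≤ (t : ℕ∞) :=
        (firstTime_le_of_mem (S := {t | 1 ≤ t ∧ k ≤ (out ω t ∩ armsAbove μ μ₀).card})
          ⟨hs1, hcount⟩).trans (by exact_mod_cast hst.le)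
      calc (countTime out μ μ₀ k ω : ℝ≥0∞) ≤ ((t : ℕ∞) : ℝ≥0∞) := by exact_mod_cast hle
        _ = ENNReal.ofReal t := by simp
        _ ≤ _ := by
          refine ENNReal.ofReal_le_ofReal (ht2.trans (le_of_eq ?_))
          have : (4 : ℝ) ^ s = 2 ^ s * 2 ^ s := by rw [← mul_pow]; norm_num
          rw [this]
          ring)
  refine key.trans (ENNReal.ofReal_le_ofReal ?_)
  rw [mul_assoc]
  have := hFWER_mul_tlog_le_sampleBound (δ := δ) hS.mean_mem hS.threshold_mem hS.one_le hj
  have := geomConst_pos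
  gcongr

/-! ### Detection from a bracket that contains all arms -/

/-- The first round by which every arm `g ≤ j` has been output or had an upper confidence bound below
`μ j` in bracket `r`. -/
def settleTime {n : ℕ} {Ω : Type*} (c δ : ℝ) (X : Ω → Fin n → ℕ → ℕ → ℝ) (I : Ω → ℕ → Fin n)
    (out : Ω → ℕ → Finset (Fin n)) (μ : Fin n → ℝ) (j : Fin n) (r : ℕ) (ω : Ω) : ℕ∞ :=
  firstTime {t | 1 ≤ t ∧ ∀ g ∈ Finset.Iic j, g ∈ out ω t ∨ ∃ s ∈ Finset.Icc 1 t, bracket s = r ∧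
    0 < pulls (I ω) g r s ∧ ucb c δ (X ω) (I ω) s g < μ j}

lemma isStoppingTime_settleTime {n : ℕ} {Ω : Type*} [mΩ : MeasurableSpace Ω]
    {X : Ω → Fin n → ℕ → ℕ → ℝ} {I : Ω → ℕ → Fin n} {out : Ω → ℕ → Finset (Fin n)}
    {hX : ∀ t, Measurable fun ω => reward (X ω) (I ω) t} {hI : Measurable I}
    {hout : ∀ t, Measurable fun ω => out ω t} (c δ : ℝ) (μ : Fin n → ℝ) (j : Fin n) (r : ℕ) :
    IsStoppingTime (playFiltration X I out hX hI hout) (settleTime c δ X I out μ j r) := by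
  refine isStoppingTime_firstTime _ (cond := fun t ω => 1 ≤ t ∧
    ∀ g ∈ Finset.Iic j, g ∈ out ω t ∨ ∃ s ∈ Finset.Icc 1 t, bracket s = r ∧
    0 < pulls (I ω) g r s ∧ ucb c δ (X ω) (I ω) s g < μ j) fun t => ?_
  by_cases ht : 1 ≤ t
  · simp only [ht, true_and]
    have e : {ω | ∀ g ∈ Finset.Iic j, g ∈ out ω t ∨ ∃ s ∈ Finset.Icc 1 t, bracket s = r ∧
        0 < pulls (I ω) g r s ∧ ucb c δ (X ω) (I ω) s g < μ j}
        = ⋂ g ∈ Finset.Iic j, ({ω | g ∈ out ω t} ∪ ⋃ s ∈ Finset.Icc 1 t, ({_ω | bracket s = r} ∩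
          ({ω | 0 < pulls (I ω) g r s} ∩ {ω | ucb c δ (X ω) (I ω) s g < μ j}))) := by
      ext ω
      simp only [Set.mem_ofPred_eq, Set.mem_iInter, Set.mem_union, Set.mem_iUnion, Set.mem_inter_iff,
        exists_prop]
    rw [e]
    refine Finset.measurableSet_biInter _ fun g _ => MeasurableSet.union ?_ ?_
    · have h := measurable_play_out (X := X) (I := I) (out := out) (hX := hX) (hI := hI)
        (hout := hout) ht le_rfl
      exact h (Set.to_countable {B : Finset (Fin n) | g ∈ B}).measurableSet
    · refine Finset.measurableSet_biUnion _ fun s hs => ?_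
      have hst : s ≤ t + 1 := by have := (Finset.mem_Icc.1 hs).2; omega
      have h1 := measurable_play_pulls (X := X) (I := I) (out := out) (hX := hX) (hI := hI)
        (hout := hout) g r hst
      have h2 := measurable_play_ucb (X := X) (I := I) (out := out) (hX := hX) (hI := hI)
        (hout := hout) c δ g hst
      exact (MeasurableSet.const _).inter ((h1 (Set.to_countable {u : ℕ | 0 < u}).measurableSet).inter
        (h2 measurableSet_Iio))
  · simp [ht]

section Settle

variable {n : ℕ} {Ω : Type*} [MeasurableSpace Ω] {P : Measure Ω}
  {ν : Fin n → Measure ℝ} {A : Ω → ℕ → Finset (Fin n)} {X : Ω → Fin n → ℕ → ℕ → ℝ}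
  {I : Ω → ℕ → Fin n} {lev : Ω → ℕ → ℝ} {out : Ω → ℕ → Finset (Fin n)} {c : ℝ} {μ : Fin n → ℝ}
  {μ₀ δ : ℝ} {k : ℕ}

/-- Every good arm that is still missing had an upper bound below `μ j` in bracket `r`, hence
violates its bound there. Using a single bracket means one sample sequence per arm, so at most `δ (j
+ 1)` violations are expected and `(1 - δ) (j + 1) ≥ (1 - δ) k` remain. -/
lemma Setting.le_integral_of_settleTime_le [IsProbabilityMeasure P]
    [∀ i, IsProbabilityMeasure (ν i)] (hS : Setting P ν A X I lev out c μ μ₀ δ k)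
    (hout : ∀ t, Measurable fun ω => out ω t) {j : Fin n} (hj : μ₀ < μ j) (hk : k ≤ (j : ℕ) + 1)
    {r : ℕ} {σ : Ω → ℕ} (hσ : Measurable σ)
    (h : ∀ᵐ ω ∂P, settleTime c δ X I out μ j r ω ≤ (σ ω : ℕ∞)) :
    (1 - δ) * k ≤ ∫ ω, ((out ω (σ ω) ∩ armsAbove μ μ₀).card : ℝ) ∂P := by
  classical
  set J := Finset.Iic j with hJ
  have hJcard : J.card = (j : ℕ) + 1 := by rw [hJ, Fin.card_Iic]
  set bad : Ω → ℕ := fun ω => {g ∈ J | X ω g r ∉ confSet c (ν g) δ}.card with hbad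
  have hbadm : Measurable bad :=
    (measurable_card_bad (ν := ν) (c := c) (δ := δ) J).comp (hS.model.measurable_bracketSamples r)
  have hbadm' : Measurable fun ω => (bad ω : ℝ) :=
    (measurable_of_countable (fun q : ℕ => (q : ℝ))).comp hbadm
  have hbadint : Integrable (fun ω => (bad ω : ℝ)) P := by
    refine Integrable.of_bound hbadm'.aestronglyMeasurable (J.card : ℝ) (ae_of_all _ fun ω => ?_)
    rw [Real.norm_of_nonneg (Nat.cast_nonneg _)]
    exact_mod_cast Finset.card_filter_le _ _
  have hbadle : ∫ ω, (bad ω : ℝ) ∂P ≤ J.card * δ := by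
    rw [integral_eq_lintegral_of_nonneg_ae (ae_of_all _ fun ω => Nat.cast_nonneg _)
      hbadm'.aestronglyMeasurable]
    refine ENNReal.toReal_le_of_le_ofReal (mul_nonneg (Nat.cast_nonneg _) hS.pos.le) ?_
    rw [ENNReal.ofReal_mul (Nat.cast_nonneg _), ENNReal.ofReal_natCast]
    simp only [ENNReal.ofReal_natCast]
    exact lintegral_card_bad_le hS.model hS.anytime hS.subGaussian hS.pos (by linarith [hS.le]) J r
  have h1 : ∀ᵐ ω ∂P, (J.card : ℝ) - bad ω ≤ ((out ω (σ ω) ∩ armsAbove μ μ₀).card : ℝ) := by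
    filter_upwards [h, hS.run] with ω hω hrun
    obtain ⟨t, ⟨-, ht⟩, htσ⟩ := firstTime_le_iff.1 hω
    have hsub : J ⊆ (out ω (σ ω) ∩ armsAbove μ μ₀) ∪ {g ∈ J | X ω g r ∉ confSet c (ν g) δ} := by
      intro g hg
      rw [Finset.mem_union]
      rcases ht g hg with h2 | ⟨s, -, rfl, h3, h4⟩
      · exact Or.inl (Finset.mem_inter.2
          ⟨hrun.mono htσ h2, Iic_subset_armsAbove hS.antitone hj hg⟩)
      · exact Or.inr (Finset.mem_filter.2 ⟨hg, notMem_confSet_of_ucb_lt (hS.mean_eq g)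
          (hS.antitone (Finset.mem_Iic.1 hg)) h3 h4⟩)
    have h5 := (Finset.card_le_card hsub).trans (Finset.card_union_le _ _)
    rw [sub_le_iff_le_add]
    exact_mod_cast h5
  have h2 := integral_mono_ae ((integrable_const (J.card : ℝ)).sub hbadint)
    (integrable_card_out hout hσ (armsAbove μ μ₀)) h1
  simp only [Pi.sub_apply] at h2
  rw [integral_sub (integrable_const _) hbadint] at h2
  simp only [integral_const, probReal_univ, one_smul] at h2
  have hkJ : (k : ℝ) ≤ J.card := by rw [hJcard]; exact_mod_cast hk
  have hδ := hS.le
  nlinarith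

end Settle

lemma exists_two_pow_ge {n : ℕ} (hn : 1 ≤ n) : ∃ r : ℕ, 1 ≤ r ∧ n ≤ 2 ^ r ∧ 2 ^ r ≤ 2 * n := by
  rcases Nat.lt_or_ge n 2 with h | h
  · exact ⟨1, le_rfl, by omega, by omega⟩
  · refine ⟨Nat.clog 2 n, Nat.clog_pos (by norm_num) h, Nat.le_pow_clog (by norm_num) n, ?_⟩
    have h1 := Nat.pow_pred_clog_lt_self (b := 2) (by norm_num) h
    have h2 := Nat.clog_pos (b := 2) (by norm_num) h
    have e : 2 ^ Nat.clog 2 n = 2 * 2 ^ (Nat.clog 2 n).pred := by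
      rw [← pow_succ', ← Nat.succ_eq_add_one, Nat.succ_pred_eq_of_pos h2]
    omega

/-- Few good arms relative to `k`: one bracket containing every arm is used, and there is no waiting
for a favourable one. Its size and weight are at most constant multiples of `H`, and the random
inflation enters only through its second moment. -/
lemma exists_settleTime_bound {c : ℝ} (hc : 0 < c) : ∃ C : ℝ, 0 < C ∧
    ∀ {n : ℕ} {Ω : Type*} [MeasurableSpace Ω] {P : Measure Ω} [IsProbabilityMeasure P]
      {ν : Fin n → Measure ℝ} [∀ i, IsProbabilityMeasure (ν i)]
      {A : Ω → ℕ → Finset (Fin n)} {X : Ω → Fin n → ℕ → ℕ → ℝ} {I : Ω → ℕ → Fin n}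
      {lev : Ω → ℕ → ℝ} {out : Ω → ℕ → Finset (Fin n)} {μ : Fin n → ℝ} {μ₀ δ : ℝ} {k : ℕ},
      Setting P ν A X I lev out c μ μ₀ δ k → ∀ j : Fin n, μ₀ < μ j → (j : ℕ) + 1 ≤ 32 * k →
      ∃ r : ℕ, ∫⁻ ω, (settleTime c δ X I out μ j r ω : ℝ≥0∞) ∂P
        ≤ ENNReal.ofReal (C * sampleBound μ μ₀ δ k j) := by
  obtain ⟨C1, hC1, hdone⟩ := exists_done_bound hc
  have hK := one_le_momentConst
  set D : ℝ := 64 * C1 with hD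
  obtain ⟨C2, hC2, htime⟩ := exists_time_bound (D := D) (by linarith)
  refine ⟨C2 * momentConst, by positivity, ?_⟩
  intro n Ω _ P _ ν _ A X I lev out μ μ₀ δ k hS j hj hjk
  have hn : 1 ≤ n := j.pos
  have hn' : (0 : ℝ) < n := by exact_mod_cast hn
  have hk' : (1 : ℝ) ≤ k := by exact_mod_cast hS.one_le
  have hjk' : (j : ℝ) + 1 ≤ 32 * k := by exact_mod_cast hjk
  set w := armWeight μ μ₀ δ k j with hw
  have hw1 : ∀ i, 1 ≤ w i := one_le_armWeight hS.mean_mem hS.threshold_mem hj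
  have hw0 : ∀ i, 0 ≤ w i := fun i => zero_le_one.trans (hw1 i)
  set p : ℝ := n * k / ((j : ℝ) + 1) with hp
  set H := hFWER μ μ₀ δ k j with hH
  have hp1 : 1 ≤ p := one_le_bracket_ratio hS.one_le
  have hpH : p ≤ H := bracket_ratio_le_hFWER hS.mean_mem hS.threshold_mem hj
  have hH1 : 1 ≤ H := hp1.trans hpH
  set W := ∑ i, w i with hWdef
  have hW : 0 < W :=
    Finset.sum_pos (fun i _ => zero_lt_one.trans_le (hw1 i)) ⟨j, Finset.mem_univ j⟩
  have hWH : W ≤ 32 * H := by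
    -- The total weight is `(j + 1) / k` times the complexity, and this ratio is at most `32` in
    -- this regime.
    have e : W = ((j : ℝ) + 1) / k * H := by
      rw [hH, hFWER_eq]
      field_simp
      rfl
    rw [e]
    gcongr
    rwa [div_le_iff₀ (by linarith)]
  obtain ⟨r, hr1, hnr, hrn⟩ := exists_two_pow_ge hn
  have h2r : (2 : ℝ) ^ r ≤ 64 * 2 ^ (0 : ℕ) * p := by
    have h1 : (2 : ℝ) ^ r ≤ 2 * n := by exact_mod_cast hrn
    have h2 : (n : ℝ) ≤ 32 * p := by
      rw [hp, ← mul_div_assoc, le_div_iff₀ (by positivity)]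
      nlinarith
    linarith
  refine ⟨r, ?_⟩
  -- The level sum relative to the plain weight; its second moment is at most `momentConst`.
  set y : Ω → ℝ := fun ω => levelSum c ν w Finset.univ (IsModel.bracketSamples X r ω) / W with hy
  have hlev : ∀ ω, levelSum c ν w Finset.univ (IsModel.bracketSamples X r ω) = y ω * W :=
    fun ω => by rw [hy]; field_simp
  have hy1 : ∀ ω, 1 ≤ y ω := fun ω => by
    rw [hy, one_le_div hW]
    refine Finset.sum_le_sum fun i _ => le_mul_of_one_le_left (hw0 i) ?_
    linarith [Nat.cast_nonneg (α := ℝ) (confLevel c (ν i) (IsModel.bracketSamples X r ω i))]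
  have hT : 0 ≤ H * tlog H := mul_nonneg (by linarith) (tlog_pos H).le
  have hpt : ∀ᵐ ω ∂P, (settleTime c δ X I out μ j r ω : ℝ≥0∞)
      ≤ ENNReal.ofReal (C2 * (H * tlog H) / W ^ 2)
        * ENNReal.ofReal (levelSum c ν w Finset.univ (IsModel.bracketSamples X r ω) ^ 2) := by
    filter_upwards [hdone hS j hj, hS.model.ae_card_bracket r] with ω hω hcard
    have hA : A ω r = Finset.univ := by
      rw [← Finset.card_eq_iff_eq_univ, hcard, Fintype.card_fin]
      exact min_eq_left hnr
    have hy0 := hy1 ω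
    obtain ⟨t, ht1, ht2⟩ := htime r (C1 * ((0 : ℕ) + 1) * (y ω * W)) (y ω) H hr1
      (by push_cast; positivity) hy0 hH1
      (by
        calc (2 : ℝ) ^ r ≤ 64 * 1 * 1 * H := by linarith
          _ ≤ 64 * C1 * y ω * H := by gcongr)
      (by
        calc C1 * (((0 : ℕ) : ℝ) + 1) * (y ω * W) = C1 * (y ω * W) := by push_cast; ring
          _ ≤ C1 * (y ω * (32 * H)) := by gcongr
          _ ≤ D * y ω * H := by
            have : 0 ≤ C1 * y ω * H := by positivity
            rw [hD]
            linarith)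
    obtain ⟨s, hs1, hst, hbr, hout⟩ := hω r 0 t hr1 h2r (by rw [hA, hlev]; exact ht1)
    have hle : settleTime c δ X I out μ j r ω ≤ (t : ℕ∞) := by
      refine le_trans (firstTime_le_of_mem (t := s) ⟨hs1, fun g _ => ?_⟩)
        (by exact_mod_cast hst.le)
      rcases hout g (by rw [hA]; exact Finset.mem_univ g) with h | h
      · exact Or.inl h
      · exact Or.inr ⟨s, Finset.mem_Icc.2 ⟨hs1, le_rfl⟩, hbr, h⟩
    calc (settleTime c δ X I out μ j r ω : ℝ≥0∞) ≤ ((t : ℕ∞) : ℝ≥0∞) := by exact_mod_cast hle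
      _ = ENNReal.ofReal t := by simp
      _ ≤ _ := by
        rw [← ENNReal.ofReal_mul (by positivity)]
        refine ENNReal.ofReal_le_ofReal (ht2.trans (le_of_eq ?_))
        rw [hlev]
        field_simp
  calc ∫⁻ ω, (settleTime c δ X I out μ j r ω : ℝ≥0∞) ∂P
      ≤ ∫⁻ ω, ENNReal.ofReal (C2 * (H * tlog H) / W ^ 2)
        * ENNReal.ofReal (levelSum c ν w Finset.univ (IsModel.bracketSamples X r ω) ^ 2) ∂P :=
        lintegral_mono_ae hpt
    _ = ENNReal.ofReal (C2 * (H * tlog H) / W ^ 2) * ∫⁻ ω,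
        ENNReal.ofReal (levelSum c ν w Finset.univ (IsModel.bracketSamples X r ω) ^ 2) ∂P :=
        lintegral_const_mul' _ _ ENNReal.ofReal_ne_top
    _ ≤ ENNReal.ofReal (C2 * (H * tlog H) / W ^ 2) * ENNReal.ofReal (momentConst * W ^ 2) := by
        gcongr
        exact lintegral_levelSum_sq_le hS.model hS.anytime hS.subGaussian hw0 _ r
    _ = ENNReal.ofReal (C2 * momentConst * (H * tlog H)) := by
        rw [← ENNReal.ofReal_mul (by positivity)]
        congr 1
        field_simp
    _ ≤ _ := by
        have := hFWER_mul_tlog_le_sampleBound (δ := δ) hS.mean_mem hS.threshold_mem hS.one_le hj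
        gcongr

/-! ### The detection guarantees -/

lemma sampleBound_nonneg {n : ℕ} {μ : Fin n → ℝ} {μ₀ δ : ℝ} {k : ℕ} {j : Fin n}
    (hμ : ∀ i, μ i ∈ Set.Icc (0 : ℝ) 1) (hμ₀ : μ₀ ∈ Set.Icc (0 : ℝ) 1) (hk : 1 ≤ k)
    (hj : μ₀ < μ j) : 0 ≤ sampleBound μ μ₀ δ k j := by
  have h1 : 1 ≤ hFWER μ μ₀ δ k j :=
    (one_le_bracket_ratio (n := n) (j := j) hk).trans (bracket_ratio_le_hFWER hμ hμ₀ hj)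
  exact (mul_nonneg (by linarith) (tlog_pos _).le).trans
    (hFWER_mul_tlog_le_sampleBound hμ hμ₀ hk hj)

lemma exists_detects {c : ℝ} (hc : 0 < c) : ∃ C : ℝ, 0 < C ∧
    ∀ {n : ℕ} {Ω : Type*} [MeasurableSpace Ω] {P : Measure Ω} [IsProbabilityMeasure P]
      {ν : Fin n → Measure ℝ} [∀ i, IsProbabilityMeasure (ν i)]
      {A : Ω → ℕ → Finset (Fin n)} {X : Ω → Fin n → ℕ → ℕ → ℝ} {I : Ω → ℕ → Fin n}
      {lev : Ω → ℕ → ℝ} {out : Ω → ℕ → Finset (Fin n)} {μ : Fin n → ℝ} {μ₀ δ : ℝ} {k : ℕ}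
      (hX : ∀ t, Measurable fun ω => reward (X ω) (I ω) t) (hI : Measurable I)
      (hout : ∀ t, Measurable fun ω => out ω t),
      Setting P ν A X I lev out c μ μ₀ δ k → k ≤ (armsAbove μ μ₀).card →
      Detects P (playFiltration X I out hX hI hout) out μ μ₀ δ k C := by
  obtain ⟨C1, hC1, hmany⟩ := exists_countTime_bound hc
  obtain ⟨C2, hC2, hfew⟩ := exists_settleTime_bound hc
  refine ⟨max C1 C2, lt_max_of_lt_left hC1, ?_⟩
  intro n Ω _ P _ ν _ A X I lev out μ μ₀ δ k hX hI hout hS hkm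
  set S : Finset (Fin n) := {j | k ≤ (j : ℕ) + 1 ∧ (j : ℕ) + 1 ≤ (armsAbove μ μ₀).card} with hSdef
  have hmem : ∀ {j}, j ∈ S ↔ k ≤ (j : ℕ) + 1 ∧ (j : ℕ) + 1 ≤ (armsAbove μ μ₀).card := by
    simp [hSdef]
  have hk := hS.one_le
  have hne : S.Nonempty := by
    have hcn : (armsAbove μ μ₀).card ≤ n := (Finset.card_le_univ _).trans (by simp)
    exact ⟨⟨k - 1, by omega⟩, hmem.2 ⟨by simp only; omega, by simp only; omega⟩⟩
  -- One stopping time has to serve all ranks at once, so it is built for a minimiser `j` of the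
  -- bound, which also decides the regime.
  obtain ⟨j, hjS, hmin⟩ := S.exists_min_image (sampleBound μ μ₀ δ k) hne
  obtain ⟨hkj, hjm⟩ := hmem.1 hjS
  have hj : μ₀ < μ j := lt_mean_of_le_card hS.antitone hjm
  have hB := sampleBound_nonneg (δ := δ) hS.mean_mem hS.threshold_mem hk hj
  have hbound : ∀ {T : ℝ≥0∞} {C : ℝ}, C ≤ max C1 C2 →
      T ≤ ENNReal.ofReal (C * sampleBound μ μ₀ δ k j) → ∀ i : Fin n, k ≤ (i : ℕ) + 1 →
      (i : ℕ) + 1 ≤ (armsAbove μ μ₀).card →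
      T ≤ ENNReal.ofReal (max C1 C2 * sampleBound μ μ₀ δ k i) := by
    intro T C hC hT i hi1 hi2
    exact hT.trans (ENNReal.ofReal_le_ofReal (mul_le_mul hC (hmin i (hmem.2 ⟨hi1, hi2⟩)) hB
      (hC1.le.trans (le_max_left _ _))))
  rcases Nat.le_total (32 * k) ((j : ℕ) + 1) with h | h
  · exact ⟨countTime out μ μ₀ k, isStoppingTime_countTime μ μ₀ k,
      hbound (le_max_left _ _) (hmany hS j hj h),
      fun σ hσ hle => hS.le_integral_of_countTime_le hout hσ hle⟩
  · obtain ⟨r, hr⟩ := hfew hS j hj h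
    exact ⟨settleTime c δ X I out μ j r, isStoppingTime_settleTime c δ μ j r,
      hbound (le_max_right _ _) hr,
      fun σ hσ hle => hS.le_integral_of_settleTime_le hout hj hkj hσ hle⟩

end InfiniteUCB

end

/-! ### The theorem. -/

theorem mainTheorem4 :
    (∃ cU : ℝ, 0 < cU ∧ IsAnytimeBound cU) ∧
    ∀ cU : ℝ, IsAnytimeBound cU → ∃ C : ℝ, 0 < C ∧
      ∀ (n : ℕ) (ν : Fin n → Measure ℝ) (μ : Fin n → ℝ) (μ₀ δ : ℝ) (k : ℕ),
        (∀ i, IsProbabilityMeasure (ν i)) →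
        (∀ i, IsOneSubGaussian (ν i)) →
        (∀ i, μ i = ∫ y, y ∂(ν i)) →
        Antitone μ →
        (∀ i, μ i ∈ Set.Icc (0 : ℝ) 1) →
        μ₀ ∈ Set.Icc (0 : ℝ) 1 →
        0 < δ → δ ≤ 1 / 40 →
        1 ≤ k → k ≤ (armsAbove μ μ₀).card →
        ∀ (Ω : Type*) [MeasurableSpace Ω] (P : Measure Ω) [IsProbabilityMeasure P]
          (A : Ω → ℕ → Finset (Fin n)) (X : Ω → Fin n → ℕ → ℕ → ℝ) (hM : IsModel P ν A X)
          (I : Ω → ℕ → Fin n) (hI : Measurable I),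
          ((∀ᵐ ω ∂P, IsFWERRun cU μ₀ δ (A ω) (X ω) (I ω)) →
            P {ω | ∃ t, (fwerSet cU μ₀ δ (A ω) (X ω) (I ω) t ∩ armsBelow μ μ₀).Nonempty}
                ≤ ENNReal.ofReal (2 * δ) ∧
            Detects P (fwerFiltration hM hI cU μ₀ δ)
              (fun ω => fwerSet cU μ₀ δ (A ω) (X ω) (I ω)) μ μ₀ δ k C) ∧
          ((∀ᵐ ω ∂P, IsFDRRun cU μ₀ δ (A ω) (X ω) (I ω)) →
            Detects P (fdrFiltration hM hI cU μ₀ δ)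
              (fun ω => fdrSet cU μ₀ δ (A ω) (X ω) (I ω)) μ μ₀ δ k C) := by
  refine ⟨⟨5, by norm_num, isAnytimeBound_five⟩, fun cU hc => ?_⟩
  obtain ⟨C, hC, hdet⟩ := exists_detects hc.pos
  refine ⟨C, hC, ?_⟩
  intro n ν μ μ₀ δ k hprob hν hmean hanti hμ hμ₀ hδ hδ' hk hkm Ω _ P _ A X hM I hI
  have hn : 1 ≤ n := hk.trans (hkm.trans ((Finset.card_le_univ _).trans (by simp)))
  have hcard : ∀ᵐ ω ∂P, ∀ r, 1 ≤ (A ω r).card ∧ (A ω r).card ≤ 2 ^ r := by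
    filter_upwards [ae_all_iff.2 hM.ae_card_bracket] with ω h r
    rw [h r]
    exact ⟨le_min hn Nat.one_le_two_pow, min_le_right _ _⟩
  refine ⟨fun hrun => ⟨measure_fwer_error_le hM I hc hν hmean μ₀ hδ hδ' hn, ?_⟩, fun hrun => ?_⟩
  · refine hdet _ hI _ (lev := fun ω r => δ / ((A ω r).card * (r : ℝ) ^ 2))
      ⟨hc, hν, hmean, hanti, hμ, hμ₀, hδ, hδ', hk, hM, ?_, ?_⟩ hkm
    · filter_upwards [hrun] with ω h
      exact h.isRun
    · filter_upwards [hcard] with ω h r hr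
      exact levelBound_fwer hδ (by linarith) hr (h r).1 (h r).2
  · refine hdet _ hI _ (lev := fun ω r => ((1 : ℕ) : ℝ) / (A ω r).card * fdrLevel δ r)
      ⟨hc, hν, hmean, hanti, hμ, hμ₀, hδ, hδ', hk, hM, ?_, ?_⟩ hkm
    · filter_upwards [hrun] with ω h
      exact h.isRun hc.pos.le hδ
    · filter_upwards [hcard] with ω h r hr
      exact levelBound_fdr hδ (by linarith) hr (h r).1 (h r).2
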